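/- For a simple directed graph $G=(V,A)$ with $n$ vertices (no loops, no parallel arcs; opposite arcs $(u,v)$ and $(v,u)$ may both be present) and an ordering $\pi$ of $V$, that is, a bijection $\pi\colon V\to\{1,\dots,n\}$, let $$\mathrm{width}_G(\pi)=\max_{1\le i\le n-1}\bigl|\{v\in V : \pi(v)\le i \text{ and there is } u\in V \text{ with } \pi(u)>i \text{ and } (u,v)\in A\}\bigr|$$ (with value $0$ if $n\le 1$), and let $\mathrm{opt}(G)=\min_\pi \mathrm{width}_G(\pi)$. The problem Directed Pathwidth asks, given $G$, for an ordering $\pi$ of minimum width. **Theorem.** Directed Pathwidth can be $2$-approximated in $O(1.66^n)$ time. That is, there are a deterministic algorithm (a program for a random access machine, where each elementary operation is charged one unit plus the bit lengths of the numbers involved) and a constant $C$ such that, for every $n\ge 0$ and every simple directed graph $G$ on $n$ vertices given by its adjacency matrix, the algorithm halts after a computation of total cost at most $C\cdot 1.66^n$ and outputs an ordering $\pi$ of the vertices of $G$ with $\mathrm{width}_G(\pi)\le 2\cdot\mathrm{opt}(G)$. -/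

import Mathlib

/-! ### Directed pathwidth, as a vertex-ordering problem -/

/-- The width of an ordering `π` of the vertices of `G`: the maximum over the cut positions
`1 ≤ i ≤ n - 1` of the number of vertices among the first `i` that have an in-neighbour
after the first `i`.  Positions are counted from `0`, so the first `i` vertices
are those with `π v < i`.  The maximum over no position at all (`n ≤ 1`) is `0`. -/
noncomputable def orderingWidth {V : Type*} {n : ℕ} (G : Digraph V) (π : V ≃ Fin n) : ℕ :=
  (Finset.Icc 1 (n - 1)).sup fun i =>
    Set.ncard {v : V | (π v : ℕ) < i ∧ ∃ u : V, i ≤ (π u : ℕ) ∧ G.Adj u v}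

/-- The optimum of Directed Pathwidth on a digraph with vertex set `{0, …, n - 1}`: the minimum
width of an ordering (a minimum over a nonempty set of natural numbers). -/
noncomputable def directedPathwidth {n : ℕ} (G : Digraph (Fin n)) : ℕ :=
  ⨅ σ : Fin n ≃ Fin n, orderingWidth G σ

/-! ### Random access machine with logarithmic cost

Programs are deterministic structured programs over registers and a random access memory, both
holding natural numbers.  A program mentions finitely many registers.  Every elementary
operation costs one unit plus the bit length of the value it produces (so the operands and the
addresses used are charged by their bit lengths, too). -/

namespace RAM

/-- The contents of the registers and of the memory cells. -/
structure State where
  reg : ℕ → ℕ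
  mem : ℕ → ℕ

/-- Arithmetic operations: truncated subtraction, and division rounding down. -/
inductive Op
  | add
  | sub
  | mul
  | div

def Op.eval : Op → ℕ → ℕ → ℕ
  | .add, x, y => x + y
  | .sub, x, y => x - y
  | .mul, x, y => x * y
  | .div, x, y => x / y

/-- Expressions: constants, register contents, memory contents at a computed address, and
arithmetic operations. -/
inductive Expr
  | const (c : ℕ)
  | reg (r : ℕ)
  | read (a : Expr)
  | op (o : Op) (e₁ e₂ : Expr)

/-- The value of an expression. -/
def Expr.eval (s : State) : Expr → ℕ
  | .const c => c
  | .reg r => s.reg r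
  | .read a => s.mem (a.eval s)
  | .op o e₁ e₂ => o.eval (e₁.eval s) (e₂.eval s)

/-- The cost of evaluating an expression. -/
def Expr.cost (s : State) : Expr → ℕ
  | .const c => 1 + Nat.size c
  | .reg r => 1 + Nat.size (s.reg r)
  | .read a => a.cost s + (1 + Nat.size (s.mem (a.eval s)))
  | .op o e₁ e₂ =>
      e₁.cost s + e₂.cost s + (1 + Nat.size (o.eval (e₁.eval s) (e₂.eval s)))

/-- Programs.  `assign r e` stores the value of `e` in register `r`; `write a e` stores the value
of `e` in the memory cell whose address is the value of `a`; `ite c p q` runs `p` if the value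
of `c` is nonzero and `q` otherwise; `loop c p` runs `p` as long as the value of `c` is
nonzero. -/
inductive Prog
  | skip
  | assign (r : ℕ) (e : Expr)
  | write (a e : Expr)
  | seq (p q : Prog)
  | ite (c : Expr) (p q : Prog)
  | loop (c : Expr) (p : Prog)

/-- `Exec p s t s'`: started in state `s`, the program `p` halts in state `s'`, and the
total cost of the run is `t`. -/
inductive Exec : Prog → State → ℕ → State → Prop
  | skip (s : State) : Exec .skip s 1 s
  | assign (r : ℕ) (e : Expr) (s : State) :
      Exec (.assign r e) s (1 + e.cost s) ⟨Function.update s.reg r (e.eval s), s.mem⟩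
  | write (a e : Expr) (s : State) :
      Exec (.write a e) s (1 + a.cost s + e.cost s)
        ⟨s.reg, Function.update s.mem (a.eval s) (e.eval s)⟩
  | seq {p q : Prog} {s₁ s₂ s₃ : State} {t₁ t₂ : ℕ} :
      Exec p s₁ t₁ s₂ → Exec q s₂ t₂ s₃ → Exec (.seq p q) s₁ (t₁ + t₂) s₃
  | ite_true {c : Expr} {p q : Prog} {s s' : State} {t : ℕ} :
      c.eval s ≠ 0 → Exec p s t s' → Exec (.ite c p q) s (1 + c.cost s + t) s'
  | ite_false {c : Expr} {p q : Prog} {s s' : State} {t : ℕ} :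
      c.eval s = 0 → Exec q s t s' → Exec (.ite c p q) s (1 + c.cost s + t) s'
  | loop_done {c : Expr} {p : Prog} {s : State} :
      c.eval s = 0 → Exec (.loop c p) s (1 + c.cost s) s
  | loop_step {c : Expr} {p : Prog} {s₁ s₂ s₃ : State} {t₁ t₂ : ℕ} :
      c.eval s₁ ≠ 0 → Exec p s₁ t₁ s₂ → Exec (.loop c p) s₂ t₂ s₃ →
        Exec (.loop c p) s₁ (1 + c.cost s₁ + t₁ + t₂) s₃

open Classical in
/-- The initial state for the digraph `G` on `{0, …, n - 1}`: register `0` holds `n`, the memory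
holds the adjacency matrix row by row (cell `u * n + v` holds `1` if `(u, v)` is an arc of `G`
and `0` otherwise), and everything else is `0`. -/
noncomputable def graphInput {n : ℕ} (G : Digraph (Fin n)) : State where
  reg := fun r => if r = 0 then n else 0
  mem := fun a => if ∃ u v : Fin n, a = (u : ℕ) * n + (v : ℕ) ∧ G.Adj u v then 1 else 0

/-- The final state `s` holds the ordering `π` as output: cell `v` holds the position of `v`. -/
def OutputsOrdering {n : ℕ} (s : State) (π : Fin n ≃ Fin n) : Prop :=
  ∀ v : Fin n, s.mem (v : ℕ) = (π v : ℕ)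

end RAM

/-! Write b(Q) for the number of vertices of a set Q that have an in-neighbour outside Q. The width
of an ordering is the maximum of b over its prefixes. Put h = ⌊n/3⌋ and let W be the set of the
first 2h vertices. Along an optimal ordering the number of vertices of W in the prefix grows by at
most one per step, so some prefix meets W in exactly h vertices. Hence a set S minimising b among
all sets with |S ∩ W| = h has b(S) ≤ opt, and it is balanced: h ≤ |S| ≤ h + (n - 2h) = n - h.

The function b is submodular (`card_boundary_submodular`). If P runs through the prefixes of an
optimal ordering, the sets S ∩ P followed by the sets S ∪ P form a chain through S whose members
have b at most b(S) + b(P) ≤ 2·opt (`Table.top_le`). A bottleneck dynamic program over the sets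
comparable with S therefore finds an ordering of width at most 2·opt. There are at most 2^|S| +
2^(n-|S|) ≤ 2·2^(n-h) such sets. With the vertices of S assigned the lowest bits, their codes form
an easily enumerated sequence (`code_succ`).

To find S, all X ⊆ W with |X| = h are tried. For fixed X, minimising b over the sets with S ∩ W = X
is polynomial: b(S) is |S| minus the number of vertices whose closed in-neighbourhood lies in S, so
the problem is dual to a bipartite matching problem. An auction assigns to vertices v distinct free
vertices of their closed in-neighbourhoods and raises integer labels. Since n vertices cannot occupy
n + 1 label values, some value is unused, and the level set above it is optimal
(`Auction.exists_level`).

The search uses 2^(2h) ≤ 2^(n-h) rounds and the dynamic program 2·2^(n-h). Everything else is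
polynomial, and 2^(2/3) < 1.6 < 1.66. For the machine model, programs are written with counting
loops whose stored values are capped, so that `exec_den` gives both the final state and a cost bound
from the program text. -/

namespace RAM

/-! ### Counting programs

A language of programs whose only loops are counting loops.  Every stored value is truncated at
the content of register `1`, so that all numbers stay small by construction. -/

instance : Add Expr := ⟨Expr.op .add⟩
instance : Sub Expr := ⟨Expr.op .sub⟩
instance : Mul Expr := ⟨Expr.op .mul⟩
instance : Div Expr := ⟨Expr.op .div⟩
instance (c : ℕ) : OfNat Expr c := ⟨Expr.const c⟩

namespace Expr

@[simp] theorem eval_add (s : State) (a b : Expr) : (a + b).eval s = a.eval s + b.eval s := rfl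
@[simp] theorem eval_sub (s : State) (a b : Expr) : (a - b).eval s = a.eval s - b.eval s := rfl
@[simp] theorem eval_mul (s : State) (a b : Expr) : (a * b).eval s = a.eval s * b.eval s := rfl
@[simp] theorem eval_div (s : State) (a b : Expr) : (a / b).eval s = a.eval s / b.eval s := rfl
@[simp] theorem eval_ofNat (s : State) (c : ℕ) :
    (no_index (OfNat.ofNat c : Expr)).eval s = c := rfl
@[simp] theorem eval_const (s : State) (c : ℕ) : (const c).eval s = c := rfl
@[simp] theorem eval_reg (s : State) (r : ℕ) : (reg r).eval s = s.reg r := rfl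
@[simp] theorem eval_read (s : State) (a : Expr) : (read a).eval s = s.mem (a.eval s) := rfl

/-- A bound for the cost of an expression, in multiples of the bit length of the registers and
memory cells. -/
def weight : Expr → ℕ
  | const c => 1 + Nat.size c
  | reg _ => 2
  | read a => a.weight + 2
  | op _ a b => 2 * a.weight + 2 * b.weight + 2

/-- The address of entry `a` of the array number `c`. -/
def addr (c : ℕ) (a : Expr) : Expr := reg 2 + (4 * a + const c)

/-- The entry `a` of the array number `c`. -/
def get (c : ℕ) (a : Expr) : Expr := read (addr c a)

/-- The value of `e`, truncated at the content of register `1`. -/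
def trunc (e : Expr) : Expr := e - (e - reg 1)

theorem eval_trunc (s : State) (e : Expr) : e.trunc.eval s = min (e.eval s) (s.reg 1) := by
  simp only [trunc, eval_sub, eval_reg]; omega

end Expr

namespace State

def setReg (s : State) (r v : ℕ) : State := ⟨Function.update s.reg r v, s.mem⟩

def setMem (s : State) (a v : ℕ) : State := ⟨s.reg, Function.update s.mem a v⟩

/-- The array number `c`; the arrays are interleaved above the cells of the input. -/
def arr (s : State) (c i : ℕ) : ℕ := s.mem (s.reg 2 + (4 * i + c))

/-- All registers and memory cells have bit length at most `B`. -/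
def Bdd (s : State) (B : ℕ) : Prop := (∀ r, (s.reg r).size ≤ B) ∧ ∀ a, (s.mem a).size ≤ B

@[simp] theorem reg_setReg (s : State) (r v r' : ℕ) :
    (s.setReg r v).reg r' = if r' = r then v else s.reg r' := by
  simp [setReg, Function.update_apply]

@[simp] theorem mem_setReg (s : State) (r v : ℕ) : (s.setReg r v).mem = s.mem := rfl
@[simp] theorem reg_setMem (s : State) (a v : ℕ) : (s.setMem a v).reg = s.reg := rfl

theorem mem_setMem (s : State) (a v a' : ℕ) :
    (s.setMem a v).mem a' = if a' = a then v else s.mem a' := by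
  simp [setMem, Function.update_apply]

theorem Bdd.setReg {s : State} {B : ℕ} (h : s.Bdd B) (r : ℕ) {v : ℕ} (hv : v.size ≤ B) :
    (s.setReg r v).Bdd B := by
  refine ⟨fun r' => ?_, h.2⟩
  rw [reg_setReg]; split_ifs
  · exact hv
  · exact h.1 r'

theorem Bdd.setMem {s : State} {B : ℕ} (h : s.Bdd B) (a : ℕ) {v : ℕ} (hv : v.size ≤ B) :
    (s.setMem a v).Bdd B := by
  refine ⟨h.1, fun a' => ?_⟩
  rw [mem_setMem]; split_ifs
  · exact hv
  · exact h.2 a'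

end State

@[simp] theorem Expr.eval_get (s : State) (c : ℕ) (a : Expr) :
    (Expr.get c a).eval s = s.arr c (a.eval s) := rfl

/-! ### Bit lengths and the cost of expressions -/

theorem Expr.size_eval_le_cost (s : State) (e : Expr) : (e.eval s).size ≤ e.cost s := by
  cases e <;> simp only [Expr.eval, Expr.cost] <;> omega

theorem Op.size_eval_le (o : Op) (x y : ℕ) : (o.eval x y).size ≤ x.size + y.size + 1 := by
  cases o <;> simp only [Op.eval]
  · rw [Nat.size_le]
    have hx := Nat.lt_size_self x
    have hy := Nat.lt_size_self y
    have h1 : 2 ^ x.size ≤ 2 ^ (x.size + y.size) := Nat.pow_le_pow_right (by norm_num) (by omega)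
    have h2 : 2 ^ y.size ≤ 2 ^ (x.size + y.size) := Nat.pow_le_pow_right (by norm_num) (by omega)
    rw [pow_succ]; omega
  · exact (Nat.size_le_size (Nat.sub_le x y)).trans (by omega)
  · rw [Nat.size_le]
    have hx := Nat.lt_size_self x
    have hy := Nat.lt_size_self y
    calc x * y < 2 ^ x.size * 2 ^ y.size := by gcongr
      _ = 2 ^ (x.size + y.size) := (pow_add ..).symm
      _ ≤ _ := Nat.pow_le_pow_right (by norm_num) (by omega)
  · exact (Nat.size_le_size (Nat.div_le_self x y)).trans (by omega)

/-- The result of an operation is at most one bit longer than its operands together, and the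
operands are no longer than their own evaluation costs. Each operation thus at most doubles the
bound, which explains the factors 2 in `weight`. -/
theorem Expr.cost_le {s : State} {B : ℕ} (hs : s.Bdd B) (hB : 1 ≤ B) (e : Expr) :
    e.cost s ≤ e.weight * B := by
  induction e with
  | const c => exact Nat.le_mul_of_pos_right _ hB
  | reg r => have := hs.1 r; simp only [cost, weight]; omega
  | read a ih => have := hs.2 (a.eval s); simp only [cost, weight, add_mul]; omega
  | op o a b iha ihb =>
    have := Op.size_eval_le o (a.eval s) (b.eval s)
    have := a.size_eval_le_cost s
    have := b.size_eval_le_cost s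
    simp only [cost, weight, add_mul, mul_assoc]; omega

/-! ### Counting programs: semantics, compilation and cost -/

/-- Counting programs: `forTo i b p` runs `p` for each value `0, 1, …` of register `i` less than
the content of register `b`; `put c a e` assigns the entry `a` of the array number `c`. -/
inductive Cmd
  | skip
  | set (r : ℕ) (e : Expr)
  | store (a e : Expr)
  | put (c : ℕ) (a e : Expr)
  | seq (p q : Cmd)
  | ite (c : Expr) (p q : Cmd)
  | forTo (i b : ℕ) (p : Cmd)

/-- The iteration of a state transformation with a counter in register `i`. -/
def iter (f : State → State) (i : ℕ) : ℕ → State → State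
  | 0, s => s
  | k + 1, s => (f (iter f i k s)).setReg i (k + 1)

namespace Cmd

infixr:30 " ;; " => Cmd.seq

/-- The state transformation computed by a counting program. -/
def den : Cmd → State → State
  | skip, s => s
  | set r e, s => s.setReg r (min (e.eval s) (s.reg 1))
  | store a e, s => s.setMem (a.eval s) (min (e.eval s) (s.reg 1))
  | put c a e, s => s.setMem ((Expr.addr c a).eval s) (min (e.eval s) (s.reg 1))
  | seq p q, s => q.den (p.den s)
  | ite c p q, s => if c.eval s ≠ 0 then p.den s else q.den s
  | forTo i b p, s => iter p.den i (s.reg b) (s.setReg i 0)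

/-- The loop guard is a truncated difference, nonzero exactly while the counter is below the bound.
-/
def compile : Cmd → Prog
  | skip => .skip
  | set r e => .assign r e.trunc
  | store a e => .write a e.trunc
  | put c a e => .write (.addr c a) e.trunc
  | seq p q => .seq p.compile q.compile
  | ite c p q => .ite c p.compile q.compile
  | forTo i b p => .seq (.assign i 0)
      (.loop (.reg b - .reg i) (.seq p.compile (.assign i (.reg i + 1))))

/-- The registers that are assigned. -/
def writes : Cmd → List ℕ
  | skip => []
  | set r _ => [r]
  | store _ _ => []
  | put _ _ _ => []
  | seq p q => p.writes ++ q.writes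
  | ite _ p q => p.writes ++ q.writes
  | forTo i _ p => i :: p.writes

/-- The registers that bound a loop. -/
def bounds : Cmd → List ℕ
  | skip => []
  | set _ _ => []
  | store _ _ => []
  | put _ _ _ => []
  | seq p q => p.bounds ++ q.bounds
  | ite _ p q => p.bounds ++ q.bounds
  | forTo _ b p => b :: p.bounds

/-- The arrays that are assigned. -/
def puts : Cmd → List ℕ
  | skip => []
  | set _ _ => []
  | store _ _ => []
  | put c _ _ => [c]
  | seq p q => p.puts ++ q.puts
  | ite _ p q => p.puts ++ q.puts
  | forTo _ _ p => p.puts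

/-- The memory is assigned through arrays only. -/
def noStore : Cmd → Bool
  | skip => true
  | set _ _ => true
  | store _ _ => false
  | put c _ _ => decide (c < 4)
  | seq p q => p.noStore && q.noStore
  | ite _ p q => p.noStore && q.noStore
  | forTo _ _ p => p.noStore

/-- No loop body assigns the counter of the loop. -/
def fixedCounters : Cmd → Bool
  | skip => true
  | set _ _ => true
  | store _ _ => true
  | put _ _ _ => true
  | seq p q => p.fixedCounters && q.fixedCounters
  | ite _ p q => p.fixedCounters && q.fixedCounters
  | forTo i _ p => p.fixedCounters && decide (i ∉ p.writes)

/-- A bound for the cost of a program, in multiples of the bit length of the registers and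
memory cells, if the registers that bound loops have contents at most `ρ`. -/
def time (ρ : ℕ → ℕ) : Cmd → ℕ
  | skip => 1
  | set _ e => 1 + e.trunc.weight
  | store a e => 1 + a.weight + e.trunc.weight
  | put c a e => 1 + (Expr.addr c a).weight + e.trunc.weight
  | seq p q => p.time ρ + q.time ρ
  | ite c p q => 1 + c.weight + p.time ρ + q.time ρ
  | forTo i b p => 3 + (Expr.reg b - Expr.reg i).weight + ρ b *
      (2 + (Expr.reg b - Expr.reg i).weight + (Expr.reg i + 1).weight + p.time ρ)

theorem reg_den (p : Cmd) {r : ℕ} (h : r ∉ p.writes) (s : State) :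
    (p.den s).reg r = s.reg r := by
  induction p generalizing s with
  | skip => rfl
  | set r' e => simp only [writes, List.mem_singleton] at h; simp [den, State.reg_setReg, h]
  | store a e => rfl
  | put c a e => rfl
  | seq p q ihp ihq =>
    simp only [writes, List.mem_append, not_or] at h
    rw [den, ihq h.2, ihp h.1]
  | ite c p q ihp ihq =>
    simp only [writes, List.mem_append, not_or] at h
    rw [den]; split_ifs
    · exact ihp h.1 s
    · exact ihq h.2 s
  | forTo i b p ih =>
    simp only [writes, List.mem_cons, not_or] at h
    rw [den]
    generalize s.reg b = k
    induction k with
    | zero => simp [iter, State.reg_setReg, h.1]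
    | succ k ihk => rw [iter, State.reg_setReg, if_neg h.1, ih h.2, ihk]

/-- Every assigned value is either capped by register `1` or a counter not exceeding its bounding
register, so the bit bound `B` survives. No bounding register is written, so the numbers of
iterations are governed by the contents on entry. -/
theorem exec_den (p : Cmd) (hp : p.fixedCounters = true) (ρ : ℕ → ℕ) {B : ℕ} (hB : 1 ≤ B)
    (hb : ∀ b ∈ p.bounds, b ∉ p.writes) {s : State} (hs : s.Bdd B)
    (hρ : ∀ b ∈ p.bounds, s.reg b ≤ ρ b) :
    ∃ t, Exec p.compile s t (p.den s) ∧ t ≤ p.time ρ * B ∧ (p.den s).Bdd B := by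
  have htr : ∀ (s : State) (e : Expr), s.Bdd B → (min (e.eval s) (s.reg 1)).size ≤ B :=
    fun s e h => (Nat.size_le_size (min_le_right _ _)).trans (h.1 1)
  induction p generalizing s with
  | skip => exact ⟨1, .skip s, by simpa [time], hs⟩
  | set r e =>
    refine ⟨_, by rw [den, ← Expr.eval_trunc]; exact Exec.assign r e.trunc s, ?_,
      hs.setReg r (htr s e hs)⟩
    have := e.trunc.cost_le hs hB
    simp only [time, add_mul]; omega
  | store a e =>
    refine ⟨_, by rw [den, ← Expr.eval_trunc]; exact Exec.write a e.trunc s, ?_,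
      hs.setMem _ (htr s e hs)⟩
    have := e.trunc.cost_le hs hB
    have := a.cost_le hs hB
    simp only [time, add_mul]; omega
  | put c a e =>
    refine ⟨_, by rw [den, ← Expr.eval_trunc]; exact Exec.write (.addr c a) e.trunc s, ?_,
      hs.setMem _ (htr s e hs)⟩
    have := e.trunc.cost_le hs hB
    have := (Expr.addr c a).cost_le hs hB
    simp only [time, add_mul]; omega
  | seq p q ihp ihq =>
    simp only [fixedCounters, Bool.and_eq_true] at hp
    simp only [bounds, writes, List.mem_append] at hb hρ
    obtain ⟨t₁, h₁, ht₁, hs₁⟩ := ihp hp.1 (fun b h h' => hb b (.inl h) (.inl h')) hs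
      (fun b h => hρ b (.inl h))
    obtain ⟨t₂, h₂, ht₂, hs₂⟩ := ihq hp.2 (fun b h h' => hb b (.inr h) (.inr h')) hs₁
      (fun b h => by
        rw [reg_den p (fun h' => hb b (.inr h) (.inl h'))]; exact hρ b (.inr h))
    exact ⟨_, h₁.seq h₂, by simp only [time, add_mul]; omega, hs₂⟩
  | ite c p q ihp ihq =>
    simp only [fixedCounters, Bool.and_eq_true] at hp
    simp only [bounds, writes, List.mem_append] at hb hρ
    have hc := c.cost_le hs hB
    by_cases h : c.eval s ≠ 0
    · obtain ⟨t₁, h₁, ht₁, hs₁⟩ := ihp hp.1 (fun b h h' => hb b (.inl h) (.inl h')) hs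
        (fun b h => hρ b (.inl h))
      rw [den, if_pos h]
      exact ⟨_, h₁.ite_true h, by simp only [time, add_mul]; omega, hs₁⟩
    · obtain ⟨t₁, h₁, ht₁, hs₁⟩ := ihq hp.2 (fun b h h' => hb b (.inr h) (.inr h')) hs
        (fun b h => hρ b (.inr h))
      rw [den, if_neg h]
      exact ⟨_, h₁.ite_false (not_not.1 h), by simp only [time, add_mul]; omega, hs₁⟩
  | forTo i b p ih =>
    simp only [fixedCounters, Bool.and_eq_true, decide_eq_true_eq] at hp
    simp only [bounds, writes, List.mem_cons] at hb hρ
    have hbi : b ≠ i := fun h => hb b (.inl rfl) (.inl h)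
    have hbp : b ∉ p.writes := fun h => hb b (.inl rfl) (.inr h)
    set s₀ := s.setReg i 0 with hs₀
    have hs₀B : s₀.Bdd B := hs.setReg i (by simp)
    have hreg : ∀ k, (iter p.den i k s₀).reg b = s.reg b ∧ (iter p.den i k s₀).reg i = k := by
      intro k
      induction k with
      | zero => simp [iter, hs₀, State.reg_setReg, hbi]
      | succ k ihk => simp [iter, State.reg_setReg, hbi, reg_den p hbp, ihk.1]
    have hbound : ∀ k, ∀ b' ∈ p.bounds, (iter p.den i k s₀).reg b' = s.reg b' := by
      intro k b' hb'
      have h1 : b' ≠ i := fun h => hb b' (.inr hb') (.inl h)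
      have h2 : b' ∉ p.writes := fun h => hb b' (.inr hb') (.inr h)
      induction k with
      | zero => simp [iter, hs₀, State.reg_setReg, h1]
      | succ k ihk => simp [iter, State.reg_setReg, h1, reg_den p h2, ihk]
    have hstep : ∀ k, (iter p.den i k s₀).Bdd B → ∃ t,
        Exec p.compile (iter p.den i k s₀) t (p.den (iter p.den i k s₀)) ∧ t ≤ p.time ρ * B ∧
          (p.den (iter p.den i k s₀)).Bdd B := fun k hk =>
      ih hp.1 (fun b' h h' => hb b' (.inr h) (.inr h')) hk
        (fun b' h => by rw [hbound k b' h]; exact hρ b' (.inr h))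
    have hbdd : ∀ k ≤ s.reg b, (iter p.den i k s₀).Bdd B := by
      intro k
      induction k with
      | zero => exact fun _ => hs₀B
      | succ k ihk =>
        intro hk
        obtain ⟨t, -, -, h⟩ := hstep k (ihk (by omega))
        exact h.setReg i ((Nat.size_le_size hk).trans (hs.1 b))
    set c := Expr.reg b - Expr.reg i with hc
    set q := Prog.seq p.compile (.assign i (.reg i + 1)) with hq
    -- Induction on the number `j` of remaining rounds: a run of a loop unfolds at its first round,
    -- whereas `iter` unfolds at its last.
    have hloop : ∀ j k, k + j = s.reg b → ∃ t,
        Exec (.loop c q) (iter p.den i k s₀) t (iter p.den i (s.reg b) s₀) ∧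
        t ≤ (1 + c.weight + j *
          (2 + c.weight + (Expr.reg i + 1).weight + p.time ρ)) * B := by
      intro j
      induction j with
      | zero =>
        intro k hk
        have hcost := c.cost_le (hbdd k (by omega)) hB
        rw [← hk, add_zero]
        refine ⟨_, .loop_done ?_, ?_⟩
        · simp [hc, hreg]; omega
        · simp only [add_mul]; omega
      | succ j ihj =>
        intro k hk
        obtain ⟨t₁, h₁, ht₁, hs₁⟩ := hstep k (hbdd k (by omega))
        obtain ⟨t₂, h₂, ht₂⟩ := ihj (k + 1) (by omega)
        have hcost := c.cost_le (hbdd k (by omega)) hB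
        have hinc := (Expr.reg i + 1).cost_le hs₁ hB
        have hx := h₁.seq (Exec.assign i (.reg i + 1) (p.den (iter p.den i k s₀)))
        have hst : (⟨Function.update (p.den (iter p.den i k s₀)).reg i
            ((Expr.reg i + 1).eval (p.den (iter p.den i k s₀))),
            (p.den (iter p.den i k s₀)).mem⟩ : State) = iter p.den i (k + 1) s₀ := by
          simp only [Expr.eval_add, Expr.eval_reg, reg_den p hp.2, (hreg k).2, iter,
            State.setReg]
          rfl
        rw [hst] at hx
        refine ⟨_, .loop_step ?_ hx h₂, ?_⟩
        · simp [hc, hreg]; omega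
        · simp only [add_mul, one_mul] at ht₂ ⊢; omega
    obtain ⟨t, ht, htle⟩ := hloop (s.reg b) 0 (by omega)
    refine ⟨_, (Exec.assign i 0 s).seq ht, ?_, hbdd _ le_rfl⟩
    have h0 : (0 : Expr).cost s = 1 := rfl
    have hmono : s.reg b * (2 + c.weight + (Expr.reg i + 1).weight + p.time ρ) * B ≤
        ρ b * (2 + c.weight + (Expr.reg i + 1).weight + p.time ρ) * B := by
      have := hρ b (.inl rfl)
      gcongr
    rw [add_mul] at htle
    simp only [time, ← hc, h0]
    rw [add_mul (3 + c.weight)]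
    simp only [add_mul _ _ B] at htle hmono ⊢
    omega

/-- Each loop contributes one factor `q`, so the degree depends on the program text only. The
constants are chosen before `ρ` and `q`, which is what makes the bound uniform in `n`. -/
theorem time_le_pow (p : Cmd) : ∃ k d : ℕ, ∀ (ρ : ℕ → ℕ) (q : ℕ), 1 ≤ q →
    (∀ b ∈ p.bounds, ρ b ≤ q) → p.time ρ ≤ k * q ^ d := by
  induction p with
  | skip => exact ⟨1, 0, fun ρ q _ _ => by simp [time]⟩
  | set r e => exact ⟨_, 0, fun ρ q _ _ => by simp only [time, pow_zero, mul_one]; exact le_rfl⟩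
  | store a e => exact ⟨_, 0, fun ρ q _ _ => by simp only [time, pow_zero, mul_one]; exact le_rfl⟩
  | put c a e => exact ⟨_, 0, fun ρ q _ _ => by simp only [time, pow_zero, mul_one]; exact le_rfl⟩
  | seq p q ihp ihq =>
    obtain ⟨k₁, d₁, h₁⟩ := ihp
    obtain ⟨k₂, d₂, h₂⟩ := ihq
    refine ⟨k₁ + k₂, d₁ + d₂, fun ρ q hq hb => ?_⟩
    simp only [bounds, List.mem_append] at hb
    have e₁ := h₁ ρ q hq fun b h => hb b (.inl h)
    have e₂ := h₂ ρ q hq fun b h => hb b (.inr h)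
    have f₁ : k₁ * q ^ d₁ ≤ k₁ * q ^ (d₁ + d₂) := by gcongr; omega
    have f₂ : k₂ * q ^ d₂ ≤ k₂ * q ^ (d₁ + d₂) := by gcongr; omega
    simp only [time, add_mul]; omega
  | ite c p q ihp ihq =>
    obtain ⟨k₁, d₁, h₁⟩ := ihp
    obtain ⟨k₂, d₂, h₂⟩ := ihq
    refine ⟨1 + c.weight + k₁ + k₂, d₁ + d₂, fun ρ q hq hb => ?_⟩
    simp only [bounds, List.mem_append] at hb
    have e₁ := h₁ ρ q hq fun b h => hb b (.inl h)
    have e₂ := h₂ ρ q hq fun b h => hb b (.inr h)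
    have f₁ : k₁ * q ^ d₁ ≤ k₁ * q ^ (d₁ + d₂) := by gcongr; omega
    have f₂ : k₂ * q ^ d₂ ≤ k₂ * q ^ (d₁ + d₂) := by gcongr; omega
    have f₃ : 1 + c.weight ≤ (1 + c.weight) * q ^ (d₁ + d₂) :=
      Nat.le_mul_of_pos_right _ (by positivity)
    simp only [time]
    rw [add_mul, add_mul]; omega
  | forTo i b p ih =>
    obtain ⟨k, d, h⟩ := ih
    refine ⟨(3 + (Expr.reg b - Expr.reg i).weight) +
      ((2 + (Expr.reg b - Expr.reg i).weight + (Expr.reg i + 1).weight) + k), d + 1,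
      fun ρ q hq hb => ?_⟩
    simp only [bounds, List.mem_cons] at hb
    have e := h ρ q hq fun b h => hb b (.inr h)
    set x := (Expr.reg b - Expr.reg i).weight with hx
    set y := (Expr.reg i + 1).weight with hy
    have hd : 1 ≤ q ^ d := Nat.one_le_pow _ _ hq
    have hd' : 1 ≤ q ^ (d + 1) := Nat.one_le_pow _ _ hq
    change 3 + x + ρ b * (2 + x + y + p.time ρ) ≤ _
    calc
      3 + x + ρ b * (2 + x + y + p.time ρ)
        ≤ (3 + x) * q ^ (d + 1) + q * ((2 + x + y) * q ^ d + k * q ^ d) := by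
        apply add_le_add (Nat.le_mul_of_pos_right _ (by positivity))
        apply Nat.mul_le_mul (hb b (.inl rfl))
        exact add_le_add (Nat.le_mul_of_pos_right _ (by positivity)) e
      _ = _ := by ring

end Cmd

/-! ### Frame rules and loop invariants -/

/-- The states `s` and `s'` agree except for the registers in `W` and the arrays in `A`. -/
structure Framed (W A : List ℕ) (s s' : State) : Prop where
  reg : ∀ r ∉ W, s'.reg r = s.reg r
  arr : ∀ c < 4, c ∉ A → ∀ i, s'.arr c i = s.arr c i
  low : ∀ a < s.reg 2, s'.mem a = s.mem a

@[simp] theorem State.arr_setReg (s : State) {r : ℕ} (hr : r ≠ 2) (v c i : ℕ) :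
    (s.setReg r v).arr c i = s.arr c i := by
  simp [State.arr, State.reg_setReg, hr.symm]

theorem State.arr_setMem_addr (s : State) {c c' : ℕ} (hc : c < 4) (hc' : c' < 4) (a v i : ℕ) :
    (s.setMem (s.reg 2 + (4 * a + c)) v).arr c' i =
      if c' = c ∧ i = a then v else s.arr c' i := by
  have : (s.reg 2 + (4 * i + c') = s.reg 2 + (4 * a + c)) ↔ (c' = c ∧ i = a) := by omega
  simp only [State.arr, State.mem_setMem, State.reg_setMem, this]

theorem Framed.refl (W A : List ℕ) (s : State) : Framed W A s s :=
  ⟨fun _ _ => rfl, fun _ _ _ _ => rfl, fun _ _ => rfl⟩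

/-- Register `2` is the base address of all arrays; if it changed, the two statements about arrays
would refer to different cells. -/
theorem Framed.trans {W A W' A' : List ℕ} {s s' s'' : State} (h : Framed W A s s')
    (h' : Framed W' A' s' s'') (h2 : 2 ∉ W) : Framed (W ++ W') (A ++ A') s s'' where
  reg r hr := by
    simp only [List.mem_append, not_or] at hr
    rw [h'.reg r hr.2, h.reg r hr.1]
  arr c hc hA i := by
    simp only [List.mem_append, not_or] at hA
    rw [h'.arr c hc hA.2, h.arr c hc hA.1]
  low a ha := by rw [h'.low a (by rwa [h.reg 2 h2]), h.low a ha]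

theorem Framed.mono {W A W' A' : List ℕ} {s s' : State} (h : Framed W A s s')
    (hW : W ⊆ W') (hA : A ⊆ A') : Framed W' A' s s' where
  reg r hr := h.reg r fun h' => hr (hW h')
  arr c hc hc' := h.arr c hc fun h' => hc' (hA h')
  low := h.low

theorem framed_setReg (s : State) {r : ℕ} (hr : r ≠ 2) (v : ℕ) :
    Framed [r] [] s (s.setReg r v) where
  reg r' h := by simp only [List.mem_singleton] at h; simp [State.reg_setReg, h]
  arr c _ _ i := s.arr_setReg hr v c i
  low _ _ := rfl

namespace Cmd

@[simp] theorem den_seq (p q : Cmd) (s : State) : (p ;; q).den s = q.den (p.den s) := rfl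

@[simp] theorem den_set (r : ℕ) (e : Expr) (s : State) :
    (set r e).den s = s.setReg r (min (e.eval s) (s.reg 1)) := rfl

@[simp] theorem den_skip (s : State) : skip.den s = s := rfl

@[simp] theorem reg_put (c : ℕ) (a e : Expr) (s : State) : ((put c a e).den s).reg = s.reg := rfl

@[simp] theorem arr_put {c c' : ℕ} (hc : c < 4) (hc' : c' < 4) (a e : Expr) (s : State) (i : ℕ) :
    ((put c a e).den s).arr c' i =
      if c' = c ∧ i = a.eval s then min (e.eval s) (s.reg 1) else s.arr c' i :=
  s.arr_setMem_addr hc hc' _ _ i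

/-- This rule also covers bodies with a bare `store`, which satisfy no frame condition on memory;
the output loop needs it. -/
theorem iter_induction {i b : ℕ} {p : Cmd} (s : State) (I : ℕ → State → Prop)
    (h0 : I 0 (s.setReg i 0))
    (step : ∀ k < s.reg b, ∀ s', (∀ r ∉ i :: p.writes, s'.reg r = s.reg r) → s'.reg i = k →
      I k s' → I (k + 1) ((p.den s').setReg i (k + 1))) :
    I (s.reg b) ((forTo i b p).den s) := by
  have key : ∀ k ≤ s.reg b, I k (iter p.den i k (s.setReg i 0)) ∧
      (iter p.den i k (s.setReg i 0)).reg i = k ∧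
      ∀ r ∉ i :: p.writes, (iter p.den i k (s.setReg i 0)).reg r = s.reg r := by
    intro k
    induction k with
    | zero =>
      refine fun _ => ⟨h0, by simp [iter, State.reg_setReg], fun r hr => ?_⟩
      simp only [List.mem_cons, not_or] at hr
      simp [iter, State.reg_setReg, hr.1]
    | succ k ih =>
      intro hk
      obtain ⟨h1, h2, h3⟩ := ih (by omega)
      refine ⟨step k (by omega) _ h3 h2 h1, by simp [iter, State.reg_setReg], fun r hr => ?_⟩
      rw [← h3 r hr]
      simp only [List.mem_cons, not_or] at hr
      simp [iter, State.reg_setReg, hr.1, reg_den p hr.2]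
  exact (key _ le_rfl).1

/-- Entries of the four interleaved arrays have addresses in different residue classes relative to
register `2`, and all lie at or above it, so a `put` disturbs neither the other arrays nor the
input. -/
theorem framed_den (p : Cmd) (hp : p.noStore = true) (h2 : 2 ∉ p.writes) (s : State) :
    Framed p.writes p.puts s (p.den s) := by
  induction p generalizing s with
  | skip => exact .refl _ _ s
  | set r e =>
    simp only [writes, List.mem_singleton] at h2
    exact framed_setReg s (Ne.symm h2) _
  | store a e => simp [noStore] at hp
  | put c a e =>
    simp only [noStore, decide_eq_true_eq] at hp
    refine ⟨fun r _ => rfl, fun c' hc' hA i => ?_, fun a' ha' => ?_⟩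
    · simp only [puts, List.mem_singleton] at hA
      have := s.arr_setMem_addr hp hc' (a.eval s) (min (e.eval s) (s.reg 1)) i
      rw [if_neg (by tauto)] at this
      exact this
    · rw [den, State.mem_setMem, if_neg]
      simp only [Expr.addr, Expr.eval_add, Expr.eval_reg]
      omega
  | seq p q ihp ihq =>
    simp only [noStore, Bool.and_eq_true] at hp
    simp only [writes, List.mem_append, not_or] at h2
    exact (ihp hp.1 h2.1 s).trans (ihq hp.2 h2.2 _) h2.1
  | ite c p q ihp ihq =>
    simp only [noStore, Bool.and_eq_true] at hp
    simp only [writes, List.mem_append, not_or] at h2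
    rw [den]
    split_ifs
    · exact (ihp hp.1 h2.1 s).mono (by simp [writes]) (by simp [puts])
    · exact (ihq hp.2 h2.2 s).mono (by simp [writes]) (by simp [puts])
  | forTo i b p ih =>
    simp only [noStore] at hp
    simp only [writes, List.mem_cons, not_or] at h2
    refine iter_induction s (fun _ s' => Framed (i :: p.writes) p.puts s s') ?_ ?_
    · exact (framed_setReg s (Ne.symm h2.1) 0).mono (by simp) (by simp)
    · intro k _ s' _ _ hI
      have h1 := (ih hp h2.2 s').trans (framed_setReg _ (Ne.symm h2.1) (k + 1)) h2.2
      exact (hI.trans h1 (by simp [h2])).mono (by simp) (by simp)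

/-- The invariant rule for loops. -/
theorem for_induction {i b : ℕ} {p : Cmd} (s : State) (hp : p.noStore = true)
    (h2 : 2 ∉ i :: p.writes) (I : ℕ → State → Prop) (h0 : I 0 (s.setReg i 0))
    (step : ∀ k < s.reg b, ∀ s', Framed (i :: p.writes) p.puts s s' → s'.reg i = k →
      I k s' → I (k + 1) ((p.den s').setReg i (k + 1))) :
    I (s.reg b) ((forTo i b p).den s) := by
  have h2' := h2
  simp only [List.mem_cons, not_or] at h2'
  refine (iter_induction s (fun k s' => I k s' ∧ Framed (i :: p.writes) p.puts s s')
    ⟨h0, ?_⟩ ?_).1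
  · exact (framed_setReg s (Ne.symm h2'.1) 0).mono (by simp) (by simp)
  · intro k hk s' _ hi hI
    refine ⟨step k hk s' hI.2 hi hI.1, ?_⟩
    have h1 := (p.framed_den hp h2'.2 s').trans (framed_setReg _ (Ne.symm h2'.1) (k + 1)) h2'.2
    exact (hI.2.trans h1 (by simp [h2'])).mono (by simp) (by simp)

/-! ### Loops with one accumulator -/

/-- A loop that updates a single register. -/
def accLoop (i b acc : ℕ) (e : Expr) : Cmd := forTo i b (set acc e)

/-- The accumulator is described by an explicit sequence `F`, so the final state is known exactly
and no further frame reasoning is needed. Sums, minima and the choice of a vertex are instances. -/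
theorem den_accLoop {i b acc : ℕ} {e : Expr} (s : State) (hi : i ≠ acc) (h1 : 1 ≠ acc)
    (h1' : 1 ≠ i) (F : ℕ → ℕ) (h0 : F 0 = s.reg acc)
    (hF : ∀ k < s.reg b,
      min (e.eval ((s.setReg acc (F k)).setReg i k)) (s.reg 1) = F (k + 1)) :
    (accLoop i b acc e).den s = (s.setReg acc (F (s.reg b))).setReg i (s.reg b) := by
  have key : ∀ k ≤ s.reg b, iter (set acc e).den i k (s.setReg i 0) =
      (s.setReg acc (F k)).setReg i k := by
    intro k
    induction k with
    | zero =>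
      intro _
      simp [iter, State.setReg, h0]
    | succ k ih =>
      intro hk
      rw [iter, ih (by omega), den]
      have : ((s.setReg acc (F k)).setReg i k).reg 1 = s.reg 1 := by
        simp [State.reg_setReg, h1, h1']
      rw [this, hF k (by omega)]
      simp only [State.setReg]
      congr 1
      funext r
      simp only [Function.update_apply]
      split_ifs <;> simp_all
  exact key _ le_rfl

theorem den_sumLoop {i b acc : ℕ} {e : Expr} (s : State) (hi : i ≠ acc) (h1 : 1 ≠ acc)
    (h1' : 1 ≠ i) (φ : ℕ → ℕ) (h0 : s.reg acc = 0)
    (hφ : ∀ k < s.reg b, ∀ x, e.eval ((s.setReg acc x).setReg i k) = φ k)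
    (hle : ∑ k ∈ Finset.range (s.reg b), φ k ≤ s.reg 1) :
    (accLoop i b acc (.reg acc + e)).den s =
      (s.setReg acc (∑ k ∈ Finset.range (s.reg b), φ k)).setReg i (s.reg b) := by
  refine den_accLoop s hi h1 h1' (fun k => ∑ j ∈ Finset.range k, φ j) (by simp [h0]) ?_
  intro k hk
  have hx : ∑ j ∈ Finset.range (k + 1), φ j ≤ s.reg 1 :=
    (Finset.sum_le_sum_of_subset (Finset.range_mono hk)).trans hle
  simp only [Expr.eval_add, Expr.eval_reg, hφ k hk, State.reg_setReg, hi.symm, if_false, if_true]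
  rw [Finset.sum_range_succ] at hx ⊢
  omega

/-- With truncated subtraction, x - (x - y) is the minimum of x and y. -/
theorem den_minLoop {i b acc : ℕ} {e : Expr} (s : State) (hi : i ≠ acc) (h1 : 1 ≠ acc)
    (h1' : 1 ≠ i) (φ : ℕ → ℕ) (h0 : s.reg acc ≤ s.reg 1)
    (hφ : ∀ k < s.reg b, ∀ x, e.eval ((s.setReg acc x).setReg i k) = φ k) :
    ∃ m, (accLoop i b acc (.reg acc - (.reg acc - e))).den s =
        (s.setReg acc m).setReg i (s.reg b) ∧
      m ≤ s.reg acc ∧ (∀ k < s.reg b, m ≤ φ k) ∧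
      (m = s.reg acc ∨ ∃ k < s.reg b, m = φ k) := by
  set F : ℕ → ℕ := fun k => k.rec (s.reg acc) (fun j m => min m (φ j)) with hF
  have hs : ∀ k, F (k + 1) = min (F k) (φ k) := fun k => rfl
  have hle : ∀ k, F k ≤ s.reg acc := by
    intro k
    induction k with
    | zero => exact le_rfl
    | succ k ih => rw [hs]; exact (min_le_left _ _).trans ih
  refine ⟨F (s.reg b), den_accLoop s hi h1 h1' F rfl ?_, hle _, ?_, ?_⟩
  · intro k hk
    have := hle k
    simp only [Expr.eval_sub, Expr.eval_reg, hφ k hk, State.reg_setReg, hi.symm, if_false,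
      if_true, hs]
    omega
  · intro k hk
    generalize s.reg b = l at hk
    induction l with
    | zero => omega
    | succ l ih =>
      rw [hs]
      rcases Nat.lt_succ_iff_lt_or_eq.1 hk with h | rfl
      · exact (min_le_left _ _).trans (ih h)
      · exact min_le_right _ _
  · generalize s.reg b = l
    induction l with
    | zero => exact .inl rfl
    | succ l ih =>
      rw [hs]
      rcases min_choice (F l) (φ l) with h | h <;> rw [h]
      · rcases ih with h' | ⟨k, hk, h'⟩
        · exact .inl h'
        · exact .inr ⟨k, by omega, h'⟩
      · exact .inr ⟨l, by omega, rfl⟩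

end Cmd

end RAM

namespace DirectedPathwidth

open Finset

/-! ### Boundaries of vertex sets -/

/-- The vertices of `Q` with an in-neighbour outside `Q`, for a digraph on `{0, …, n - 1}`. -/
noncomputable def boundary (n : ℕ) (E : ℕ → ℕ → Prop) (Q : Finset ℕ) : Finset ℕ := by
  classical exact {v ∈ range n | v ∈ Q ∧ ∃ u < n, u ∉ Q ∧ E u v}

theorem mem_boundary {n : ℕ} {E : ℕ → ℕ → Prop} {Q : Finset ℕ} {v : ℕ} :
    v ∈ boundary n E Q ↔ v < n ∧ v ∈ Q ∧ ∃ u < n, u ∉ Q ∧ E u v := by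
  simp [boundary]

/-- The union of the two boundaries on the left is contained in the union of those on the right, and
likewise for the intersections. -/
theorem card_boundary_submodular (n : ℕ) (E : ℕ → ℕ → Prop) (S P : Finset ℕ) :
    #(boundary n E (S ∩ P)) + #(boundary n E (S ∪ P)) ≤
      #(boundary n E S) + #(boundary n E P) := by
  rw [← card_union_add_card_inter (boundary n E (S ∩ P)), ← card_union_add_card_inter
    (boundary n E S)]
  apply add_le_add <;> apply card_le_card <;> intro v <;>
    simp only [mem_union, mem_inter, mem_boundary] <;> grind

/-- The vertices whose closed in-neighbourhood lies in `Q`. -/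
noncomputable def inner (n : ℕ) (E : ℕ → ℕ → Prop) (Q : Finset ℕ) : Finset ℕ := by
  classical exact {v ∈ range n | ∀ u < n, u = v ∨ E u v → u ∈ Q}

theorem mem_inner {n : ℕ} {E : ℕ → ℕ → Prop} {Q : Finset ℕ} {v : ℕ} :
    v ∈ inner n E Q ↔ v < n ∧ ∀ u < n, u = v ∨ E u v → u ∈ Q := by
  simp [inner]

/-- Minimising the boundary amounts to maximising the number of inner vertices minus the size of the
set, the form in which matching duality applies. -/
theorem card_boundary_add_card_inner {n : ℕ} {E : ℕ → ℕ → Prop} {Q : Finset ℕ}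
    (hQ : Q ⊆ range n) : #(boundary n E Q) + #(inner n E Q) = #Q := by
  rw [← card_union_of_disjoint]
  · congr 1
    ext v
    have := @hQ v
    simp only [mem_union, mem_boundary, mem_inner, mem_range] at this ⊢
    grind
  · rw [Finset.disjoint_left]
    simp only [mem_boundary, mem_inner]
    grind

/-! ### The auction: minimum boundary with a prescribed trace on W -/

/-- The invariant of the auction on labels `d` and owners `o`, where `t - 1` is the vertex to be
served next if `t ≠ 0`, and the vertices from `nx` on have not been considered yet. -/
structure Auction (n w : ℕ) (E : ℕ → ℕ → Prop) (X : Finset ℕ) (d o : ℕ → ℕ) (t nx : ℕ) :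
    Prop where
  label_mem : ∀ u ∈ X, d u = n + 3
  label_notMem : ∀ u < w, u ∉ X → d u = 0
  label_le : ∀ u, w ≤ u → u < n → d u ≤ n + 2
  owner_eq_zero : ∀ u, w ≤ u → u < n → (o u = 0 ↔ d u = 0)
  le_next : t ≤ nx
  next_le : nx ≤ n
  owner : ∀ u v, w ≤ u → u < n → o u = v + 1 →
    v < nx ∧ (u = v ∨ E u v) ∧ v + 1 ≠ t ∧ ∀ u' < n, u' = v ∨ E u' v → d u ≤ d u' + 1
  owner_inj : ∀ u u', w ≤ u → u < n → w ≤ u' → u' < n → o u = o u' → o u ≠ 0 → u = u'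
  served : ∀ v < nx, v + 1 ≠ t → (∃ u, w ≤ u ∧ u < n ∧ o u = v + 1) ∨
    (∃ u < n, (u = v ∨ E u v) ∧ u < w ∧ u ∉ X) ∨ ∀ u < n, u = v ∨ E u v → n + 2 ≤ d u

namespace Auction

variable {n w : ℕ} {E : ℕ → ℕ → Prop} {X : Finset ℕ} {d o : ℕ → ℕ} {t nx v u : ℕ}

theorem init (hXw : X ⊆ range w) (hX : ∀ u ∈ X, d u = n + 3)
    (hX' : ∀ u < n, u ∉ X → d u = 0) (ho : ∀ u < n, o u = 0) (hw : w ≤ n) :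
    Auction n w E X d o 0 0 := by
  have hF : ∀ u, w ≤ u → u < n → d u = 0 := fun u h1 h2 =>
    hX' u h2 fun h => by have := mem_range.1 (hXw h); omega
  exact {
    label_mem := hX
    label_notMem := fun u hu => hX' u (by omega)
    label_le := fun u h1 h2 => by simp [hF u h1 h2]
    owner_eq_zero := fun u h1 h2 => by simp [hF u h1 h2, ho u h2]
    le_next := le_rfl
    next_le := Nat.zero_le _
    owner := fun u v _ hu h => by simp [ho u hu] at h
    owner_inj := fun u u' _ hu _ _ _ h => absurd (ho u hu) h
    served := fun v hv => by omega }

theorem start (h : Auction n w E X d o 0 nx) (hnx : nx < n) :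
    Auction n w E X d o (nx + 1) (nx + 1) where
  label_mem := h.label_mem
  label_notMem := h.label_notMem
  label_le := h.label_le
  owner_eq_zero := h.owner_eq_zero
  le_next := le_rfl
  next_le := hnx
  owner u v hw hu ho := by
    obtain ⟨h1, h2, h3, h4⟩ := h.owner u v hw hu ho
    exact ⟨by omega, h2, by omega, h4⟩
  owner_inj := h.owner_inj
  served v hv hv' := h.served v (by omega) (by omega)

/-- Since `u` has the smallest label available to `v`, raising it by one leaves it within one of the
other labels. The same condition for other owners survives because labels only grow. The displaced
owner, if any, is served next; owners are shifted by one so that `0` means none. -/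
theorem raise (h : Auction n w E X d o (v + 1) nx) (hX : X ⊆ range w) (hu : u < n) (hw : w ≤ u)
    (hv : u = v ∨ E u v) (hmin : ∀ u' < n, u' = v ∨ E u' v → d u ≤ d u') (hd : d u ≤ n + 1) :
    Auction n w E X (Function.update d u (d u + 1)) (Function.update o u (v + 1)) (o u) nx where
  label_mem x hx := by
    have := mem_range.1 (hX hx)
    rw [Function.update_of_ne (by omega)]; exact h.label_mem x hx
  label_notMem x hx := by
    rw [Function.update_of_ne (by omega)]; exact h.label_notMem x hx
  label_le x hx hx' := by
    have := h.label_le x hx hx'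
    rw [Function.update_apply]; split_ifs <;> omega
  owner_eq_zero x hx hx' := by
    have := h.owner_eq_zero x hx hx'
    simp only [Function.update_apply]; split_ifs <;> simp_all
  le_next := by
    rcases Nat.eq_zero_or_eq_succ_pred (o u) with h0 | h0
    · omega
    · have := (h.owner u _ hw hu h0).1
      omega
  next_le := h.next_le
  owner x y hx hx' hy := by
    have hle := h.le_next
    have hmono : ∀ z, d z ≤ Function.update d u (d u + 1) z := fun z => by
      rw [Function.update_apply]; split_ifs with hz
      · subst hz; omega
      · exact le_rfl
    rw [Function.update_apply] at hy
    split_ifs at hy with hxu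
    · obtain rfl : v = y := by omega
      subst hxu
      refine ⟨by omega, hv, fun h' => ?_, fun u' hu' hn => ?_⟩
      · exact (h.owner x v hw hu h'.symm).2.2.1 rfl
      · rw [Function.update_self]
        exact Nat.add_le_add_right ((hmin u' hu' hn).trans (hmono u')) 1
    · obtain ⟨h1, h2, h3, h4⟩ := h.owner x y hx hx' hy
      refine ⟨h1, h2, fun h' => ?_, fun u' hu' hn => ?_⟩
      · exact hxu (h.owner_inj x u hx hx' hw hu (by omega) (by omega))
      · rw [Function.update_of_ne hxu]
        exact (h4 u' hu' hn).trans (Nat.add_le_add_right (hmono u') 1)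
  owner_inj x x' hx1 hx2 hx1' hx2' he h0 := by
    simp only [Function.update_apply] at he h0
    split_ifs at he h0 with h1 h2 h2
    · omega
    · exact absurd rfl (h.owner x' v hx1' hx2' he.symm).2.2.1
    · exact absurd rfl (h.owner x v hx1 hx2 he).2.2.1
    · exact h.owner_inj x x' hx1 hx2 hx1' hx2' he h0
  served y hy hyt := by
    by_cases hyv : y = v
    · subst hyv
      exact .inl ⟨u, hw, hu, by simp⟩
    · rcases h.served y hy (by omega) with ⟨x, hx1, hx2, hx3⟩ | h' | h'
      · have : x ≠ u := by rintro rfl; omega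
        exact .inl ⟨x, hx1, hx2, by rwa [Function.update_of_ne this]⟩
      · exact .inr (.inl h')
      · refine .inr (.inr fun x hx hxy => (h' x hx hxy).trans ?_)
        rw [Function.update_apply]; split_ifs with hz
        · subst hz; omega
        · exact le_rfl

/-- The cheapest neighbour shows why `v` needs no partner: either it is a vertex of W outside `X`,
and `v` is never inner, or all labels around `v` are at least `n + 2`, and `v` is inner for every
level set considered. -/
theorem giveUp (h : Auction n w E X d o (v + 1) nx) (hu : u < n)
    (hv : u = v ∨ E u v) (hmin : ∀ u' < n, u' = v ∨ E u' v → d u ≤ d u')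
    (hd : ¬ (w ≤ u ∧ d u ≤ n + 1)) : Auction n w E X d o 0 nx where
  label_mem := h.label_mem
  label_notMem := h.label_notMem
  label_le := h.label_le
  owner_eq_zero := h.owner_eq_zero
  le_next := Nat.zero_le _
  next_le := h.next_le
  owner u v hw hu ho := by
    obtain ⟨h1, h2, h3, h4⟩ := h.owner u v hw hu ho
    exact ⟨by omega, h2, by omega, h4⟩
  owner_inj := h.owner_inj
  served y hy _ := by
    by_cases hyv : y = v
    · subst hyv
      by_cases huw : u < w
      · by_cases hX : u ∈ X
        · have := h.label_mem u hX
          exact .inr (.inr fun x hx hxy => by have := hmin x hx hxy; omega)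
        · exact .inr (.inl ⟨u, hu, hv, huw, hX⟩)
      · exact .inr (.inr fun x hx hxy => by have := hmin x hx hxy; omega)
    · exact h.served y hy (by omega)

theorem sum_label_le (h : Auction n w E X d o t nx) :
    ∑ u ∈ Ico w n, d u ≤ n * (n + 2) := by
  calc ∑ u ∈ Ico w n, d u ≤ ∑ u ∈ Ico w n, (n + 2) :=
        sum_le_sum fun u hu => h.label_le u (mem_Ico.1 hu).1 (mem_Ico.1 hu).2
    _ = (n - w) * (n + 2) := by simp
    _ ≤ _ := by gcongr; omega

theorem sum_update (hu : u < n) (hw : w ≤ u) :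
    ∑ x ∈ Ico w n, Function.update d u (d u + 1) x = ∑ x ∈ Ico w n, d x + 1 := by
  have hmem : u ∈ Ico w n := by simp [hu, hw]
  rw [sum_update_of_mem hmem, ← add_sum_erase _ d hmem, sdiff_singleton_eq_erase]
  ring

/-- When the auction is over, some level set of the labels has minimum boundary. -/
theorem exists_level (h : Auction n w E X d o 0 n) (hX : X ⊆ range w) (hw : w ≤ n)
    {S : Finset ℕ} (hS : S ⊆ range n) (hSX : ∀ u < w, u ∈ S ↔ u ∈ X) :
    ∃ l ≤ n, #(boundary n E {u ∈ range n | l + 1 < d u}) ≤ #(boundary n E S) := by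
  classical
  -- Pigeonhole: the `n + 1` values 1, …, n + 1 cannot all be labels of `n` vertices.
  obtain ⟨l, hl, hgap⟩ : ∃ l ≤ n, ∀ u < n, w ≤ u → d u ≠ l + 1 := by
    by_contra! hcon
    have hsub : range (n + 1) ⊆ (range n).image fun u => d u - 1 := by
      intro l hl
      obtain ⟨u, hu, -, hd⟩ := hcon l (by simpa [Nat.lt_succ_iff] using hl)
      exact mem_image.2 ⟨u, by simpa using hu, by omega⟩
    have := (card_le_card hsub).trans card_image_le
    simp at this
  refine ⟨l, hl, ?_⟩
  set T : Finset ℕ := {u ∈ range n | l + 1 < d u} with hT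
  set H : Finset ℕ := {u ∈ range n | w ≤ u ∧ l + 1 < d u} with hH
  set K : Finset ℕ := {u ∈ S | w ≤ u} with hK
  -- The vertices without a partner that are inner for free, because all labels around them are
  -- maximal.
  set G : Finset ℕ := {v ∈ range n | (∀ u, w ≤ u → u < n → o u ≠ v + 1) ∧
    ∀ u < n, u = v ∨ E u v → n + 2 ≤ d u} with hG
  have hTX : #T = #X + #H := by
    rw [← card_union_of_disjoint]
    · congr 1
      ext u
      have h1 := h.label_mem u
      have h2 := h.label_notMem u
      have h3 := @hX u
      simp only [hT, hH, mem_union, mem_filter, mem_range] at h3 ⊢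
      by_cases hu : u ∈ X
      · have := h3 hu; have := h1 hu; simp [hu]; omega
      · by_cases huw : u < w
        · have := h2 huw hu; simp [hu]; omega
        · simp [hu]; omega
    · rw [Finset.disjoint_left]
      intro u hu
      have := mem_range.1 (hX hu)
      simp [hH]; omega
  have hSK : #S = #X + #K := by
    rw [← card_union_of_disjoint]
    · congr 1
      ext u
      have h2 := hSX u
      have h3 := @hX u
      simp only [hK, mem_union, mem_filter, mem_range] at h3 ⊢
      grind
    · rw [Finset.disjoint_left]
      intro u hu
      have := mem_range.1 (hX hu)
      simp [hK]; omega
  have hT1 := card_boundary_add_card_inner (n := n) (E := E) (Q := T) (filter_subset _ _)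
  have hS1 := card_boundary_add_card_inner (n := n) (E := E) hS
  have hown : ∀ u, w ≤ u → u < n → d u ≠ 0 → o u = (o u - 1) + 1 := fun u h1 h2 h3 => by
    have := (h.owner_eq_zero u h1 h2).not.2 h3
    omega
  -- The owner of a vertex of `H` sees only labels at least `l + 1`; as no free vertex has label `l
  -- + 1`, its whole closed in-neighbourhood lies in `T`.
  have hTi : #G + #H ≤ #(inner n E T) := by
    have himg : #(H.image fun u => o u - 1) = #H := by
      refine card_image_of_injOn fun x hx y hy hxy => ?_
      simp only [hH, coe_filter, mem_range, Set.mem_ofPred_eq] at hx hy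
      have h1 := hown x hx.2.1 hx.1 (by omega)
      have h2 := hown y hy.2.1 hy.1 (by omega)
      exact h.owner_inj x y hx.2.1 hx.1 hy.2.1 hy.1 (by have : o x - 1 = o y - 1 := hxy; omega) (by omega)
    rw [← himg, ← card_union_of_disjoint]
    · apply card_le_card
      intro v hv
      rw [mem_inner]
      rcases mem_union.1 hv with hv | hv
      · simp only [hG, mem_filter, mem_range] at hv
        refine ⟨hv.1, fun u hu hn => ?_⟩
        have := hv.2.2 u hu hn
        simp only [hT, mem_filter, mem_range]; omega
      · obtain ⟨x, hx, rfl⟩ := mem_image.1 hv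
        simp only [hH, mem_filter, mem_range] at hx
        obtain ⟨h1, h2, h3, h4⟩ := h.owner x _ hx.2.1 hx.1 (hown x hx.2.1 hx.1 (by omega))
        refine ⟨h1, fun u hu hn => ?_⟩
        have h5 := h4 u hu hn
        have h6 := hgap u hu
        simp only [hT, mem_filter, mem_range]
        refine ⟨hu, ?_⟩
        by_cases huw : w ≤ u
        · have := h6 huw; omega
        · by_cases huX : u ∈ X
          · have := h.label_mem u huX; omega
          · have := h.label_notMem u (by omega) huX; omega
    · rw [Finset.disjoint_left]
      intro v hv hv'
      obtain ⟨x, hx, rfl⟩ := mem_image.1 hv'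
      simp only [hH, hG, mem_filter, mem_range] at hx hv
      exact hv.2.1 x hx.2.1 hx.1 (hown x hx.2.1 hx.1 (by omega))
  -- Weak duality: an inner vertex of `S` outside `G` has a partner, which lies in its closed
  -- in-neighbourhood and hence in `K`; partners are distinct for distinct vertices.
  have hSi : #(inner n E S) ≤ #G + #K := by
    refine le_trans (card_le_card (t := G ∪ K.image fun u => o u - 1) ?_)
      ((card_union_le _ _).trans (Nat.add_le_add_left card_image_le _))
    intro v hv
    rw [mem_inner] at hv
    rw [mem_union]
    by_cases hex : ∃ u, w ≤ u ∧ u < n ∧ o u = v + 1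
    · obtain ⟨u, hu1, hu2, hu3⟩ := hex
      obtain ⟨h1, h2, h3, h4⟩ := h.owner u v hu1 hu2 hu3
      refine .inr (mem_image.2 ⟨u, ?_, by omega⟩)
      simp only [hK, mem_filter]
      exact ⟨hv.2 u hu2 h2, hu1⟩
    · rcases h.served v hv.1 (by omega) with h' | ⟨u, hu1, hu2, hu3, hu4⟩ | h'
      · exact absurd h' hex
      · exact absurd ((hSX u hu3).1 (hv.2 u hu1 hu2)) hu4
      · left
        simp only [hG, mem_filter, mem_range]
        push Not at hex
        exact ⟨hv.1, hex, h'⟩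
  -- The boundary of `T` has size at most |X| - |G|, that of `S` at least |X| - |G|.
  omega

end Auction

/-! ### Binary codes of vertex sets -/

/-- The set of vertices encoded by the number `x`, if vertex `v` has weight `wt v`. -/
def decode (n : ℕ) (wt : ℕ → ℕ) (x : ℕ) : Finset ℕ := {v ∈ range n | x / wt v % 2 = 1}

theorem mem_decode {n : ℕ} {wt : ℕ → ℕ} {x v : ℕ} :
    v ∈ decode n wt x ↔ v < n ∧ x / wt v % 2 = 1 := by simp [decode]

/-- The weights `wt` are the powers of two with the exponents given by an injection `p` of
`{0, …, n - 1}` into itself. -/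
structure IsWeight (n : ℕ) (wt p : ℕ → ℕ) : Prop where
  lt : ∀ v < n, p v < n
  inj : ∀ u < n, ∀ v < n, p u = p v → u = v
  eq : ∀ v < n, wt v = 2 ^ p v

namespace IsWeight

variable {n s : ℕ} {wt p : ℕ → ℕ} {Q S : Finset ℕ}

theorem sum_eq (h : IsWeight n wt p) (hQ : Q ⊆ range n) :
    ∑ v ∈ Q, wt v = ∑ i ∈ Q.image p, 2 ^ i := by
  rw [sum_image]
  · exact sum_congr rfl fun v hv => h.eq v (mem_range.1 (hQ hv))
  · exact fun u hu v hv => h.inj u (mem_range.1 (hQ hu)) v (mem_range.1 (hQ hv))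

theorem decode_sum (h : IsWeight n wt p) (hQ : Q ⊆ range n) :
    decode n wt (∑ v ∈ Q, wt v) = Q := by
  ext v
  rw [mem_decode, h.sum_eq hQ]
  have key : ∀ v < n, ((∑ i ∈ Q.image p, 2 ^ i) / wt v % 2 = 1 ↔ v ∈ Q) := by
    intro v hv
    have h1 : p v ∈ (∑ i ∈ Q.image p, 2 ^ i).bitIndices.toFinset ↔ v ∈ Q := by
      rw [toFinset_bitIndices_sum_two_pow, mem_image]
      constructor
      · rintro ⟨u, hu, huv⟩
        rwa [← h.inj u (mem_range.1 (hQ hu)) v hv huv]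
      · exact fun hv => ⟨v, hv, rfl⟩
    rw [← h1, List.mem_toFinset, Nat.mem_bitIndices, Nat.testBit_eq_decide_div_mod_eq,
      decide_eq_true_eq, h.eq v hv]
  constructor
  · rintro ⟨hv, hx⟩
    exact (key v hv).1 hx
  · intro hv
    have hv' := mem_range.1 (hQ hv)
    exact ⟨hv', (key v hv').2 hv⟩

theorem sum_lt (h : IsWeight n wt p) (hQ : Q ⊆ range n) (hs : ∀ v ∈ Q, p v < s) :
    ∑ v ∈ Q, wt v < 2 ^ s := by
  rw [h.sum_eq hQ]
  refine Nat.geomSum_lt le_rfl fun k hk => ?_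
  obtain ⟨v, hv, rfl⟩ := mem_image.1 hk
  exact hs v hv

theorem sum_prefix (h : IsWeight n wt p) (hS : S ⊆ range n) (hs : ∀ v ∈ S, p v < s)
    (hc : s ≤ #S) : ∑ v ∈ S, wt v = 2 ^ s - 1 := by
  rw [h.sum_eq hS]
  have : S.image p = range s := by
    apply eq_of_subset_of_card_le
    · intro i hi
      obtain ⟨v, hv, rfl⟩ := mem_image.1 hi
      exact mem_range.2 (hs v hv)
    · rw [card_image_of_injOn, card_range]
      · exact hc
      · exact fun u hu v hv => h.inj u (mem_range.1 (hS hu)) v (mem_range.1 (hS hv))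
  rw [this, Nat.geomSum_eq le_rfl]
  simp

/-- The set `S` occupies exactly the lowest `s` bits, so a superset has these bits all equal to one
and its other vertices contribute multiples of `2 ^ s`. -/
theorem sum_mod (h : IsWeight n wt p) (hS : S ⊆ range n) (hs : ∀ v < n, v ∈ S ↔ p v < s)
    (hc : s ≤ #S) (hQ : Q ⊆ range n) (hSQ : S ⊆ Q) :
    (∑ v ∈ Q, wt v) % 2 ^ s = 2 ^ s - 1 := by
  rw [← sum_sdiff hSQ, h.sum_prefix hS (fun v hv => (hs v (mem_range.1 (hS hv))).1 hv) hc]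
  have : 2 ^ s ∣ ∑ v ∈ Q \ S, wt v := by
    refine dvd_sum fun v hv => ?_
    rw [mem_sdiff] at hv
    have hv' := mem_range.1 (hQ hv.1)
    rw [h.eq v hv']
    exact pow_dvd_pow 2 (not_lt.1 ((hs v hv').not.1 hv.2))
  obtain ⟨c, hc⟩ := this
  have := Nat.one_le_two_pow (n := s)
  rw [hc, Nat.mul_add_mod, Nat.mod_eq_of_lt (by omega)]

end IsWeight

/-! ### The dynamic program over comparable sets -/

/-- The number `x` encodes a set comparable with the set encoded by `2 ^ s - 1`. -/
def Comparable (s x : ℕ) : Prop := x < 2 ^ s ∨ x % 2 ^ s = 2 ^ s - 1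

/-- The table `f` of the dynamic program has been filled in up to the entry `y`. -/
structure Table (n : ℕ) (E : ℕ → ℕ → Prop) (wt : ℕ → ℕ) (M s : ℕ) (f : ℕ → ℕ) (y : ℕ) :
    Prop where
  zero : f 0 = 1
  lower : ∀ x, f x ≠ 0 → #(boundary n E (decode n wt x)) + 1 ≤ f x
  pred : ∀ x ≠ 0, f x ≠ 0 → f x < M →
    ∃ v ∈ decode n wt x, f (x - wt v) ≠ 0 ∧ f (x - wt v) ≤ f x
  le : ∀ x, f x ≠ 0 → x ≤ y
  upper : ∀ x ≤ y, Comparable s x → x ≠ 0 → f x ≠ 0 ∧ ∀ v ∈ decode n wt x, f (x - wt v) ≠ 0 →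
    f x ≤ max (#(boundary n E (decode n wt x)) + 1) (f (x - wt v))

theorem card_boundary_le (n : ℕ) (E : ℕ → ℕ → Prop) (Q : Finset ℕ) :
    #(boundary n E Q) ≤ n := by
  classical
  refine (card_le_card (t := range n) fun v hv => ?_).trans (card_range n).le
  exact mem_range.2 (mem_boundary.1 hv).1

theorem boundary_empty (n : ℕ) (E : ℕ → ℕ → Prop) : boundary n E ∅ = ∅ := by
  ext v; simp [mem_boundary]

theorem boundary_range (n : ℕ) (E : ℕ → ℕ → Prop) : boundary n E (range n) = ∅ := by
  ext v; simp [mem_boundary]; grind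

theorem decode_zero (n : ℕ) (wt : ℕ → ℕ) : decode n wt 0 = ∅ := by
  ext v; simp [mem_decode]

namespace Table

variable {n : ℕ} {E : ℕ → ℕ → Prop} {wt p : ℕ → ℕ} {M s : ℕ} {f : ℕ → ℕ} {y : ℕ}

theorem init (h0 : f 0 = 1) (h : ∀ x ≠ 0, f x = 0) : Table n E wt M s f 0 where
  zero := h0
  lower x hx := by
    obtain rfl : x = 0 := by by_contra h'; exact hx (h x h')
    simp [decode_zero, boundary_empty, h0]
  pred x hx hx' := absurd (h x hx) hx'
  le x hx := by by_contra h'; exact hx (h x (by omega))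
  upper x hx _ hx' := by omega

/-- Entries are one more than the bottleneck value, so that `0` can mean an entry not filled in; `M`
plays the role of infinity when no predecessor is available. Codes of predecessors are smaller, so
writing entry `x` leaves all entries that matter to smaller codes intact. -/
theorem step (h : Table n E wt M s f y) (hM : n + 1 ≤ M) (hwt : ∀ v < n, 1 ≤ wt v) {x m : ℕ}
    (hx : y < x) (hgap : ∀ z, y < z → z < x → ¬ Comparable s z) (hmM : m ≤ M)
    (hle : ∀ v ∈ decode n wt x, f (x - wt v) ≠ 0 → m ≤ f (x - wt v))
    (hm : m = M ∨ ∃ v ∈ decode n wt x, f (x - wt v) ≠ 0 ∧ m = f (x - wt v)) :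
    Table n E wt M s
      (Function.update f x (max (#(boundary n E (decode n wt x)) + 1) m)) x := by
  have hsub : ∀ z, z ≤ x → z ≠ 0 → ∀ v ∈ decode n wt z, ∀ a,
      Function.update f x a (z - wt v) = f (z - wt v) := fun z hz hz0 v hv a => by
    have := hwt v (mem_decode.1 hv).1
    rw [Function.update_of_ne (by omega)]
  have hlt : ∀ z, f z ≠ 0 → z ≠ x := fun z hz => by
    have := h.le z hz
    omega
  refine ⟨?_, fun z hz => ?_, fun z hz0 hz hzM => ?_, fun z hz => ?_, fun z hz hc hz0 => ?_⟩
  · rw [Function.update_of_ne (by omega), h.zero]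
  · rw [Function.update_apply] at hz ⊢
    split_ifs at hz ⊢ with hzx
    · rw [hzx]; exact le_max_left _ _
    · exact h.lower z hz
  · by_cases hzx : z = x
    · subst hzx
      rw [Function.update_self] at hzM hz ⊢
      rcases hm with rfl | ⟨v, hv, h1, h2⟩
      · exact absurd hzM (not_lt.2 (le_max_right _ _))
      · refine ⟨v, hv, ?_⟩
        rw [hsub z le_rfl hz0 v hv]
        exact ⟨h1, h2 ▸ le_max_right _ _⟩
    · rw [Function.update_of_ne hzx] at hz hzM ⊢
      obtain ⟨v, hv, hv'⟩ := h.pred z hz0 hz hzM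
      have := h.le z hz
      refine ⟨v, hv, ?_⟩
      rwa [hsub z (by omega) hz0 v hv]
  · by_cases hzx : z = x
    · omega
    · rw [Function.update_of_ne hzx] at hz
      have := h.le z hz
      omega
  · by_cases hzx : z = x
    · subst hzx
      rw [Function.update_self]
      refine ⟨by omega, fun v hv hv0 => ?_⟩
      rw [hsub z le_rfl hz0 v hv] at hv0 ⊢
      exact max_le_max le_rfl (hle v hv hv0)
    · have hzy : z ≤ y := by
        by_contra h'
        exact hgap z (by omega) (by omega) hc
      obtain ⟨h1, h2⟩ := h.upper z hzy hc hz0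
      rw [Function.update_of_ne hzx]
      refine ⟨h1, fun v hv hv0 => ?_⟩
      rw [hsub z hz hz0 v hv] at hv0 ⊢
      exact h2 v hv hv0

/-- The bound `c + 1` propagates upwards along the chain, since each set is a predecessor of the
next. Repetitions are allowed because intersecting with or uniting with `S` can make consecutive
sets equal. -/
theorem chain_le (h : Table n E wt M s f (2 ^ n - 1)) (hp : IsWeight n wt p) {c m : ℕ}
    {Q : ℕ → Finset ℕ} (hQ : ∀ i ≤ m, Q i ⊆ range n)
    (hcmp : ∀ i ≤ m, Comparable s (∑ v ∈ Q i, wt v))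
    (hstep : ∀ i < m, Q (i + 1) = Q i ∨ ∃ v ∈ Q (i + 1), Q i = (Q (i + 1)).erase v)
    (hc : ∀ i ≤ m, #(boundary n E (Q i)) ≤ c)
    (h0 : f (∑ v ∈ Q 0, wt v) ≠ 0 ∧ f (∑ v ∈ Q 0, wt v) ≤ c + 1) :
    f (∑ v ∈ Q m, wt v) ≠ 0 ∧ f (∑ v ∈ Q m, wt v) ≤ c + 1 := by
  suffices ∀ i ≤ m, f (∑ v ∈ Q i, wt v) ≠ 0 ∧ f (∑ v ∈ Q i, wt v) ≤ c + 1 from this m le_rfl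
  intro i
  induction i with
  | zero => exact fun _ => h0
  | succ i ih =>
    intro hi
    obtain ⟨ih1, ih2⟩ := ih (by omega)
    rcases hstep i (by omega) with he | ⟨v, hv, he⟩
    · rw [he]; exact ⟨ih1, ih2⟩
    · have hsum := sum_erase_add _ wt hv
      rw [← he] at hsum
      have hvn := mem_range.1 (hQ _ hi hv)
      have hpos : 0 < wt v := by rw [hp.eq v hvn]; positivity
      have hlt := hp.sum_lt (hQ _ hi) fun u hu => hp.lt u (mem_range.1 (hQ _ hi hu))
      have hdec := hp.decode_sum (hQ _ hi)
      obtain ⟨h1, h2⟩ := h.upper _ (by omega) (hcmp _ hi) (by omega)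
      refine ⟨h1, (h2 v (by rwa [hdec]) ?_).trans ?_⟩
      · rwa [← hsum, Nat.add_sub_cancel]
      · rw [← hsum, Nat.add_sub_cancel, hsum, hdec]
        exact max_le (Nat.add_le_add_right (hc _ hi) 1) ih2

/-- The value of the whole vertex set is at most `c + 1` if the cuts of a chain of sets that has
been uncrossed with the set `S` have boundaries of size at most `c`. -/
theorem top_le (h : Table n E wt M s f (2 ^ n - 1)) (hp : IsWeight n wt p) {c : ℕ}
    {S : Finset ℕ} (hS : S ⊆ range n) (hs : ∀ v < n, v ∈ S ↔ p v < s) (hcard : s ≤ #S)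
    {P : ℕ → Finset ℕ} (hP : ∀ i ≤ n, P i ⊆ range n) (hP0 : P 0 = ∅) (hPn : P n = range n)
    (hstep : ∀ i < n, ∃ v ∉ P i, P (i + 1) = insert v (P i))
    (hc : ∀ i ≤ n, #(boundary n E S) + #(boundary n E (P i)) ≤ c) :
    f (2 ^ n - 1) ≠ 0 ∧ f (2 ^ n - 1) ≤ c + 1 := by
  have hsm := fun i => card_boundary_submodular n E S (P i)
  -- The lower half of the chain climbs from the empty set to `S` inside `S`; the second application
  -- of `chain_le` climbs from `S` to the whole vertex set.
  have hS0 : f (∑ v ∈ S, wt v) ≠ 0 ∧ f (∑ v ∈ S, wt v) ≤ c + 1 := by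
    have := h.chain_le hp (c := c) (m := n) (Q := fun i => S ∩ P i)
      (fun i hi => inter_subset_right.trans (hP i hi)) (fun i hi => .inl ?_) (fun i hi => ?_)
      (fun i hi => ?_) ?_
    · simpa only [hPn, inter_eq_left.2 hS] using this
    · refine hp.sum_lt (inter_subset_left.trans hS) fun v hv => ?_
      have := (mem_inter.1 hv).1
      exact (hs v (mem_range.1 (hS this))).1 this
    · obtain ⟨v, hv, hPv⟩ := hstep i hi
      by_cases hvS : v ∈ S
      · refine .inr ⟨v, by simp [hPv, hvS], ?_⟩
        ext u; simp only [hPv, mem_inter, mem_insert, mem_erase]; grind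
      · left
        ext u; simp only [hPv, mem_inter, mem_insert]; grind
    · have := hsm i
      have := hc i hi
      omega
    · simp [hP0, h.zero]
  have := h.chain_le hp (c := c) (m := n) (Q := fun i => S ∪ P i)
    (fun i hi => union_subset hS (hP i hi))
    (fun i hi => .inr (hp.sum_mod hS hs hcard (union_subset hS (hP i hi)) subset_union_left))
    (fun i hi => ?_) (fun i hi => ?_) ?_
  · have hn := hp.sum_prefix (S := range n) (s := n) subset_rfl
      (fun v hv => hp.lt v (mem_range.1 hv)) (by simp)
    simpa only [hPn, union_eq_right.2 hS, hn] using this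
  · obtain ⟨v, hv, hPv⟩ := hstep i hi
    by_cases hvS : v ∈ S
    · left
      ext u; simp only [hPv, mem_union, mem_insert]; grind
    · refine .inr ⟨v, by simp [hPv], ?_⟩
      ext u; simp only [hPv, mem_union, mem_insert, mem_erase]; grind
  · have := hsm i
    have := hc i hi
    omega
  · simpa only [hP0, union_empty] using hS0

end Table

/-- Some member of a chain of sets meets `W` in a prescribed number of elements. -/
theorem exists_card_inter_eq {n h : ℕ} {P : ℕ → Finset ℕ} {W : Finset ℕ} (hP0 : P 0 = ∅)
    (hstep : ∀ i < n, ∃ v ∉ P i, P (i + 1) = insert v (P i)) (hn : h ≤ #(P n ∩ W)) :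
    ∃ i ≤ n, #(P i ∩ W) = h := by
  induction n with
  | zero => exact ⟨0, le_rfl, by simp [hP0] at hn ⊢; omega⟩
  | succ n ih =>
    by_cases hh : h ≤ #(P n ∩ W)
    · obtain ⟨i, hi, hi'⟩ := ih (fun i hi => hstep i (by omega)) hh
      exact ⟨i, by omega, hi'⟩
    · refine ⟨n + 1, le_rfl, ?_⟩
      obtain ⟨v, -, hv⟩ := hstep n (by omega)
      have : #(P (n + 1) ∩ W) ≤ #(P n ∩ W) + 1 := by
        refine (card_le_card (t := insert v (P n ∩ W)) ?_).trans (card_insert_le _ _)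
        rw [hv]
        intro u; simp only [mem_inter, mem_insert]; tauto
      omega

/-! ### Program for the size of a boundary -/

open Finset RAM RAM.Cmd

/-- The state `s` holds a digraph with adjacency relation `E` on `{0, …, n - 1}`, and `M` in
register `1`. -/
structure Ctx (n : ℕ) (E : ℕ → ℕ → Prop) (M : ℕ) (s : State) : Prop where
  reg_zero : s.reg 0 = n
  reg_one : s.reg 1 = M
  reg_two : s.reg 2 = n * n
  sq_le : (n + 4) * (n + 4) ≤ M
  pow_le : 4 * 2 ^ n ≤ M
  le_one : ∀ u < n, ∀ v < n, s.mem (u * n + v) ≤ 1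
  adj : ∀ u < n, ∀ v < n, s.mem (u * n + v) = 1 ↔ E u v

theorem mul_add_lt {n u v : ℕ} (hu : u < n) (hv : v < n) : u * n + v < n * n := by
  calc u * n + v < u * n + n := by omega
    _ = (u + 1) * n := by ring
    _ ≤ n * n := Nat.mul_le_mul_right n hu

theorem Ctx.framed {n : ℕ} {E : ℕ → ℕ → Prop} {M : ℕ} {s s' : State} {W A : List ℕ}
    (h : Ctx n E M s) (hF : Framed W A s s') (hW : ∀ r ≤ 2, r ∉ W) : Ctx n E M s' where
  reg_zero := (hF.reg 0 (hW 0 (by omega))).trans h.reg_zero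
  reg_one := (hF.reg 1 (hW 1 (by omega))).trans h.reg_one
  reg_two := (hF.reg 2 (hW 2 (by omega))).trans h.reg_two
  sq_le := h.sq_le
  pow_le := h.pow_le
  le_one u hu v hv := by
    rw [hF.low _ (by rw [h.reg_two]; exact mul_add_lt hu hv)]; exact h.le_one u hu v hv
  adj u hu v hv := by
    rw [hF.low _ (by rw [h.reg_two]; exact mul_add_lt hu hv)]; exact h.adj u hu v hv

theorem Ctx.le {n : ℕ} {E : ℕ → ℕ → Prop} {M : ℕ} {s : State} (h : Ctx n E M s) :
    n + 4 ≤ M := by have := h.sq_le; nlinarith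

/-- Whether the vertex in register `v` belongs to the set encoded by register `x` with respect to
the weights in array number `c`. -/
def bitE (c x v : ℕ) : Expr :=
  .reg x / .get c (.reg v) - .reg x / .get c (.reg v) / 2 * 2

theorem eval_bitE (s : State) (c x v : ℕ) :
    (bitE c x v).eval s = if s.reg x / s.arr c (s.reg v) % 2 = 1 then 1 else 0 := by
  simp only [bitE, Expr.eval_sub, Expr.eval_mul, Expr.eval_div, Expr.eval_reg, Expr.eval_get,
    Expr.eval_ofNat]
  split_ifs <;> omega

/-- Whether an expression is nonzero. -/
def flagE (e : Expr) : Expr := 1 - (1 - e)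

theorem eval_flagE (s : State) (e : Expr) :
    (flagE e).eval s = if e.eval s = 0 then 0 else 1 := by
  simp only [flagE, Expr.eval_sub, Expr.eval_ofNat]
  split_ifs <;> omega

/-- The number of in-neighbours of a vertex outside a set. -/
def outsideLoop (c : ℕ) : Cmd :=
  accLoop 12 0 17 (.reg 17 + (1 - bitE c 15 12) * .read (.reg 12 * .reg 0 + .reg 11))

/-- The size of the boundary of the set encoded by register `15`. -/
def boundaryCmd (c : ℕ) : Cmd :=
  set 16 0 ;; forTo 11 0
    (set 17 0 ;; outsideLoop c ;; set 16 (.reg 16 + bitE c 15 11 * flagE (.reg 17)))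

variable {n h w k c : ℕ} {E : ℕ → ℕ → Prop} {M : ℕ}

/-- Only whether the count vanishes matters for membership in the boundary, so its exact value is
left unspecified. -/
theorem den_outsideLoop {s : State} (h : Ctx n E M s) (c : ℕ) (h0 : s.reg 17 = 0)
    (hv : s.reg 11 < n) :
    ∃ a, (outsideLoop c).den s = (s.setReg 17 a).setReg 12 n ∧
      (a = 0 ↔ ¬ ∃ u < n, u ∉ decode n (s.arr c) (s.reg 15) ∧ E u (s.reg 11)) := by
  set φ : ℕ → ℕ := fun u => (1 - if s.reg 15 / s.arr c u % 2 = 1 then 1 else 0) *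
    s.mem (u * n + s.reg 11) with hφ
  have hφ1 : ∀ u < n, φ u ≤ 1 := fun u hu => by
    have := h.le_one u hu _ hv
    simp only [hφ]; split_ifs <;> omega
  have hsum : ∑ k ∈ range n, φ k ≤ n := by
    calc ∑ k ∈ range n, φ k ≤ ∑ k ∈ range n, 1 := sum_le_sum fun k hk => hφ1 k (mem_range.1 hk)
      _ = n := by simp
  have h1 := den_sumLoop (i := 12) (b := 0) (acc := 17)
    (e := (1 - bitE c 15 12) * .read (.reg 12 * .reg 0 + .reg 11)) s (by norm_num) (by norm_num)
    (by norm_num) φ h0 ?_ ?_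
  · refine ⟨_, by rw [outsideLoop, h1, h.reg_zero], ?_⟩
    rw [sum_eq_zero_iff]
    push Not
    refine ⟨fun h' u hu hu' hE => ?_, fun h' u hu => ?_⟩
    · have := h' u (by simpa using hu)
      rw [← h.adj u hu _ hv] at hE
      simp only [mem_decode, hu, true_and] at hu'
      simp [hφ, hu', hE] at this
    · have hu := mem_range.1 hu
      have h2 := h' u hu
      have h3 := h.le_one u hu _ hv
      rw [← h.adj u hu _ hv] at h2
      simp only [mem_decode, hu, true_and] at h2
      simp only [hφ]
      split_ifs with h4
      · simp
      · have := h2 h4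
        simp; omega
  · intro k hk x
    simp [hφ, eval_bitE, State.reg_setReg, State.arr_setReg, h.reg_zero]
  · rw [h.reg_zero, h.reg_one]
    have := h.le
    omega

theorem boundaryCmd_spec {s : State} (h : Ctx n E M s) {c : ℕ} (hc : c < 4) :
    ((boundaryCmd c).den s).reg 16 = #(boundary n E (decode n (s.arr c) (s.reg 15))) := by
  classical
  set B := boundary n E (decode n (s.arr c) (s.reg 15)) with hB
  have hcard := card_boundary_le n E (decode n (s.arr c) (s.reg 15))
  set s₁ := (set 16 0).den s with hs₁
  have h1 : Ctx n E M s₁ := h.framed (framed_den _ rfl (by decide) s) (by decide)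
  have hfilter : #{v ∈ B | v < n} = #B := by
    congr 1
    refine filter_true_of_mem fun v hv => ?_
    exact (mem_boundary.1 hv).1
  rw [boundaryCmd, den, ← hfilter]
  have := for_induction (i := 11) (b := 0)
    (p := set 17 0 ;; outsideLoop c ;; set 16 (.reg 16 + bitE c 15 11 * flagE (.reg 17)))
    s₁ rfl (by decide : 2 ∉ [11, 17, 12, 17, 16]) (fun k s' => s'.reg 16 = #{v ∈ B | v < k}) ?_ ?_
  · rwa [h1.reg_zero] at this
  · simp [hs₁, den, State.reg_setReg]
  · intro k hk s' hF hk' hI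
    have h2 : Ctx n E M s' := h1.framed hF (by
      have : ∀ r ≤ 2, r ∉ [11, 17, 12, 17, 16] := by decide
      exact this)
    have h15 : s'.reg 15 = s.reg 15 := by
      rw [hF.reg 15 (by exact (by decide : 15 ∉ [11, 17, 12, 17, 16]))]
      simp [hs₁, den, State.reg_setReg]
    have harr : s'.arr c = s.arr c := by
      funext i
      rw [hF.arr c hc (by simp [puts, outsideLoop, accLoop])]
      exact s.arr_setReg (by norm_num) _ c i
    rw [h1.reg_zero] at hk
    simp only [den]
    set s₂ := s'.setReg 17 (min ((0 : Expr).eval s') (s'.reg 1)) with hs₂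
    have h3 : Ctx n E M s₂ := h2.framed (framed_setReg _ (by norm_num) _) (by decide)
    obtain ⟨a, ha, ha'⟩ := den_outsideLoop h3 c (by simp [hs₂, State.reg_setReg])
      (by simpa [hs₂, State.reg_setReg, hk'] using hk)
    have hle := h2.le
    have harr2 : s₂.arr c = s.arr c := by
      funext i; rw [hs₂, State.arr_setReg _ (by norm_num), harr]
    have hBk : #{v ∈ B | v < k + 1} = #{v ∈ B | v < k} + if k ∈ B then 1 else 0 := by
      have : ({v ∈ B | v < k + 1} : Finset ℕ) = {v ∈ B | v < k} ∪ if k ∈ B then {k} else ∅ := by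
        ext v
        split_ifs with hkB
        · simp only [mem_filter, mem_union, mem_singleton]; grind
        · simp only [mem_filter, mem_union, notMem_empty]; grind
      rw [this, card_union_of_disjoint]
      · split_ifs <;> simp
      · split_ifs <;> simp
    have hBn : #{v ∈ B | v < k + 1} ≤ n := (card_le_card (filter_subset _ _)).trans hcard
    have hkB : k ∈ B ↔ s.reg 15 / s.arr c k % 2 = 1 ∧ a ≠ 0 := by
      rw [harr2] at ha'
      rw [hB, mem_boundary, mem_decode, Ne, ha']
      simp [hs₂, State.reg_setReg, hk', h15, hk]
    rw [ha]
    simp only [State.reg_setReg, State.arr_setReg, eval_bitE, eval_flagE, Expr.eval_add,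
      Expr.eval_mul, Expr.eval_reg, hs₂, harr, hk', h15, hI, h2.reg_one, ne_eq,
      not_false_eq_true, Nat.reduceEqDiff, if_false, if_true]
    rw [hBk] at hBn ⊢
    by_cases h4 : s.reg 15 / s.arr c k % 2 = 1 <;> by_cases h5 : a = 0 <;>
      simp only [h4, h5, hkB, if_true, if_false, ne_eq, not_true_eq_false, and_false, and_true,
        not_false_eq_true] at hBn ⊢ <;> simp <;> omega

theorem framed_boundaryCmd (c : ℕ) (s : State) :
    Framed [16, 11, 17, 12] [] s ((boundaryCmd c).den s) :=
  (framed_den (boundaryCmd c) rfl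
    (by exact (by decide : 2 ∉ [16, 11, 17, 12, 17, 16])) s).mono
    (by
      change [16, 11, 17, 12, 17, 16] ⊆ [16, 11, 17, 12]
      decide)
    (by simp [boundaryCmd, puts, outsideLoop, accLoop])

/-! ### Program for the auction -/

/-- Initialization of labels and owners for the set encoded by register `10`. -/
def auctionInit : Cmd :=
  forTo 12 0 (put 1 (.reg 12) (bitE 0 10 12 * (.reg 0 + 3)) ;; put 2 (.reg 12) 0)

/-- The label and the number of the vertex in register `12`, packed into one number; truncated
subtraction makes it at least the content of register `1` if the vertex is not in the closed
in-neighbourhood of the vertex to be served. -/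
def keyE : Expr :=
  .get 1 (.reg 12) * .reg 0 + .reg 12 +
    (1 - (.read (.reg 12 * .reg 0 + (.reg 19 - 1)) +
      (1 - ((.reg 12 + 1 - .reg 19) + (.reg 19 - (.reg 12 + 1)))))) * .reg 1

def keyLoop : Cmd := accLoop 12 0 21 (.reg 21 - (.reg 21 - keyE))

/-- Register `29` saves the displaced owner before its entry is overwritten. -/
def raiseCmd : Cmd :=
  set 29 (.get 2 (.reg 28)) ;; put 2 (.reg 28) (.reg 19) ;;
    put 1 (.reg 28) (.get 1 (.reg 28) + 1) ;; set 19 (.reg 29)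

/-- The chosen vertex is the remainder of the minimum key modulo n. The product of truncated
differences is nonzero exactly if that vertex is outside W and its label is at most n + 1. -/
def serveCmd : Cmd :=
  set 21 (.reg 1) ;; keyLoop ;; set 28 (.reg 21 - .reg 21 / .reg 0 * .reg 0) ;;
    ite ((1 - (.reg 6 - .reg 28)) * (.reg 0 + 2 - .get 1 (.reg 28))) raiseCmd (set 19 0)

/-- One round of the auction. -/
def auctionStep : Cmd :=
  ite (.reg 19) serveCmd
    (ite (.reg 0 - .reg 20) (set 20 (.reg 20 + 1) ;; set 19 (.reg 20)) skip)

theorem auctionInit_spec {s : State} (h : Ctx n E M s) :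
    ∀ u < n, ((auctionInit.den s).arr 1 u =
      if u ∈ decode n (s.arr 0) (s.reg 10) then n + 3 else 0) ∧ (auctionInit.den s).arr 2 u = 0 := by
  have := for_induction (i := 12) (b := 0)
    (p := put 1 (.reg 12) (bitE 0 10 12 * (.reg 0 + 3)) ;; put 2 (.reg 12) 0) s rfl (by decide)
    (fun k s' => ∀ u < k, (s'.arr 1 u =
      if u ∈ decode n (s.arr 0) (s.reg 10) then n + 3 else 0) ∧ s'.arr 2 u = 0) (by simp) ?_
  · rwa [h.reg_zero] at this
  · intro k hk s' hF hk' hI u hu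
    rw [h.reg_zero] at hk
    have h0 := hF.reg 0 (by decide)
    have h1 := hF.reg 1 (by decide)
    have h2 := hF.reg 2 (by decide)
    have h10 := hF.reg 10 (by decide)
    have ha := hF.arr 0 (by norm_num) (by decide)
    have hle := h.le
    have hmem : k ∈ decode n (s.arr 0) (s.reg 10) ↔ s.reg 10 / s.arr 0 k % 2 = 1 := by
      rw [mem_decode]; simp [hk]
    by_cases hku : u = k
    · subst hku
      simp [hk', eval_bitE, hmem, h0, h1, h10, ha, h.reg_zero, h.reg_one]
      split_ifs <;> omega
    · simp [hk', hku]
      exact hI u (by omega)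

/-- Keys of non-neighbours are at least `M`, those of neighbours are below `M`, and `v` itself is
among the candidates. Since the vertex number is below `n`, comparing keys compares labels first. -/
theorem den_keyLoop {s : State} (h : Ctx n E M s) {v : ℕ} (hv : v < n) (ht : s.reg 19 = v + 1)
    (h21 : s.reg 21 = M) (hd : ∀ u < n, s.arr 1 u ≤ n + 3) :
    ∃ u < n, (keyLoop.den s) = (s.setReg 21 (s.arr 1 u * n + u)).setReg 12 n ∧
      (u = v ∨ E u v) ∧ ∀ u' < n, u' = v ∨ E u' v → s.arr 1 u ≤ s.arr 1 u' := by
  set φ : ℕ → ℕ := fun u => s.arr 1 u * n + u +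
    (1 - (s.mem (u * n + v) + (1 - ((u + 1 - (v + 1)) + (v + 1 - (u + 1)))))) * M with hφ
  obtain ⟨m, hm, -, h2, h3⟩ := den_minLoop (i := 12) (b := 0) (acc := 21) (e := keyE) s
    (by norm_num) (by norm_num) (by norm_num) φ (by rw [h21, h.reg_one]) (by
      intro k hk x
      simp [hφ, keyE, State.reg_setReg, State.arr_setReg, h.reg_zero, h.reg_one, ht])
  rw [h.reg_zero] at h2 h3 hm
  have hnb : ∀ u < n, (u = v ∨ E u v) → φ u = s.arr 1 u * n + u := by
    intro u hu hn
    have h4 := h.adj u hu v hv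
    have h5 := h.le_one u hu v hv
    have : 1 - (s.mem (u * n + v) + (1 - ((u + 1 - (v + 1)) + (v + 1 - (u + 1))))) = 0 := by
      rcases hn with rfl | hn
      · omega
      · rw [h4.2 hn]; omega
    simp only [hφ, this, zero_mul, add_zero]
  have hnb' : ∀ u < n, ¬ (u = v ∨ E u v) → M ≤ φ u := by
    intro u hu hn
    push Not at hn
    have h4 := (h.adj u hu v hv).not.2 hn.2
    have h5 := h.le_one u hu v hv
    have : 1 - (s.mem (u * n + v) + (1 - ((u + 1 - (v + 1)) + (v + 1 - (u + 1))))) = 1 := by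
      have := hn.1
      omega
    simp only [hφ, this, one_mul]; omega
  have hlt : ∀ u < n, s.arr 1 u * n + u < M := by
    intro u hu
    have := hd u hu
    have := h.sq_le
    have : s.arr 1 u * n ≤ (n + 3) * n := by gcongr
    nlinarith
  have hmv : m < M := (h2 v hv).trans_lt (by rw [hnb v hv (.inl rfl)]; exact hlt v hv)
  rcases h3 with h3 | ⟨u, hu, rfl⟩
  · omega
  · have hun : u = v ∨ E u v := by
      by_contra h'
      have := hnb' u hu h'
      omega
    refine ⟨u, hu, by rw [← hnb u hu hun, keyLoop, hm], hun, fun u' hu' hn' => ?_⟩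
    have := h2 u' hu'
    rw [hnb u hu hun, hnb u' hu' hn'] at this
    by_contra! hcon
    have : (s.arr 1 u' + 1) * n ≤ s.arr 1 u * n := by gcongr; omega
    rw [add_mul] at this
    omega

/-- The rounds still allowed for are bounded by the potential of the auction. -/
def Progress (n w k : ℕ) (d : ℕ → ℕ) (t nx : ℕ) : Prop :=
  k + (if t = 0 then 0 else 1) ≤ 2 * nx + ∑ u ∈ Ico w n, d u ∨ (t = 0 ∧ nx = n)

/-- Starting a vertex raises the potential by two, paying for this round and for a later round in
which the pending request is given up. A raise is paid for by the label sum. Once the auction is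
over, rounds change nothing. -/
theorem auctionStep_spec {s : State} (h : Ctx n E M s) (h6 : s.reg 6 = w)
    {X : Finset ℕ} (hX : X ⊆ range w) {k : ℕ}
    (ha : Auction n w E X (s.arr 1) (s.arr 2) (s.reg 19) (s.reg 20))
    (hk : Progress n w k (s.arr 1) (s.reg 19) (s.reg 20)) :
    Auction n w E X ((auctionStep.den s).arr 1) ((auctionStep.den s).arr 2)
        ((auctionStep.den s).reg 19) ((auctionStep.den s).reg 20) ∧
      Progress n w (k + 1) ((auctionStep.den s).arr 1) ((auctionStep.den s).reg 19)
        ((auctionStep.den s).reg 20) := by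
  have hle := h.le
  rw [auctionStep, den]
  by_cases ht : s.reg 19 = 0
  · rw [if_neg (by simpa using ht), den]
    by_cases hnx : s.reg 20 < n
    · rw [if_pos (by simp [h.reg_zero]; omega)]
      have hmin : min (s.reg 20 + 1) (s.reg 1) = s.reg 20 + 1 := by rw [h.reg_one]; omega
      have e : ∀ c, ((set 20 (.reg 20 + 1) ;; set 19 (.reg 20)).den s).arr c = s.arr c := by
        intro c; funext i
        simp [den, State.arr_setReg]
      have e19 : ((set 20 (.reg 20 + 1) ;; set 19 (.reg 20)).den s).reg 19 = s.reg 20 + 1 := by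
        simp [den, State.reg_setReg, h.reg_one]; omega
      have e20 : ((set 20 (.reg 20 + 1) ;; set 19 (.reg 20)).den s).reg 20 = s.reg 20 + 1 := by
        simp [den, State.reg_setReg, h.reg_one]; omega
      rw [e, e, e19, e20]
      rw [ht] at ha hk
      refine ⟨ha.start hnx, ?_⟩
      rcases hk with hk | hk
      · left
        simp only [if_true] at hk
        simp
        omega
      · omega
    · rw [if_neg (by simp [h.reg_zero]; omega)]
      refine ⟨ha, .inr ⟨ht, ?_⟩⟩
      rw [den_skip]
      have := ha.next_le
      omega
  · rw [if_pos (by simpa using ht)]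
    obtain ⟨v, hv⟩ : ∃ v, s.reg 19 = v + 1 := ⟨s.reg 19 - 1, by omega⟩
    have hvn : v < n := by
      have := ha.le_next
      have := ha.next_le
      omega
    have hd : ∀ u < n, s.arr 1 u ≤ n + 3 := by
      intro u hu
      by_cases huw : w ≤ u
      · have := ha.label_le u huw hu; omega
      · by_cases huX : u ∈ X
        · exact (ha.label_mem u huX).le
        · simp [ha.label_notMem u (by omega) huX]
    set s₁ := (set 21 (.reg 1)).den s with hs₁
    have hF₁ : Framed [21] [] s s₁ := framed_den (set 21 (.reg 1)) rfl (by decide) s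
    have h₁ : Ctx n E M s₁ := h.framed hF₁ (by decide)
    have harr₁ : ∀ c, s₁.arr c = s.arr c := fun c => by
      funext i; rw [hs₁, den, State.arr_setReg _ (by norm_num)]
    have h19 : s₁.reg 19 = v + 1 := by rw [hF₁.reg 19 (by decide), hv]
    obtain ⟨u, hu, he, hnb, hmin⟩ := den_keyLoop h₁ hvn h19
      (by simp [hs₁, den, State.reg_setReg, h.reg_one]) (by rwa [harr₁])
    rw [harr₁] at he hmin
    have hn0 : 0 < n := by omega
    set s₂ := (s₁.setReg 21 (s.arr 1 u * n + u)).setReg 12 n with hs₂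
    have hF₂ : Framed [21, 12] [] s₁ s₂ :=
      (framed_setReg _ (by norm_num) _).trans (framed_setReg _ (by norm_num) _) (by decide)
    have h₂ : Ctx n E M s₂ := h₁.framed hF₂ (by decide)
    set s₃ := s₂.setReg 28 u with hs₃
    have hs₃' : (set 28 (.reg 21 - .reg 21 / .reg 0 * .reg 0)).den s₂ = s₃ := by
      have h21 : s₂.reg 21 = s.arr 1 u * n + u := by simp [hs₂, State.reg_setReg]
      have hdiv : (s.arr 1 u * n + u) / n = s.arr 1 u := by
        rw [mul_comm, Nat.mul_add_div hn0, Nat.div_eq_of_lt hu, add_zero]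
      simp only [den, Expr.eval_sub, Expr.eval_mul, Expr.eval_div, Expr.eval_reg, h21,
        h₂.reg_zero, h₂.reg_one, hdiv, hs₃]
      congr 1
      omega
    have harr₃ : ∀ c, s₃.arr c = s.arr c := fun c => by
      funext i
      rw [hs₃, State.arr_setReg _ (by norm_num), hs₂, State.arr_setReg _ (by norm_num),
        State.arr_setReg _ (by norm_num), harr₁]
    have h₃ : Ctx n E M s₃ := h₂.framed (framed_setReg _ (by norm_num) _) (by decide)
    have hreg₃ : s₃.reg 28 = u ∧ s₃.reg 6 = w ∧ s₃.reg 19 = v + 1 ∧ s₃.reg 20 = s.reg 20 := by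
      simp [hs₃, hs₂, hs₁, den, State.reg_setReg, h6, hv]
    obtain ⟨r28, r6, r19, r20⟩ := hreg₃
    have hserve : serveCmd.den s = (ite ((1 - (.reg 6 - .reg 28)) *
        (.reg 0 + 2 - .get 1 (.reg 28))) raiseCmd (set 19 0)).den s₃ := by
      rw [serveCmd, den_seq, den_seq, den_seq, ← hs₁, he, hs₃']
    have hdu := hd u hu
    rw [hserve, den]
    rw [hv] at ha hk
    by_cases hcond : w ≤ u ∧ s.arr 1 u ≤ n + 1
    · rw [if_pos]
      · have a1 : (raiseCmd.den s₃).arr 1 =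
            Function.update (s.arr 1) u (s.arr 1 u + 1) := by
          funext i
          simp only [raiseCmd, den_seq, den_set, State.arr_setReg, arr_put, reg_put, r28, harr₃,
            h₃.reg_one, State.reg_setReg, Function.update_apply, Expr.eval_add, Expr.eval_get,
            Expr.eval_reg, Expr.eval_ofNat, ne_eq, Nat.reduceEqDiff, not_false_eq_true, if_false,
            Nat.reduceLT, true_and, false_and, OfNat.one_ne_ofNat]
          split_ifs <;> omega
        have a2 : (raiseCmd.den s₃).arr 2 = Function.update (s.arr 2) u (v + 1) := by
          funext i
          simp [raiseCmd, r28, r19, h₃.reg_one, harr₃, Function.update_apply]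
          split_ifs <;> omega
        have ho : s.arr 2 u ≤ n := by
          by_contra! hcon
          have h1 := (ha.owner u (s.arr 2 u - 1) hcond.1 hu (by omega)).1
          have := ha.next_le
          omega
        have a19 : (raiseCmd.den s₃).reg 19 = s.arr 2 u := by
          simp [raiseCmd, r28, h₃.reg_one, harr₃]
          omega
        have a20 : (raiseCmd.den s₃).reg 20 = s.reg 20 := by
          simp [raiseCmd, r20]
        rw [a1, a2, a19, a20]
        refine ⟨ha.raise hX hu hcond.1 hnb hmin hcond.2, ?_⟩
        rcases hk with hk | hk
        · left
          rw [Auction.sum_update hu hcond.1]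
          simp only [Nat.add_eq_zero_iff, one_ne_zero, and_false, if_false] at hk
          split_ifs <;> omega
        · omega
      · simp [r6, r28, h₃.reg_zero, harr₃]
        omega
    · rw [if_neg]
      · have a1 : ∀ c, ((set 19 0).den s₃).arr c = s.arr c := fun c => by
          funext i; simp [harr₃]
        have a19 : ((set 19 0).den s₃).reg 19 = 0 := by simp
        have a20 : ((set 19 0).den s₃).reg 20 = s.reg 20 := by simp [r20]
        rw [a1, a1, a19, a20]
        refine ⟨ha.giveUp hu hnb hmin hcond, ?_⟩
        rcases hk with hk | hk
        · left
          simp only [Nat.add_eq_zero_iff, one_ne_zero, and_false, if_false] at hk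
          simp
          omega
        · omega
      · simp [r6, r28, h₃.reg_zero, harr₃]
        omega

def auctionCmd : Cmd := auctionInit ;; set 19 0 ;; set 20 0 ;; forTo 13 3 auctionStep

/-! ### The search for a balanced set -/

/-- The code of a level set of the labels. -/
def levelCmd : Cmd :=
  set 15 0 ;; accLoop 12 0 15
    (.reg 15 + flagE (.get 1 (.reg 12) - (.reg 14 + 1)) * .get 0 (.reg 12))

def candidateCmd : Cmd :=
  levelCmd ;; boundaryCmd 0 ;;
    ite (.reg 22 - .reg 16) (set 22 (.reg 16) ;; set 23 (.reg 15)) skip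

def candidateLoop : Cmd := forTo 14 9 candidateCmd

def countCmd : Cmd := set 18 0 ;; accLoop 12 0 18 (.reg 18 + bitE 0 10 12)

def splitCmd : Cmd :=
  countCmd ;; ite (1 - ((.reg 18 - .reg 7) + (.reg 7 - .reg 18)))
    (auctionCmd ;; candidateLoop) skip

/-- The search for a balanced set with a small boundary. -/
def searchCmd : Cmd := set 22 (.reg 9) ;; forTo 10 4 splitCmd

/-- A context in which the parameters have been computed. -/
structure Setup (n h : ℕ) (E : ℕ → ℕ → Prop) (M : ℕ) (s : State) : Prop extends
    Ctx n E M s where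
  le : 2 * h ≤ n
  reg_three : s.reg 3 = (n + 2) * (n + 2)
  reg_four : s.reg 4 = 2 ^ (2 * h)
  reg_five : s.reg 5 = 2 * 2 ^ (n - h)
  reg_six : s.reg 6 = 2 * h
  reg_seven : s.reg 7 = h
  reg_eight : s.reg 8 = 2 ^ n
  reg_nine : s.reg 9 = n + 1
  weight : ∀ v < n, s.arr 0 v = 2 ^ v

theorem Setup.framed {s s' : State} {W A : List ℕ} (hs : Setup n h E M s)
    (hF : Framed W A s s') (hW : ∀ r ≤ 9, r ∉ W) (hA : 0 ∉ A) : Setup n h E M s' where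
  toCtx := hs.toCtx.framed hF fun r hr => hW r (by omega)
  le := hs.le
  reg_three := (hF.reg 3 (hW 3 (by omega))).trans hs.reg_three
  reg_four := (hF.reg 4 (hW 4 (by omega))).trans hs.reg_four
  reg_five := (hF.reg 5 (hW 5 (by omega))).trans hs.reg_five
  reg_six := (hF.reg 6 (hW 6 (by omega))).trans hs.reg_six
  reg_seven := (hF.reg 7 (hW 7 (by omega))).trans hs.reg_seven
  reg_eight := (hF.reg 8 (hW 8 (by omega))).trans hs.reg_eight
  reg_nine := (hF.reg 9 (hW 9 (by omega))).trans hs.reg_nine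
  weight v hv := by rw [hF.arr 0 (by norm_num) hA, hs.weight v hv]

theorem Setup.isWeight {s : State} (hs : Setup n h E M s) : IsWeight n (s.arr 0) id where
  lt _ hv := hv
  inj _ _ _ _ huv := huv
  eq := hs.weight

theorem auctionCmd_spec {s : State} (hs : Setup n h E M s)
    (hX : decode n (s.arr 0) (s.reg 10) ⊆ range (2 * h)) :
    Auction n (2 * h) E (decode n (s.arr 0) (s.reg 10)) ((auctionCmd.den s).arr 1)
      ((auctionCmd.den s).arr 2) 0 n := by
  set X := decode n (s.arr 0) (s.reg 10) with hXdef
  have hinit := auctionInit_spec hs.toCtx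
  set s₁ := (auctionInit ;; set 19 0 ;; set 20 0).den s with hs₁
  have hF₁ := framed_den (auctionInit ;; set 19 0 ;; set 20 0) rfl (by decide) s
  have h₁ : Setup n h E M s₁ := hs.framed hF₁ (by decide) (by decide)
  have harr : ∀ c u, s₁.arr c u = (auctionInit.den s).arr c u := fun c u => by simp [hs₁]
  have h0 : Auction n (2 * h) E X (s₁.arr 1) (s₁.arr 2) 0 0 := by
    refine .init hX (fun u hu => ?_) (fun u hu huX => ?_) (fun u hu => ?_) hs.le
    · rw [harr, (hinit u (mem_decode.1 hu).1).1, if_pos hu]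
    · rw [harr, (hinit u hu).1, if_neg huX]
    · rw [harr, (hinit u hu).2]
  have h19 : s₁.reg 19 = 0 := by simp [hs₁]
  have h20 : s₁.reg 20 = 0 := by simp [hs₁]
  have := for_induction (i := 13) (b := 3) (p := auctionStep) s₁ rfl (by decide)
    (fun k s' => Auction n (2 * h) E X (s'.arr 1) (s'.arr 2) (s'.reg 19) (s'.reg 20) ∧
      Progress n (2 * h) k (s'.arr 1) (s'.reg 19) (s'.reg 20)) ?_ ?_
  · have he : auctionCmd.den s = (forTo 13 3 auctionStep).den s₁ := rfl
    rw [← he, h₁.reg_three] at this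
    obtain ⟨ha, hp⟩ := this
    have hsum := ha.sum_label_le
    have hnx := ha.next_le
    rcases hp with hp | ⟨e1, e2⟩
    · exfalso
      -- The left side bounds the potential, so the auction is over before the loop of (n + 2)²
      -- rounds ends.
      have : n * (n + 2) + 2 * n < (n + 2) * (n + 2) := by nlinarith
      omega
    · rwa [e1, e2] at ha
  · have e : ∀ c, (s₁.setReg 13 0).arr c = s₁.arr c := fun c => by funext i; simp
    rw [e, e]
    simp only [State.reg_setReg, Nat.reduceEqDiff, if_false, h19, h20]
    exact ⟨h0, .inl (by simp)⟩
  · intro k _ s' hF _ hI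
    have h' := h₁.framed hF (by decide) (by decide)
    obtain ⟨i1, i2⟩ := auctionStep_spec h'.toCtx h'.reg_six hX hI.1 hI.2
    have e : ∀ c, ((auctionStep.den s').setReg 13 (k + 1)).arr c = (auctionStep.den s').arr c :=
      fun c => by funext i; simp
    rw [e, e]
    simp only [State.reg_setReg, Nat.reduceEqDiff, if_false]
    exact ⟨i1, i2⟩

/-- A level set of the labels. -/
def levelSet (n l : ℕ) (d : ℕ → ℕ) : Finset ℕ := {u ∈ range n | l + 1 < d u}

theorem den_levelCmd {s : State} (hs : Setup n h E M s) :
    levelCmd.den s = ((s.setReg 15 0).setReg 15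
      (∑ u ∈ levelSet n (s.reg 14) (s.arr 1), s.arr 0 u)).setReg 12 n := by
  have hlt := hs.isWeight.sum_lt (Q := levelSet n (s.reg 14) (s.arr 1)) (s := n)
    (filter_subset _ _) (fun v hv => mem_range.1 (mem_of_mem_filter v hv))
  rw [levelSet, sum_filter] at hlt ⊢
  have hM := hs.pow_le
  rw [levelCmd, den_seq, den_set]
  have h1 := den_sumLoop (i := 12) (b := 0) (acc := 15)
    (e := flagE (.get 1 (.reg 12) - (.reg 14 + 1)) * .get 0 (.reg 12)) (s.setReg 15 0)
    (by norm_num) (by norm_num) (by norm_num)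
    (fun u => if s.reg 14 + 1 < s.arr 1 u then s.arr 0 u else 0) (by simp) ?_ ?_
  · simp only [State.reg_setReg, hs.reg_zero] at h1
    simpa using h1
  · intro k hk x
    simp only [Expr.eval_mul, eval_flagE, Expr.eval_sub, Expr.eval_get, Expr.eval_add,
      Expr.eval_reg, Expr.eval_ofNat]
    simp
    split_ifs <;> omega
  · simp [hs.reg_zero, hs.reg_one]
    omega

/-- The best candidate so far is in registers `22` and `23`. -/
def Best (n h : ℕ) (E : ℕ → ℕ → Prop) (s : State) : Prop :=
  s.reg 22 ≤ n → #(boundary n E (decode n (s.arr 0) (s.reg 23))) = s.reg 22 ∧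
    h ≤ #(decode n (s.arr 0) (s.reg 23)) ∧ #(decode n (s.arr 0) (s.reg 23)) + h ≤ n

theorem Best.framed {s s' : State} {W A : List ℕ} (hs : Best n h E s)
    (hF : Framed W A s s') (hW : 22 ∉ W ∧ 23 ∉ W) (hA : 0 ∉ A) : Best n h E s' := by
  have : s'.arr 0 = s.arr 0 := by funext i; exact hF.arr 0 (by norm_num) hA i
  rw [Best, this, hF.reg 22 hW.1, hF.reg 23 hW.2]
  exact hs

theorem candidateCmd_spec {s : State} (hs : Setup n h E M s) (hb : Best n h E s)
    (hT : h ≤ #(levelSet n (s.reg 14) (s.arr 1)) ∧ #(levelSet n (s.reg 14) (s.arr 1)) + h ≤ n) :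
    Best n h E (candidateCmd.den s) ∧ (candidateCmd.den s).reg 22 ≤ s.reg 22 ∧
      (candidateCmd.den s).reg 22 ≤ #(boundary n E (levelSet n (s.reg 14) (s.arr 1))) := by
  set T := levelSet n (s.reg 14) (s.arr 1) with hTdef
  have hTn : T ⊆ range n := filter_subset _ _
  have hlt := hs.isWeight.sum_lt hTn (s := n) (fun v hv => mem_range.1 (hTn hv))
  have hM := hs.pow_le
  have hle := hs.toCtx.le
  set s₁ := levelCmd.den s with hs₁
  have hF₁ := framed_den levelCmd rfl (by decide) s
  have h₁ : Setup n h E M s₁ := hs.framed hF₁ (by decide) (by decide)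
  have h15 : s₁.reg 15 = ∑ u ∈ T, s.arr 0 u := by
    rw [hs₁, den_levelCmd hs]; simp [hTdef]
  set s₂ := (boundaryCmd 0).den s₁ with hs₂
  have hF₂ := framed_boundaryCmd 0 s₁
  have h16 := boundaryCmd_spec h₁.toCtx (c := 0) (by norm_num)
  have h₂ : Setup n h E M s₂ := h₁.framed hF₂ (by decide) (by decide)
  have harr : s₂.arr 0 = s.arr 0 := by
    funext i
    rw [hF₂.arr 0 (by norm_num) (by decide), hF₁.arr 0 (by norm_num) (by decide)]
  have harr₁ : s₁.arr 0 = s.arr 0 := by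
    funext i
    rw [hF₁.arr 0 (by norm_num) (by decide)]
  have hdec := hs.isWeight.decode_sum hTn
  rw [h15, harr₁, hdec, ← hs₂] at h16
  have h15' : s₂.reg 15 = ∑ u ∈ T, s.arr 0 u := by rw [hF₂.reg 15 (by decide), h15]
  have h22 : s₂.reg 22 = s.reg 22 := by rw [hF₂.reg 22 (by decide), hF₁.reg 22 (by decide)]
  have hbn := card_boundary_le n E T
  have hden : candidateCmd.den s = (ite (.reg 22 - .reg 16) (set 22 (.reg 16) ;;
      set 23 (.reg 15)) skip).den s₂ := rfl
  rw [hden, den]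
  split_ifs with hc
  · simp only [Expr.eval_sub, Expr.eval_reg, h22, h16] at hc
    have e : ∀ c, ((set 22 (.reg 16) ;; set 23 (.reg 15)).den s₂).arr c = s₂.arr c :=
      fun c => by funext i; simp
    have e22 : ((set 22 (.reg 16) ;; set 23 (.reg 15)).den s₂).reg 22 = #(boundary n E T) := by
      simp [h16, h₂.reg_one]; omega
    have e23 : ((set 22 (.reg 16) ;; set 23 (.reg 15)).den s₂).reg 23 = ∑ u ∈ T, s.arr 0 u := by
      simp [h15', h₂.reg_one]; omega
    rw [Best, e22, e23, e, harr, hdec]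
    exact ⟨fun _ => ⟨rfl, hT⟩, by omega, le_rfl⟩
  · simp only [Expr.eval_sub, Expr.eval_reg, h22, h16] at hc
    rw [den_skip, h22]
    exact ⟨(hb.framed hF₁ (by decide) (by decide)).framed hF₂ (by decide) (by decide), le_rfl,
      by omega⟩

theorem candidateLoop_spec {s : State} (hs : Setup n h E M s) (hb : Best n h E s)
    (hT : ∀ l ≤ n, h ≤ #(levelSet n l (s.arr 1)) ∧ #(levelSet n l (s.arr 1)) + h ≤ n) :
    Best n h E (candidateLoop.den s) ∧ (candidateLoop.den s).reg 22 ≤ s.reg 22 ∧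
      ∀ l ≤ n, (candidateLoop.den s).reg 22 ≤ #(boundary n E (levelSet n l (s.arr 1))) := by
  have := for_induction (i := 14) (b := 9) (p := candidateCmd) s rfl (by decide)
    (fun k s' => Best n h E s' ∧ s'.reg 22 ≤ s.reg 22 ∧
      ∀ l < k, s'.reg 22 ≤ #(boundary n E (levelSet n l (s.arr 1)))) ?_ ?_
  · rw [hs.reg_nine] at this
    exact ⟨this.1, this.2.1, fun l hl => this.2.2 l (by omega)⟩
  · exact ⟨hb.framed (framed_setReg s (by norm_num) 0) (by decide) (by decide), by simp, by simp⟩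
  · intro k hk s' hF hk' hI
    rw [hs.reg_nine] at hk
    have h' := hs.framed hF (by decide) (by decide)
    have harr : s'.arr 1 = s.arr 1 := by funext i; exact hF.arr 1 (by norm_num) (by decide) i
    have hc := candidateCmd_spec h' hI.1 (by rw [hk', harr]; exact hT k (by omega))
    rw [hk', harr] at hc
    refine ⟨hc.1.framed (framed_setReg _ (by norm_num) _) (by decide) (by decide), ?_, ?_⟩
    · simpa using hc.2.1.trans hI.2.1
    · intro l hl
      simp only [State.reg_setReg, Nat.reduceEqDiff, if_false]
      rcases Nat.lt_succ_iff_lt_or_eq.1 hl with hl | rfl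
      · exact hc.2.1.trans (hI.2.2 l hl)
      · exact hc.2.2

theorem countCmd_spec {s : State} (hs : Setup n h E M s) :
    (countCmd.den s).reg 18 = #(decode n (s.arr 0) (s.reg 10)) := by
  have hle := hs.toCtx.le
  rw [countCmd, den_seq, den_set, decode, card_filter]
  have h1 := den_sumLoop (i := 12) (b := 0) (acc := 18)
    (e := bitE 0 10 12) (s.setReg 18 0) (by norm_num) (by norm_num) (by norm_num)
    (fun u => if s.reg 10 / s.arr 0 u % 2 = 1 then 1 else 0) (by simp) ?_ ?_
  · simp only [State.reg_setReg, hs.reg_zero] at h1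
    have e : min ((0 : Expr).eval s) (s.reg 1) = 0 := by simp
    rw [e, h1]
    simp
  · intro k hk x
    simp [eval_bitE]
  · rw [← card_filter]
    refine (card_filter_le _ _).trans ?_
    simp [hs.reg_zero, hs.reg_one]
    omega

theorem splitCmd_spec {s : State} (hs : Setup n h E M s) (hb : Best n h E s)
    (hx : s.reg 10 < 2 ^ (2 * h)) :
    Best n h E (splitCmd.den s) ∧ (splitCmd.den s).reg 22 ≤ s.reg 22 ∧
      ∀ S ⊆ range n, #(S ∩ range (2 * h)) = h →
        ∑ u ∈ S ∩ range (2 * h), s.arr 0 u = s.reg 10 →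
        (splitCmd.den s).reg 22 ≤ #(boundary n E S) := by
  set X := decode n (s.arr 0) (s.reg 10) with hXdef
  have hXw : X ⊆ range (2 * h) := by
    intro v hv
    rw [hXdef, mem_decode] at hv
    rw [mem_range]
    by_contra! hcon
    rw [hs.weight v hv.1, Nat.div_eq_of_lt] at hv
    · simp at hv
    · exact hx.trans_le (Nat.pow_le_pow_right (by norm_num) hcon)
  set s₁ := countCmd.den s with hs₁
  have hF₁ := framed_den countCmd rfl (by decide) s
  have h₁ : Setup n h E M s₁ := hs.framed hF₁ (by decide) (by decide)
  have h18 : s₁.reg 18 = #X := countCmd_spec hs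
  have harr₁ : s₁.arr 0 = s.arr 0 := by
    funext i
    rw [hF₁.arr 0 (by norm_num) (by decide)]
  have h10 : s₁.reg 10 = s.reg 10 := hF₁.reg 10 (by decide)
  have h22 : s₁.reg 22 = s.reg 22 := hF₁.reg 22 (by decide)
  have hb₁ : Best n h E s₁ := hb.framed hF₁ (by decide) (by decide)
  have hSX : ∀ S ⊆ range n, ∑ u ∈ S ∩ range (2 * h), s.arr 0 u = s.reg 10 →
      S ∩ range (2 * h) = X := by
    intro S hS hsum
    rw [hXdef, ← hsum, hs.isWeight.decode_sum (inter_subset_left.trans hS)]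
  have hden : splitCmd.den s = (ite (1 - ((.reg 18 - .reg 7) + (.reg 7 - .reg 18)))
    (auctionCmd ;; candidateLoop) skip).den s₁ := rfl
  rw [hden, den]
  split_ifs with hc
  · have hXh : #X = h := by
      simp [h18, h₁.reg_seven] at hc
      omega
    set s₂ := auctionCmd.den s₁ with hs₂
    have hF₂ := framed_den auctionCmd rfl (by decide) s₁
    have h₂ : Setup n h E M s₂ := h₁.framed hF₂ (by decide) (by decide)
    have hb₂ : Best n h E s₂ := hb₁.framed hF₂ (by decide) (by decide)
    have ha := auctionCmd_spec h₁ (by rwa [harr₁, h10])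
    rw [harr₁, h10, ← hXdef, ← hs₂] at ha
    -- Every level set contains `X` and otherwise only vertices outside W, so it is balanced
    -- whatever the level.
    have hT : ∀ l ≤ n, h ≤ #(levelSet n l (s₂.arr 1)) ∧ #(levelSet n l (s₂.arr 1)) + h ≤ n := by
      intro l hl
      have h1 : X ⊆ levelSet n l (s₂.arr 1) := by
        intro u hu
        have := ha.label_mem u hu
        have := (mem_decode.1 hu).1
        simp only [levelSet, mem_filter, mem_range]
        omega
      have h2 : levelSet n l (s₂.arr 1) ⊆ X ∪ Ico (2 * h) n := by
        intro u hu
        simp only [levelSet, mem_filter, mem_range] at hu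
        simp only [mem_union, mem_Ico]
        by_contra! hcon
        have := ha.label_notMem u (by omega) hcon.1
        omega
      have h3 := card_le_card h1
      have h4 := (card_le_card h2).trans (card_union_le _ _)
      have := hs.le
      simp only [Nat.card_Ico] at h4
      omega
    obtain ⟨c1, c2, c3⟩ := candidateLoop_spec h₂ hb₂ hT
    rw [den_seq]
    refine ⟨c1, c2.trans (by rw [hF₂.reg 22 (by decide), h22]), fun S hS _ hsum => ?_⟩
    have hSX := hSX S hS hsum
    obtain ⟨l, hl, hl'⟩ := ha.exists_level hXw hs.le hS (fun u hu => by
      rw [← hSX]; simp [hu])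
    exact (c3 l hl).trans hl'
  · rw [den_skip, h22]
    refine ⟨hb₁, le_rfl, fun S hS hcard hsum => ?_⟩
    exfalso
    rw [hSX S hS hsum] at hcard
    simp [h18, h₁.reg_seven, hcard] at hc

theorem searchCmd_spec {s : State} (hs : Setup n h E M s) :
    Best n h E (searchCmd.den s) ∧
      ∀ S ⊆ range n, #(S ∩ range (2 * h)) = h → (searchCmd.den s).reg 22 ≤ #(boundary n E S) := by
  set s₁ := (set 22 (.reg 9)).den s with hs₁
  have hF₁ := framed_den (set 22 (.reg 9)) rfl (by decide) s
  have h₁ : Setup n h E M s₁ := hs.framed hF₁ (by decide) (by decide)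
  have hle := hs.toCtx.le
  -- The initial value exceeds every boundary size, so `Best` holds vacuously.
  have h22 : s₁.reg 22 = n + 1 := by simp [hs₁, hs.reg_nine, hs.reg_one]; omega
  have hb₁ : Best n h E s₁ := fun h => by omega
  have hden : searchCmd.den s = (forTo 10 4 splitCmd).den s₁ := rfl
  rw [hden]
  have := for_induction (i := 10) (b := 4) (p := splitCmd) s₁ rfl (by decide)
    (fun k s' => Best n h E s' ∧ ∀ S ⊆ range n, #(S ∩ range (2 * h)) = h →
      ∑ u ∈ S ∩ range (2 * h), s₁.arr 0 u < k → s'.reg 22 ≤ #(boundary n E S)) ?_ ?_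
  · refine ⟨this.1, fun S hS hc => this.2 S hS hc ?_⟩
    rw [h₁.reg_four]
    exact h₁.isWeight.sum_lt (inter_subset_left.trans hS)
      fun v hv => mem_range.1 (mem_inter.1 hv).2
  · exact ⟨hb₁.framed (framed_setReg _ (by norm_num) 0) (by decide) (by decide), by simp⟩
  · intro k hk s' hF hk' hI
    rw [h₁.reg_four] at hk
    have h' := h₁.framed hF (by decide) (by decide)
    have harr : s'.arr 0 = s₁.arr 0 := by funext i; exact hF.arr 0 (by norm_num) (by decide) i
    obtain ⟨c1, c2, c3⟩ := splitCmd_spec h' hI.1 (by omega)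
    refine ⟨c1.framed (framed_setReg _ (by norm_num) _) (by decide) (by decide), ?_⟩
    intro S hS hc hsum
    simp only [State.reg_setReg, Nat.reduceEqDiff, if_false]
    rcases Nat.lt_succ_iff_lt_or_eq.1 hsum with hsum | hsum
    · exact c2.trans (hI.2 S hS hc hsum)
    · exact c3 S hS hc (by rw [harr, hsum, hk'])

/-! ### Weights adapted to the set found -/

/-- Assignment of successive powers of two to the vertices with property `c`. -/
def passCmd (c : Expr) : Cmd :=
  forTo 12 0 (ite c (put 1 (.reg 12) (.reg 24) ;; set 24 (.reg 24 * 2)) skip)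

/-- Computation of weights for which the vertices of the set in register `23` come first. -/
def relabelCmd : Cmd :=
  set 24 1 ;; passCmd (bitE 0 23 12) ;; set 25 (.reg 24) ;; passCmd (1 - bitE 0 23 12)

theorem framed_passCmd (c : Expr) (s : State) :
    Framed [12, 24] [1] s ((passCmd c).den s) :=
  (framed_den (passCmd c) rfl (by exact (by decide : 2 ∉ [12, 24])) s).mono
    (by simp [passCmd, writes]) (by simp [passCmd, puts])

theorem passCmd_spec {s : State} (hs : Ctx n E M s) {c : Expr} (q : ℕ → Prop) [DecidablePred q]
    (hc : ∀ k < n, ∀ s', Framed [12, 24] [1] s s' → s'.reg 12 = k → (c.eval s' ≠ 0 ↔ q k))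
    {a : ℕ} (ha : s.reg 24 = 2 ^ a) (han : a + Nat.count q n ≤ n) :
    ((passCmd c).den s).reg 24 = 2 ^ (a + Nat.count q n) ∧
      ∀ v < n, ((passCmd c).den s).arr 1 v =
        if q v then 2 ^ (a + Nat.count q v) else s.arr 1 v := by
  have hM := hs.pow_le
  have hpow : ∀ k ≤ n, 2 ^ (a + Nat.count q k) ≤ 2 ^ n := fun k hk =>
    Nat.pow_le_pow_right (by norm_num) ((Nat.add_le_add_left (Nat.count_monotone q hk) a).trans han)
  have := for_induction (i := 12) (b := 0)
    (p := ite c (put 1 (.reg 12) (.reg 24) ;; set 24 (.reg 24 * 2)) skip) s rfl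
    (by exact (by decide : 2 ∉ [12, 24]))
    (fun k s' => s'.reg 24 = 2 ^ (a + Nat.count q k) ∧ ∀ v, s'.arr 1 v =
        if q v ∧ v < k then 2 ^ (a + Nat.count q v) else s.arr 1 v) ?_ ?_
  · rw [hs.reg_zero] at this
    refine ⟨this.1, fun v hv => ?_⟩
    rw [passCmd, this.2 v]
    simp [hv]
  · simp [ha]
  · intro k hk s' hF hk' hI
    rw [hs.reg_zero] at hk
    have hF' : Framed [12, 24] [1] s s' := hF.mono (by simp [writes]) (by simp [puts])
    have h1 := hF'.reg 1 (by decide)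
    have hck := hc k hk s' hF' hk'
    have hpk := hpow k (by omega)
    rw [den, Nat.count_succ]
    by_cases hq : q k
    · rw [if_pos (hck.2 hq), if_pos hq]
      constructor
      · simp [hI.1, h1, hs.reg_one, ← add_assoc, pow_succ]
        omega
      · intro v
        simp [hI.1, hI.2, h1, hs.reg_one, hk']
        by_cases hv : v = k
        · subst hv
          simp [hq]; omega
        · have : v ≤ k ↔ v < k := by omega
          simp [hv, this]
    · rw [if_neg (hck.not.2 hq), if_neg hq]
      refine ⟨by simp [hI.1], fun v => ?_⟩
      have : (q v ∧ v ≤ k) ↔ (q v ∧ v < k) := by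
        refine and_congr_right fun hqv => ?_
        have : v ≠ k := by rintro rfl; exact hq hqv
        omega
      simp [hI.2, this]

/-- The exponent of a vertex is its rank within its class, with the complement placed after `S`;
ranks within a class are distinct. -/
theorem isWeight_count {wt : ℕ → ℕ} {S : Finset ℕ} (hS : S ⊆ range n)
    (h1 : ∀ v < n, v ∈ S → wt v = 2 ^ Nat.count (· ∈ S) v)
    (h2 : ∀ v < n, v ∉ S → wt v = 2 ^ (#S + Nat.count (· ∉ S) v)) :
    ∃ p, IsWeight n wt p ∧ ∀ v < n, v ∈ S ↔ p v < #S := by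
  have c1 : Nat.count (· ∈ S) n = #S := by
    rw [Nat.count_eq_card_filter_range, filter_mem_eq_inter, inter_eq_right.2 hS]
  have c2 : Nat.count (· ∉ S) n = n - #S := by
    rw [Nat.count_eq_card_filter_range, filter_notMem_eq_sdiff, card_sdiff_of_subset hS, card_range]
  have hle : #S ≤ n := by simpa using card_le_card hS
  have d1 : ∀ v < n, v ∈ S → Nat.count (· ∈ S) v < #S := fun v hv hvS => by
    rw [← c1]; exact Nat.count_strict_mono hvS hv
  have d2 : ∀ v < n, v ∉ S → Nat.count (· ∉ S) v < n - #S := fun v hv hvS => by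
    rw [← c2]; exact Nat.count_strict_mono hvS hv
  refine ⟨fun v => if v ∈ S then Nat.count (· ∈ S) v else #S + Nat.count (· ∉ S) v,
    ⟨fun v hv => ?_, fun u hu v hv huv => ?_, fun v hv => ?_⟩, fun v hv => ?_⟩
  · split_ifs with hvS
    · have := d1 v hv hvS; omega
    · have := d2 v hv hvS; omega
  · split_ifs at huv with hu' hv' hv'
    · exact Nat.count_injective (p := (· ∈ S)) hu' hv' huv
    · have := d1 u hu hu'; omega
    · have := d1 v hv hv'; omega
    · exact Nat.count_injective (p := (· ∉ S)) hu' hv' (by omega)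
  · split_ifs with hvS
    · exact h1 v hv hvS
    · exact h2 v hv hvS
  · by_cases hvS : v ∈ S
    · simp [hvS, d1 v hv hvS]
    · simp [hvS]

theorem relabelCmd_spec {s : State} (hs : Setup n h E M s) :
    (relabelCmd.den s).reg 25 = 2 ^ #(decode n (s.arr 0) (s.reg 23)) ∧
      ∃ p, IsWeight n ((relabelCmd.den s).arr 1) p ∧ ∀ v < n,
        v ∈ decode n (s.arr 0) (s.reg 23) ↔ p v < #(decode n (s.arr 0) (s.reg 23)) := by
  set S := decode n (s.arr 0) (s.reg 23) with hS
  have hSn : S ⊆ range n := filter_subset _ _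
  have c1 : Nat.count (· ∈ S) n = #S := by
    rw [Nat.count_eq_card_filter_range, filter_mem_eq_inter, inter_eq_right.2 hSn]
  have c2 : Nat.count (· ∉ S) n = n - #S := by
    rw [Nat.count_eq_card_filter_range, filter_notMem_eq_sdiff, card_sdiff_of_subset hSn,
      card_range]
  have hle : #S ≤ n := by simpa using card_le_card hSn
  have hM := hs.pow_le
  have hMn := hs.toCtx.le
  have hpow : 2 ^ #S ≤ 2 ^ n := Nat.pow_le_pow_right (by norm_num) hle
  have hmem : ∀ s', s'.reg 23 = s.reg 23 → s'.arr 0 = s.arr 0 → ∀ k < n, s'.reg 12 = k →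
      ((bitE 0 23 12).eval s' ≠ 0 ↔ k ∈ S) := by
    intro s' h23 ha k hk hk'
    rw [eval_bitE, h23, ha, hk', hS, mem_decode]
    simp [hk]
  set s₁ := (set 24 1).den s with hs₁
  have hF₁ := framed_den (set 24 1) rfl (by decide) s
  have h₁ : Setup n h E M s₁ := hs.framed hF₁ (by decide) (by decide)
  have p1 := passCmd_spec h₁.toCtx (c := bitE 0 23 12) (· ∈ S) (a := 0)
    (fun k hk s' hF hk' => hmem s' (by rw [hF.reg 23 (by decide), hF₁.reg 23 (by decide)])
      (by funext i; rw [hF.arr 0 (by norm_num) (by decide), hF₁.arr 0 (by norm_num) (by decide)])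
      k hk hk') (by simp [hs₁, hs.reg_one]; omega) (by omega)
  set s₂ := (passCmd (bitE 0 23 12)).den s₁ with hs₂
  have hF₂ := framed_passCmd (bitE 0 23 12) s₁
  have h₂ : Setup n h E M s₂ := h₁.framed hF₂ (by decide) (by decide)
  set s₃ := (set 25 (.reg 24)).den s₂ with hs₃
  have hF₃ := framed_den (set 25 (.reg 24)) rfl (by decide) s₂
  have h₃ : Setup n h E M s₃ := h₂.framed hF₃ (by decide) (by decide)
  rw [zero_add, c1] at p1
  have h25 : s₃.reg 25 = 2 ^ #S := by simp [hs₃, p1.1, h₂.reg_one]; omega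
  have p2 := passCmd_spec h₃.toCtx (c := 1 - bitE 0 23 12) (· ∉ S) (a := #S)
    (fun k hk s' hF hk' => by
      have := hmem s' (by rw [hF.reg 23 (by decide), hF₃.reg 23 (by decide),
        hF₂.reg 23 (by decide), hF₁.reg 23 (by decide)])
        (by funext i; rw [hF.arr 0 (by norm_num) (by decide),
          hF₃.arr 0 (by norm_num) (by decide), hF₂.arr 0 (by norm_num) (by decide),
          hF₁.arr 0 (by norm_num) (by decide)]) k hk hk'
      rw [← this, Expr.eval_sub, Expr.eval_ofNat]
      rw [eval_bitE]
      split_ifs <;> simp)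
    (by rw [hF₃.reg 24 (by decide), p1.1]) (by omega)
  have hF₄ := framed_passCmd (1 - bitE 0 23 12) s₃
  have hden : relabelCmd.den s = (passCmd (1 - bitE 0 23 12)).den s₃ := rfl
  rw [hden]
  refine ⟨by rw [hF₄.reg 25 (by decide), h25], isWeight_count hSn (fun v hv hvS => ?_)
    fun v hv hvS => ?_⟩
  · rw [p2.2 v hv, if_neg (by simpa using hvS), hF₃.arr 1 (by norm_num) (by decide), p1.2 v hv,
      if_pos hvS, zero_add]
  · rw [p2.2 v hv, if_pos hvS]

/-! ### Program for the dynamic program -/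

/-- The table entry of the set without the vertex in register `12`. -/
def predE : Expr := .get 3 (.reg 15 - .get 1 (.reg 12))

/-- Candidates that are not members, or whose predecessor entry is empty, receive the penalty M and
never beat the initial value of the minimum. The last command forms a maximum by truncated
subtraction. -/
def fillCmd : Cmd :=
  set 15 (.reg 26) ;; boundaryCmd 1 ;; set 27 (.reg 1) ;;
    accLoop 12 0 27 (.reg 27 - (.reg 27 -
      (predE + (1 - bitE 1 15 12 * flagE predE) * .reg 1))) ;;
    put 3 (.reg 15) (.reg 16 + 1 + (.reg 27 - (.reg 16 + 1)))

/-- With a = 2^|S| in register `25`, codes advance by 1 below a - 1 and by a from there on. -/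
def tableStep : Cmd :=
  set 26 (.reg 15 + 1 + (1 - (.reg 25 - 1 - .reg 15)) * (.reg 25 - 1)) ;;
    ite (.reg 8 - .reg 26) fillCmd skip

/-- The dynamic program over the sets comparable with a given set. -/
def tableCmd : Cmd := set 15 0 ;; put 3 0 1 ;; forTo 13 5 tableStep

theorem fillCmd_spec {s : State} (hs : Setup n h E M s) (hx : s.reg 26 < 2 ^ n)
    (hwt : ∀ v < n, 1 ≤ s.arr 1 v) (ht : Table n E (s.arr 1) M k (s.arr 3) (s.reg 15))
    (hlt : s.reg 15 < s.reg 26)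
    (hgap : ∀ z, s.reg 15 < z → z < s.reg 26 → ¬ Comparable k z) :
    Table n E (s.arr 1) M k ((fillCmd.den s).arr 3) (s.reg 26) ∧
      (fillCmd.den s).reg 15 = s.reg 26 := by
  set x := s.reg 26 with hxdef
  have hM := hs.pow_le
  have hMn := hs.toCtx.le
  set s₁ := (set 15 (.reg 26)).den s with hs₁
  have hF₁ := framed_den (set 15 (.reg 26)) rfl (by decide) s
  have h₁ : Setup n h E M s₁ := hs.framed hF₁ (by decide) (by decide)
  have h15 : s₁.reg 15 = x := by simp [hs₁, hs.reg_one, ← hxdef]; omega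
  have h16 := boundaryCmd_spec h₁.toCtx (c := 1) (by norm_num)
  have harr₁ : ∀ c, s₁.arr c = s.arr c := fun c => by funext i; simp [hs₁]
  rw [h15, harr₁] at h16
  set s₂ := (boundaryCmd 1).den s₁ with hs₂
  have hF₂ := framed_boundaryCmd 1 s₁
  have h₂ : Setup n h E M s₂ := h₁.framed hF₂ (by decide) (by decide)
  set s₃ := (set 27 (.reg 1)).den s₂ with hs₃
  have hF₃ := framed_den (set 27 (.reg 1)) rfl (by decide) s₂
  have h₃ : Setup n h E M s₃ := h₂.framed hF₃ (by decide) (by decide)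
  have harr₃ : ∀ c < 4, s₃.arr c = s.arr c := fun c hc => by
    funext i
    rw [hF₃.arr c hc (by simp [puts]), hF₂.arr c hc (by simp), harr₁]
  have h15₃ : s₃.reg 15 = x := by rw [hF₃.reg 15 (by decide), hF₂.reg 15 (by decide), h15]
  have h16₃ : s₃.reg 16 = #(boundary n E (decode n (s.arr 1) x)) := by
    rw [hF₃.reg 16 (by decide), h16]
  have h27₃ : s₃.reg 27 = M := by simp [hs₃, h₂.reg_one]
  set φ : ℕ → ℕ := fun v => s.arr 3 (x - s.arr 1 v) +
    (1 - (if x / s.arr 1 v % 2 = 1 then 1 else 0) *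
      if s.arr 3 (x - s.arr 1 v) = 0 then 0 else 1) * M with hφ
  obtain ⟨m, hm, hmM, hmle, hmex⟩ := den_minLoop (i := 12) (b := 0) (acc := 27)
    (e := predE + (1 - bitE 1 15 12 * flagE predE) * .reg 1) s₃ (by norm_num) (by norm_num)
    (by norm_num) φ (by rw [h27₃, h₃.reg_one]) (by
      intro k hk x
      simp only [Expr.eval_add, Expr.eval_mul, Expr.eval_sub, eval_bitE, eval_flagE,
        Expr.eval_ofNat, predE, Expr.eval_get, Expr.eval_reg]
      simp [harr₃, h15₃, hφ, h₃.reg_one])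
  rw [h₃.reg_zero] at hm hmle hmex
  rw [h27₃] at hmM hmex
  have hden : fillCmd.den s = (put 3 (.reg 15) (.reg 16 + 1 + (.reg 27 - (.reg 16 + 1)))).den
      ((s₃.setReg 27 m).setReg 12 n) := by
    rw [← hm]; rfl
  have hbn := card_boundary_le n E (decode n (s.arr 1) x)
  have ha3 : (fillCmd.den s).arr 3 = Function.update (s.arr 3) x
      (max (#(boundary n E (decode n (s.arr 1) x)) + 1) m) := by
    funext i
    rw [hden]
    simp only [Nat.reduceLT, arr_put, Expr.eval_reg, State.reg_setReg, Nat.reduceEqDiff, if_false,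
      if_true, h15₃, Expr.eval_add, Expr.eval_sub, Expr.eval_ofNat, h16₃, h₃.reg_one,
      State.arr_setReg, ne_eq, not_false_eq_true, harr₃, true_and, Function.update_apply]
    split_ifs <;> omega
  refine ⟨?_, by rw [hden]; simp [h15₃]⟩
  rw [ha3]
  refine ht.step (by omega) hwt hlt hgap hmM (fun v hv hv0 => ?_) ?_
  · rw [mem_decode] at hv
    have := hmle v hv.1
    simpa [hφ, hv.2, hv0] using this
  · rcases hmex with hmex | ⟨v, hv, hmv⟩
    · exact .inl hmex
    · by_cases hc : x / s.arr 1 v % 2 = 1 ∧ s.arr 3 (x - s.arr 1 v) ≠ 0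
      · refine .inr ⟨v, mem_decode.2 ⟨hv, hc.1⟩, hc.2, ?_⟩
        simpa [hφ, hc.1, hc.2] using hmv
      · left
        have : φ v = s.arr 3 (x - s.arr 1 v) + M := by
          simp only [hφ]
          split_ifs with c1 c2
          · simp
          · exact absurd ⟨c1, c2⟩ hc
          · simp
          · simp
        omega

/-- The sequence of the codes of the sets that the dynamic program runs through. -/
def code (a b k : ℕ) : ℕ := min k (a - 1) + a * min (k - (a - 1)) (b - 1)

/-- Subsets of S have the codes below `a`, supersets those congruent to -1 modulo `a`. The two runs
share `a - 1`, the code of S, and no code of either kind is skipped. At `a * b - 1` the sequence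
stays put. -/
theorem code_succ {a b j : ℕ} (ha : 1 ≤ a) (hb : 1 ≤ b) :
    (code a b j + 1 + (1 - (a - 1 - code a b j)) * (a - 1) < a * b →
      code a b (j + 1) = code a b j + 1 + (1 - (a - 1 - code a b j)) * (a - 1) ∧
      ∀ z, code a b j < z → z < code a b (j + 1) → ¬ (z < a ∨ z % a = a - 1)) ∧
    (¬ code a b j + 1 + (1 - (a - 1 - code a b j)) * (a - 1) < a * b →
      code a b (j + 1) = code a b j) := by
  by_cases hj : j < a - 1
  · have e1 : code a b j = j := by
      have : j - (a - 1) = 0 := by omega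
      simp [code, this]; omega
    have e2 : code a b (j + 1) = j + 1 := by
      have : j + 1 - (a - 1) = 0 := by omega
      simp [code, this]; omega
    have e3 : 1 - (a - 1 - j) = 0 := by omega
    have : a * 1 ≤ a * b := Nat.mul_le_mul_left a hb
    rw [e1, e2, e3]
    exact ⟨fun _ => ⟨by omega, fun z h1 h2 => by omega⟩, fun h => by omega⟩
  · set i := min (j - (a - 1)) (b - 1) with hi
    have e1 : code a b j = a - 1 + a * i := by
      simp [code, hi]; omega
    have e2 : code a b (j + 1) = a - 1 + a * min (j + 1 - (a - 1)) (b - 1) := by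
      simp [code]; omega
    have e3 : 1 - (a - 1 - code a b j) = 1 := by omega
    have e4 : a * b = a * (b - 1) + a := by
      rw [← Nat.mul_succ]; congr 1; omega
    rw [e3, one_mul, e1, e2]
    constructor
    · intro hlt
      have hib : i < b - 1 := by
        by_contra hcon
        have : i = b - 1 := by omega
        rw [this] at hlt
        omega
      have e5 : min (j + 1 - (a - 1)) (b - 1) = i + 1 := by omega
      rw [e5, Nat.mul_succ]
      refine ⟨by omega, fun z h1 h2 h3 => ?_⟩
      have : a * 0 ≤ a * i := by gcongr; omega
      rcases h3 with h3 | h3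
      · omega
      · have h4 : z = (z - a * (i + 1)) + a * (i + 1) := by
          rw [Nat.mul_succ]; omega
        rw [h4, Nat.add_mul_mod_self_left, Nat.mod_eq_of_lt] at h3
        · rw [Nat.mul_succ] at h3; omega
        · rw [Nat.mul_succ]; omega
    · intro hge
      have hib : i = b - 1 := by
        by_contra hcon
        have : a * (i + 1) ≤ a * (b - 1) := by gcongr; omega
        rw [Nat.mul_succ] at this
        omega
      have e5 : min (j + 1 - (a - 1)) (b - 1) = i := by omega
      rw [e5]

theorem tableCmd_spec {s : State} (hs : Setup n h E M s) (hk : s.reg 25 = 2 ^ k) (hk1 : h ≤ k)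
    (hk2 : k + h ≤ n) (hwt : ∀ v < n, 1 ≤ s.arr 1 v) (h3 : ∀ i, s.arr 3 i = 0) :
    Table n E (s.arr 1) M k ((tableCmd.den s).arr 3) (2 ^ n - 1) := by
  have hM := hs.pow_le
  have hMn := hs.toCtx.le
  set a := 2 ^ k with ha
  set b := 2 ^ (n - k) with hb
  have hab : a * b = 2 ^ n := by rw [ha, hb, ← pow_add]; congr 1; omega
  have ha1 : 1 ≤ a := Nat.one_le_two_pow
  have hb1 : 1 ≤ b := Nat.one_le_two_pow
  have haN : a ≤ 2 ^ n := Nat.pow_le_pow_right (by norm_num) (by omega)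
  set s₁ := (set 15 0 ;; put 3 0 1).den s with hs₁
  have hF₁ := framed_den (set 15 0 ;; put 3 0 1) rfl (by decide) s
  have h₁ : Setup n h E M s₁ := hs.framed hF₁ (by decide) (by decide)
  have hden : tableCmd.den s = (forTo 13 5 tableStep).den s₁ := rfl
  have harr₁ : s₁.arr 1 = s.arr 1 := by funext i; rw [hF₁.arr 1 (by norm_num) (by decide)]
  have h25₁ : s₁.reg 25 = a := by rw [hF₁.reg 25 (by decide), hk]
  have h15₁ : s₁.reg 15 = 0 := by simp [hs₁]
  have h0 : Table n E (s.arr 1) M k (s₁.arr 3) 0 := by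
    refine .init ?_ fun x hx => ?_
    · simp [hs₁, hs.reg_one]; omega
    · simp [hs₁, hx, h3]
  have := for_induction (i := 13) (b := 5) (p := tableStep) s₁ rfl (by decide)
    (fun j s' => s'.reg 15 = code a b j ∧ Table n E (s.arr 1) M k (s'.arr 3) (s'.reg 15)) ?_ ?_
  · rw [h₁.reg_five] at this
    -- Balance gives a, b ≤ 2 ^ (n - h), so the fixed number of rounds suffices for both runs
    -- whatever the size of the set; surplus rounds are idle.
    have hfin : code a b (2 * 2 ^ (n - h)) = 2 ^ n - 1 := by
      have h1 : a ≤ 2 ^ (n - h) := Nat.pow_le_pow_right (by norm_num) (by omega)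
      have h2 : b ≤ 2 ^ (n - h) := Nat.pow_le_pow_right (by norm_num) (by omega)
      have e : a * b = a * (b - 1) + a := by rw [← Nat.mul_succ]; congr 1; omega
      rw [code, min_eq_right (by omega), min_eq_right (by omega), ← hab]
      omega
    rw [hden, ← hfin, ← this.1]
    exact this.2
  · have e : (s₁.setReg 13 0).arr 3 = s₁.arr 3 := by funext i; simp
    rw [e]
    simp [h15₁, code, h0]
  · intro j _ s' hF _ hI
    obtain ⟨hI1, hI2⟩ := hI
    have h' := h₁.framed hF (by decide) (by decide)
    have h25 : s'.reg 25 = a := by rw [hF.reg 25 (by decide), h25₁]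
    have harr1 : s'.arr 1 = s.arr 1 := by
      funext i; rw [hF.arr 1 (by norm_num) (by decide), harr₁]
    have e : ((tableStep.den s').setReg 13 (j + 1)).arr 3 = (tableStep.den s').arr 3 := by
      funext i; simp
    rw [e]
    simp only [State.reg_setReg, Nat.reduceEqDiff, if_false]
    have hle15 : s'.reg 15 < 2 ^ n := by
      rw [hI1, code, ← hab]
      have : a * min (j - (a - 1)) (b - 1) ≤ a * (b - 1) := by gcongr; omega
      have e : a * b = a * (b - 1) + a := by rw [← Nat.mul_succ]; congr 1; omega
      omega
    set c := s'.reg 15 + 1 + (1 - (a - 1 - s'.reg 15)) * (a - 1) with hc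
    have hcM : c ≤ M := by
      have : (1 - (a - 1 - s'.reg 15)) * (a - 1) ≤ 1 * (a - 1) := by gcongr; omega
      omega
    set s₂ := s'.setReg 26 c with hs₂
    have hs₂' : (set 26 (.reg 15 + 1 + (1 - (.reg 25 - 1 - .reg 15)) * (.reg 25 - 1))).den s' =
        s₂ := by
      rw [den_set, hs₂]
      congr 1
      simp only [Expr.eval_add, Expr.eval_mul, Expr.eval_sub, Expr.eval_reg, Expr.eval_ofNat, h25,
        h'.reg_one, ← hc]
      omega
    have h₂ : Setup n h E M s₂ := h'.framed (framed_setReg _ (by norm_num) _) (by decide)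
      (by decide)
    have harr₂ : ∀ i, s₂.arr i = s'.arr i := fun i => by funext l; simp [hs₂]
    have hstep : tableStep.den s' = (ite (.reg 8 - .reg 26) fillCmd skip).den s₂ := by
      rw [← hs₂']; rfl
    have h15 : s₂.reg 15 = s'.reg 15 := by simp [hs₂]
    have h26 : s₂.reg 26 = c := by simp [hs₂]
    have hcode := code_succ (j := j) ha1 hb1
    rw [← hI1, ← hc, hab] at hcode
    rw [hstep, den]
    by_cases hcn : c < 2 ^ n
    · obtain ⟨e1, e2⟩ := hcode.1 hcn
      rw [if_pos (by simp [h₂.reg_eight, h26]; omega)]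
      have := fillCmd_spec (k := k) h₂ (by rwa [h26])
        (by rw [harr₂, harr1]; exact hwt)
        (by rw [harr₂, harr₂, harr1, h15]; exact hI2) (by rw [h15, h26]; omega)
        (fun z h1 h2 => by
          rw [h15] at h1; rw [h26, ← e1] at h2
          exact e2 z h1 h2)
      rw [harr₂, harr1, h26] at this
      rw [this.2, e1]
      exact ⟨rfl, this.1⟩
    · rw [if_neg (by simp [h₂.reg_eight, h26]; omega), den_skip, h15, harr₂]
      exact ⟨by rw [hcode.2 hcn], hI2⟩

/-! ### Reading off the ordering -/

/-- Whether the vertex in register `12` can be the last one of the set in register `15`. -/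
def lastE : Expr := bitE 1 15 12 * flagE predE * (1 - (predE - .get 3 (.reg 15)))

def pickCmd : Cmd := set 28 0 ;; accLoop 12 0 28 (lastE * .reg 12 + (1 - lastE) * .reg 28)

def outputStep : Cmd :=
  pickCmd ;; store (.reg 28) (.reg 0 - 1 - .reg 13) ;; set 15 (.reg 15 - .get 1 (.reg 28))

/-- Reading an ordering off the table. -/
def outputCmd : Cmd := set 15 (.reg 8 - 1) ;; forTo 13 0 outputStep

theorem pickCmd_spec {s : State} (h0 : s.reg 0 = n) (h1 : n ≤ s.reg 1)
    (hex : ∃ v ∈ decode n (s.arr 1) (s.reg 15), s.arr 3 (s.reg 15 - s.arr 1 v) ≠ 0 ∧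
      s.arr 3 (s.reg 15 - s.arr 1 v) ≤ s.arr 3 (s.reg 15)) :
    ∃ v ∈ decode n (s.arr 1) (s.reg 15), (s.arr 3 (s.reg 15 - s.arr 1 v) ≠ 0 ∧
      s.arr 3 (s.reg 15 - s.arr 1 v) ≤ s.arr 3 (s.reg 15)) ∧
      pickCmd.den s = ((s.setReg 28 0).setReg 28 v).setReg 12 n := by
  classical
  set q : ℕ → Prop := fun v => s.reg 15 / s.arr 1 v % 2 = 1 ∧
    s.arr 3 (s.reg 15 - s.arr 1 v) ≠ 0 ∧
      s.arr 3 (s.reg 15 - s.arr 1 v) ≤ s.arr 3 (s.reg 15) with hq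
  -- The largest admissible vertex below `k`, with default `0`, which is not used since an
  -- admissible vertex exists.
  set F : ℕ → ℕ := fun k => k.rec 0 fun j a => if q j then j else a with hF
  have hs : ∀ j, F (j + 1) = if q j then j else F j := fun j => rfl
  have hFn : ∀ j ≤ n, F j ≤ n := by
    intro j
    induction j with
    | zero => exact fun _ => Nat.zero_le _
    | succ j ih =>
      intro hj
      rw [hs]; split_ifs
      · omega
      · exact ih (by omega)
  have hFq : ∀ j, (∃ v < j, q v) → F j < j ∧ q (F j) := by
    intro j
    induction j with
    | zero => rintro ⟨v, hv, -⟩; omega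
    | succ j ih =>
      rintro ⟨v, hv, hqv⟩
      rw [hs]; split_ifs with hqj
      · exact ⟨by omega, hqj⟩
      · have : v ≠ j := by rintro rfl; exact hqj hqv
        have := ih ⟨v, by omega, hqv⟩
        exact ⟨by omega, this.2⟩
  obtain ⟨v, hv, hv'⟩ := hex
  rw [mem_decode] at hv
  obtain ⟨f1, f2⟩ := hFq n ⟨v, hv.1, hv.2, hv'⟩
  refine ⟨F n, mem_decode.2 ⟨f1, f2.1⟩, f2.2, ?_⟩
  have := den_accLoop (i := 12) (b := 0) (acc := 28)
    (e := lastE * .reg 12 + (1 - lastE) * .reg 28) (s.setReg 28 0) (by norm_num) (by norm_num)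
    (by norm_num) F (by simp [hF]) ?_
  · rw [pickCmd, den_seq, den_set]
    simp only [State.reg_setReg, h0] at this
    simpa using this
  · intro j hj
    simp [h0] at hj
    have hle := hFn j (by omega)
    set s' := ((s.setReg 28 0).setReg 28 (F j)).setReg 12 j with hs'
    have he : lastE.eval s' = if q j then 1 else 0 := by
      simp only [lastE, Expr.eval_mul, Expr.eval_sub, eval_bitE, eval_flagE, Expr.eval_ofNat,
        predE, Expr.eval_get, Expr.eval_reg, hs']
      simp only [State.reg_setReg, State.arr_setReg, ne_eq, Nat.reduceEqDiff, not_false_eq_true,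
        if_false, if_true, hq]
      by_cases c1 : s.reg 15 / s.arr 1 j % 2 = 1 <;>
        by_cases c2 : s.arr 3 (s.reg 15 - s.arr 1 j) = 0 <;> simp [c1, c2]
      split_ifs <;> omega
    rw [hs, Expr.eval_add, Expr.eval_mul, Expr.eval_mul, Expr.eval_sub, he]
    simp only [Expr.eval_reg, Expr.eval_ofNat, hs', State.reg_setReg]
    split_ifs <;> simp <;> omega

theorem arr_setMem_of_lt {s : State} {a : ℕ} (ha : a < s.reg 2) (v i : ℕ) :
    (s.setMem a v).arr i = s.arr i := by
  funext j
  simp only [State.arr, State.mem_setMem, State.reg_setMem]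
  rw [if_neg (by omega)]

/-- The invariant of the output loop: the vertices outside `Q` have got the last positions. -/
structure Suffix (n c : ℕ) (E : ℕ → ℕ → Prop) (Q : Finset ℕ) (pos : ℕ → ℕ) : Prop where
  subset : Q ⊆ range n
  le_pos : ∀ v < n, v ∉ Q → #Q ≤ pos v
  pos_lt : ∀ v < n, v ∉ Q → pos v < n
  inj : ∀ u < n, ∀ v < n, u ∉ Q → v ∉ Q → pos u = pos v → u = v
  width : ∀ i ≤ n, #Q ≤ i → #(boundary n E {v ∈ range n | v ∈ Q ∨ pos v < i}) ≤ c

theorem Suffix.init {pos : ℕ → ℕ} : Suffix n c E (range n) pos where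
  subset := subset_rfl
  le_pos v hv hv' := absurd (mem_range.2 hv) hv'
  pos_lt v hv hv' := absurd (mem_range.2 hv) hv'
  inj u hu _ _ hu' := absurd (mem_range.2 hu) hu'
  width i _ _ := by
    have : ({v ∈ range n | v ∈ range n ∨ pos v < i} : Finset ℕ) = range n := by
      ext v; simp; tauto
    rw [this, boundary_range]
    simp

/-- Cuts at positions from |Q| on are the same as before. The only new cut is at |Q| - 1, and its
set is `Q` without `v`. -/
theorem Suffix.step {Q : Finset ℕ} {pos : ℕ → ℕ} (hQ : Suffix n c E Q pos) {v : ℕ} (hv : v ∈ Q)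
    (hb : #(boundary n E (Q.erase v)) ≤ c) :
    Suffix n c E (Q.erase v) (Function.update pos v (#Q - 1)) := by
  have hcard := card_erase_of_mem hv
  have hpos : 0 < #Q := card_pos.2 ⟨v, hv⟩
  have hQn : #Q ≤ n := by simpa using card_le_card hQ.subset
  have hmem : ∀ u, u ∉ Q.erase v → u = v ∨ u ∉ Q := fun u hu => by
    rw [mem_erase] at hu; tauto
  refine ⟨(erase_subset _ _).trans hQ.subset, fun u hu hu' => ?_, fun u hu hu' => ?_,
    fun u hu x hx hu' hx' he => ?_, fun i hi hi' => ?_⟩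
  · rcases hmem u hu' with rfl | h
    · simp [hcard]
    · rw [Function.update_of_ne (by rintro rfl; exact h hv)]
      have := hQ.le_pos u hu h
      omega
  · rcases hmem u hu' with rfl | h
    · simp; omega
    · rw [Function.update_of_ne (by rintro rfl; exact h hv)]
      exact hQ.pos_lt u hu h
  · have hne : ∀ y, y ∉ Q → y ≠ v := fun y hy => by rintro rfl; exact hy hv
    rcases hmem u hu' with rfl | h1 <;> rcases hmem x hx' with rfl | h2
    · rfl
    · rw [Function.update_self, Function.update_of_ne (hne x h2)] at he
      have := hQ.le_pos x hx h2
      omega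
    · rw [Function.update_self, Function.update_of_ne (hne u h1)] at he
      have := hQ.le_pos u hu h1
      omega
    · rw [Function.update_of_ne (hne x h2), Function.update_of_ne (hne u h1)] at he
      exact hQ.inj u hu x hx h1 h2 he
  · have hmono : ∀ u < n, u ∉ Q.erase v → #Q - 1 ≤ Function.update pos v (#Q - 1) u := by
      intro u hu hu'
      rcases hmem u hu' with rfl | h
      · simp
      · rw [Function.update_of_ne (by rintro rfl; exact h hv)]
        have := hQ.le_pos u hu h
        omega
    rcases Nat.lt_or_ge i #Q with hlt | hge
    · have : ({u ∈ range n | u ∈ Q.erase v ∨ Function.update pos v (#Q - 1) u < i} : Finset ℕ) =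
          Q.erase v := by
        ext u
        simp only [mem_filter, mem_range]
        constructor
        · rintro ⟨hu, hu' | hu'⟩
          · exact hu'
          · by_contra hcon
            have := hmono u hu hcon
            omega
        · intro hu
          exact ⟨mem_range.1 (hQ.subset (mem_of_mem_erase hu)), .inl hu⟩
      rw [this]; exact hb
    · have : ({u ∈ range n | u ∈ Q.erase v ∨ Function.update pos v (#Q - 1) u < i} : Finset ℕ) =
          {u ∈ range n | u ∈ Q ∨ pos u < i} := by
        ext u
        simp only [mem_filter, mem_range, mem_erase]
        refine and_congr_right fun hu => ?_
        by_cases huv : u = v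
        · subst huv; simp [hv]; omega
        · simp [huv]
      rw [this]
      exact hQ.width i hi hge

theorem outputCmd_spec {s : State} {p : ℕ → ℕ} (hs : Setup n h E M s)
    (hp : IsWeight n (s.arr 1) p) (ht : Table n E (s.arr 1) M k (s.arr 3) (2 ^ n - 1))
    (h0 : s.arr 3 (2 ^ n - 1) ≠ 0) (hc : s.arr 3 (2 ^ n - 1) ≤ c + 1) (hcM : c + 1 < M) :
    Suffix n c E ∅ (outputCmd.den s).mem := by
  have hM := hs.pow_le
  have hMn := hs.toCtx.le
  set s₁ := (set 15 (.reg 8 - 1)).den s with hs₁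
  have hF₁ := framed_den (set 15 (.reg 8 - 1)) rfl (by decide) s
  have h₁ : Setup n h E M s₁ := hs.framed hF₁ (by decide) (by decide)
  have h15 : s₁.reg 15 = 2 ^ n - 1 := by simp [hs₁, hs.reg_eight, hs.reg_one]; omega
  have harr : ∀ i, s₁.arr i = s.arr i := fun i => by funext l; simp [hs₁]
  have hn := hp.sum_prefix (S := range n) (s := n) subset_rfl
    (fun v hv => hp.lt v (mem_range.1 hv)) (by simp)
  -- The output overwrites the adjacency matrix, so the context is not preserved; only the two
  -- arrays needed and the table entry of the remaining set are tracked.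
  have := iter_induction (i := 13) (b := 0) (p := outputStep) s₁
    (fun j s' => s'.arr 1 = s.arr 1 ∧ s'.arr 3 = s.arr 3 ∧ ∃ Q, Suffix n c E Q s'.mem ∧
      #Q = n - j ∧ s'.reg 15 = ∑ v ∈ Q, s.arr 1 v ∧ s.arr 3 (s'.reg 15) ≠ 0 ∧
      s.arr 3 (s'.reg 15) ≤ c + 1) ?_ ?_
  · rw [h₁.reg_zero] at this
    obtain ⟨-, -, Q, hQ, hcard, -⟩ := this
    rw [Nat.sub_self, card_eq_zero] at hcard
    subst hcard
    exact hQ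
  · have e : ∀ i, (s₁.setReg 13 0).arr i = s.arr i := fun i => by funext l; simp [harr]
    refine ⟨e 1, e 3, range n, .init, by simp, ?_, ?_, ?_⟩
    · simp [h15, hn]
    · simpa [h15] using h0
    · simpa [h15] using hc
  · intro j hj s' hF hj' hI
    rw [h₁.reg_zero] at hj
    obtain ⟨a1, a3, Q, hQ, hcard, hsum, hne, hle⟩ := hI
    have r0 : s'.reg 0 = n := by rw [hF 0 (by decide), h₁.reg_zero]
    have r1 : s'.reg 1 = M := by rw [hF 1 (by decide), h₁.reg_one]
    have r2 : s'.reg 2 = n * n := by rw [hF 2 (by decide), h₁.reg_two]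
    have hdec : decode n (s.arr 1) (s'.reg 15) = Q := by rw [hsum, hp.decode_sum hQ.subset]
    have hQne : Q.Nonempty := by rw [← card_pos]; omega
    have hpos : s'.reg 15 ≠ 0 := by
      obtain ⟨v, hv⟩ := hQne
      have h1 := sum_erase_add Q (s.arr 1) hv
      have h2 := hp.eq v (mem_range.1 (hQ.subset hv))
      have : 0 < 2 ^ p v := by positivity
      omega
    have hx : s'.reg 15 < 2 ^ n := by
      rw [hsum]
      exact hp.sum_lt hQ.subset fun v hv => hp.lt v (mem_range.1 (hQ.subset hv))
    -- The entry is at most `c + 1 < M`, hence finite, so it comes from a predecessor.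
    have hpred := ht.pred _ hpos hne (by omega)
    obtain ⟨v, hv, hv', hpick⟩ := pickCmd_spec (s := s') r0 (by omega) (by rw [a1, a3]; exact hpred)
    rw [a1, hdec] at hv
    rw [a1, a3] at hv'
    have hvn := mem_range.1 (hQ.subset hv)
    -- Output cells lie below the base address of the arrays, so weights and table stay intact.
    have hvnn : v < n * n := hvn.trans_le (Nat.le_mul_self n)
    set s₂ := ((s'.setReg 28 0).setReg 28 v).setReg 12 n with hs₂
    set s₃ := s₂.setMem v (n - 1 - j) with hs₃
    have hs₃' : (store (.reg 28) (.reg 0 - 1 - .reg 13)).den s₂ = s₃ := by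
      simp only [den, hs₃, Expr.eval_reg, Expr.eval_sub, Expr.eval_ofNat]
      congr 1
      simp [hs₂, r0, r1, hj']
      omega
    have e₂ : ∀ i, s₂.arr i = s'.arr i := fun i => by funext l; simp [hs₂]
    have e₃ : ∀ i, s₃.arr i = s'.arr i := fun i => by
      rw [hs₃, arr_setMem_of_lt (by simpa [hs₂, r2] using hvnn), e₂]
    have hsum' := sum_erase_add Q (s.arr 1) hv
    have hden : (outputStep.den s').setReg 13 (j + 1) =
        (s₃.setReg 15 (∑ u ∈ Q.erase v, s.arr 1 u)).setReg 13 (j + 1) := by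
      rw [outputStep, den_seq, den_seq, hpick, hs₃', den_set]
      congr 2
      have f28 : s₃.reg 28 = v := by simp [hs₃, hs₂]
      have f15 : s₃.reg 15 = s'.reg 15 := by simp [hs₃, hs₂]
      have f1 : s₃.reg 1 = M := by simp [hs₃, hs₂, r1]
      simp only [Expr.eval_sub, Expr.eval_get, Expr.eval_reg, f28, f15, f1, e₃, a1]
      omega
    have hx' : s'.reg 15 - s.arr 1 v = ∑ u ∈ Q.erase v, s.arr 1 u := by omega
    rw [hx'] at hv'
    have hb : #(boundary n E (Q.erase v)) ≤ c := by
      have := ht.lower _ hv'.1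
      rw [hp.decode_sum ((erase_subset _ _).trans hQ.subset)] at this
      omega
    rw [hden]
    have e : ∀ i, ((s₃.setReg 15 (∑ u ∈ Q.erase v, s.arr 1 u)).setReg 13 (j + 1)).arr i =
        s'.arr i := fun i => by
      rw [← e₃]; funext l; simp
    refine ⟨by rw [e, a1], by rw [e, a3], Q.erase v, ?_, ?_, ?_, ?_, ?_⟩
    · have := hQ.step hv hb
      have hmem : ((s₃.setReg 15 (∑ u ∈ Q.erase v, s.arr 1 u)).setReg 13 (j + 1)).mem =
          Function.update s'.mem v (#Q - 1) := by
        have : #Q - 1 = n - 1 - j := by omega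
        rw [this]; rfl
      rwa [hmem]
    · rw [card_erase_of_mem hv]; omega
    · simp
    · simpa using hv'.1
    · simpa using hv'.2.trans hle

/-! ### The truncation threshold and the parameters -/

/-- Computation of the truncation threshold `256 * 4 ^ n`. -/
def growLoop : Prog :=
  .loop (.reg 10) (.seq (.assign 1 (.reg 1 * 4)) (.assign 10 (.reg 10 - 1)))

/-- This cannot be a counting program: register `1` is initially zero and would cap every stored
value at zero. -/
def growProg : Prog := .seq (.assign 1 (.const 256)) (.seq (.assign 10 (.reg 0)) growLoop)

theorem exec_growLoop {B : ℕ} (hB : 1 ≤ B) (j : ℕ) (s : State) (hs : s.Bdd B)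
    (hj : s.reg 10 = j) (h1 : (s.reg 1 * 4 ^ j).size ≤ B) :
    ∃ t s', Exec growLoop s t s' ∧ t ≤ (j + 1) * (40 * B) ∧ s'.Bdd B ∧ s'.mem = s.mem ∧
      s'.reg 1 = s.reg 1 * 4 ^ j ∧ ∀ r, r ≠ 1 → r ≠ 10 → s'.reg r = s.reg r := by
  have hc : ∀ s : State, s.Bdd B → (Expr.reg 10).cost s ≤ 2 * B := fun s hs =>
    (Expr.reg 10).cost_le hs hB
  induction j generalizing s with
  | zero =>
    have := hc s hs
    exact ⟨_, s, .loop_done (by simpa using hj), by omega, hs, rfl, by simp, fun _ _ _ => rfl⟩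
  | succ j ih =>
    set s₁ := s.setReg 1 (s.reg 1 * 4) with hs₁
    have hs₁B : s₁.Bdd B := hs.setReg 1 <| (Nat.size_le_size (by
      rw [pow_succ', ← mul_assoc]
      exact Nat.le_mul_of_pos_right _ (by positivity))).trans h1
    set s₂ := s₁.setReg 10 j with hs₂
    have hs₂B : s₂.Bdd B := hs₁B.setReg 10 <| (Nat.size_le_size (by omega : j ≤ s.reg 10)).trans
      (hs.1 10)
    have e₁ : Exec (.assign 1 (.reg 1 * 4)) s (1 + (Expr.reg 1 * 4).cost s) s₁ :=
      Exec.assign 1 (.reg 1 * 4) s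
    have e₂ : Exec (.assign 10 (.reg 10 - 1)) s₁ (1 + (Expr.reg 10 - 1).cost s₁) s₂ := by
      have hj' : (Expr.reg 10 - 1).eval s₁ = j := by simp [hs₁, hj]
      have := Exec.assign 10 (.reg 10 - 1) s₁
      rwa [hj'] at this
    have c₁ := (Expr.reg 1 * 4).cost_le hs hB
    have c₂ := (Expr.reg 10 - 1).cost_le hs₁B hB
    have w₁ : (Expr.reg 1 * 4).weight = 14 := by decide
    have w₂ : (Expr.reg 10 - 1).weight = 10 := by decide
    rw [w₁] at c₁
    rw [w₂] at c₂
    obtain ⟨t, s', ht, htle, hB', hm, hr1, hr⟩ := ih s₂ hs₂B (by simp [hs₂]) (by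
      simpa [hs₂, hs₁, pow_succ', mul_assoc] using h1)
    have := hc s hs
    refine ⟨_, s', .loop_step (by simp [hj]) (e₁.seq e₂) ht, ?_, hB', hm, ?_, ?_⟩
    · rw [Nat.succ_mul]; omega
    · simp [hr1, hs₂, hs₁, pow_succ', mul_assoc]
    · intro r h1 h10
      rw [hr r h1 h10]; simp [hs₂, hs₁, h1, h10]

theorem exec_growProg {B : ℕ} (s : State) (hs : s.Bdd B) (hB9 : 9 ≤ B)
    (h1 : (256 * 4 ^ s.reg 0).size ≤ B) :
    ∃ t s', Exec growProg s t s' ∧ t ≤ (s.reg 0 + 2) * (40 * B) ∧ s'.Bdd B ∧ s'.mem = s.mem ∧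
      s'.reg 1 = 256 * 4 ^ s.reg 0 ∧ ∀ r, r ≠ 1 → r ≠ 10 → s'.reg r = s.reg r := by
  have hB : 1 ≤ B := by omega
  set s₁ := s.setReg 1 256 with hs₁
  have hs₁B : s₁.Bdd B := hs.setReg 1 (le_trans (by decide) hB9)
  set s₂ := s₁.setReg 10 (s.reg 0) with hs₂
  have hs₂B : s₂.Bdd B := hs₁B.setReg 10 (hs.1 0)
  have e₁ : Exec (.assign 1 (.const 256)) s (1 + (Expr.const 256).cost s) s₁ :=
    Exec.assign 1 (.const 256) s
  have e₂ : Exec (.assign 10 (.reg 0)) s₁ (1 + (Expr.reg 0).cost s₁) s₂ := by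
    have h0 : (Expr.reg 0).eval s₁ = s.reg 0 := by simp [hs₁]
    have := Exec.assign 10 (.reg 0) s₁
    rwa [h0] at this
  have c₁ : (Expr.const 256).cost s = 10 := by simp only [Expr.cost]; decide
  have c₂ : (Expr.reg 0).cost s₁ ≤ 2 * B := (Expr.reg 0).cost_le hs₁B hB
  obtain ⟨t, s', ht, htle, hB', hm, hr1, hr⟩ := exec_growLoop hB (s.reg 0) s₂ hs₂B
    (by simp [hs₂]) (by simpa [hs₂, hs₁] using h1)
  refine ⟨_, s', e₁.seq (e₂.seq ht), ?_, hB', hm, ?_, ?_⟩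
  · rw [Nat.succ_mul] at htle ⊢; rw [Nat.succ_mul]; omega
  · simp [hr1, hs₂, hs₁]
  · intro r h1 h10
    rw [hr r h1 h10]; simp [hs₂, hs₁, h1, h10]

/-- The extra entry number n is needed because n - ⌊n/3⌋ equals n when n < 3. -/
def powerCmd : Cmd :=
  set 8 1 ;; forTo 12 0 (put 0 (.reg 12) (.reg 8) ;; set 8 (.reg 8 * 2)) ;;
    put 0 (.reg 0) (.reg 8)

def paramCmd : Cmd :=
  set 3 ((.reg 0 + 2) * (.reg 0 + 2)) ;; set 7 (.reg 0 / 3) ;; set 6 (2 * .reg 7) ;;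
    set 9 (.reg 0 + 1)

/-- Computation of the parameters. -/
def setupCmd : Cmd :=
  powerCmd ;; paramCmd ;; set 4 (.get 0 (.reg 6)) ;; set 5 (2 * .get 0 (.reg 0 - .reg 7))

theorem powerCmd_spec {s : State} (hs : Ctx n E M s) :
    (powerCmd.den s).reg 8 = 2 ^ n ∧ ∀ v ≤ n, (powerCmd.den s).arr 0 v = 2 ^ v := by
  have hM := hs.pow_le
  have hMn := hs.le
  set s₁ := (set 8 1).den s with hs₁
  have hF₁ := framed_den (set 8 1) rfl (by decide) s
  have h₁ : Ctx n E M s₁ := hs.framed hF₁ (by decide)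
  have := for_induction (i := 12) (b := 0)
    (p := put 0 (.reg 12) (.reg 8) ;; set 8 (.reg 8 * 2)) s₁ rfl (by decide)
    (fun k s' => s'.reg 8 = 2 ^ k ∧ ∀ v < k, s'.arr 0 v = 2 ^ v) ?_ ?_
  · rw [h₁.reg_zero] at this
    have hF₂ := framed_den (forTo 12 0 (put 0 (.reg 12) (.reg 8) ;; set 8 (.reg 8 * 2))) rfl
      (by decide) s₁
    set s₂ := (forTo 12 0 (put 0 (.reg 12) (.reg 8) ;; set 8 (.reg 8 * 2))).den s₁ with hs₂
    have h₂ : Ctx n E M s₂ := h₁.framed hF₂ (by decide)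
    have hden : powerCmd.den s = (put 0 (.reg 0) (.reg 8)).den s₂ := rfl
    rw [hden]
    refine ⟨by simp [this.1], fun v hv => ?_⟩
    simp only [Nat.ofNat_pos, arr_put, Expr.eval_reg, h₂.reg_zero, true_and, this.1, h₂.reg_one]
    split_ifs with hvn
    · rw [hvn]; omega
    · exact this.2 v (by omega)
  · simp [hs₁, hs.reg_one]; omega
  · intro k hk s' hF hk' hI
    rw [h₁.reg_zero] at hk
    have h' := h₁.framed hF (by decide)
    have hp : 2 ^ k * 2 ≤ 2 ^ n := by
      rw [← pow_succ]; exact Nat.pow_le_pow_right (by norm_num) hk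
    constructor
    · simp [hI.1, h'.reg_one, pow_succ]; omega
    · intro v hv
      simp [hk', hI.1, h'.reg_one]
      split_ifs with hvk
      · rw [hvk]; omega
      · exact hI.2 v (by omega)

theorem setupCmd_spec {s : State} (hs : Ctx n E M s) : Setup n (n / 3) E M (setupCmd.den s) := by
  have hM := hs.pow_le
  have hMn := hs.le
  have hsq := hs.sq_le
  have hsq' : (n + 2) * (n + 2) ≤ M := le_trans (by gcongr <;> omega) hsq
  set s₁ := powerCmd.den s with hs₁
  have hF₁ := framed_den powerCmd rfl (by decide) s
  have h₁ : Ctx n E M s₁ := hs.framed hF₁ (by decide)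
  have hp := powerCmd_spec hs
  rw [← hs₁] at hp
  set s₂ := paramCmd.den s₁ with hs₂
  have hF₂ := framed_den paramCmd rfl (by decide) s₁
  have h₂ : Ctx n E M s₂ := h₁.framed hF₂ (by decide)
  have r3 : s₂.reg 3 = (n + 2) * (n + 2) := by
    simp [hs₂, paramCmd, h₁.reg_zero, h₁.reg_one]; omega
  have r7 : s₂.reg 7 = n / 3 := by
    simp [hs₂, paramCmd, h₁.reg_zero, h₁.reg_one]; omega
  have r6 : s₂.reg 6 = 2 * (n / 3) := by
    simp [hs₂, paramCmd, h₁.reg_zero, h₁.reg_one]; omega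
  have r9 : s₂.reg 9 = n + 1 := by
    simp [hs₂, paramCmd, h₁.reg_zero, h₁.reg_one]; omega
  have hp2 : ∀ v ≤ n, s₂.arr 0 v = 2 ^ v := fun v hv => by
    rw [hF₂.arr 0 (by norm_num) (by decide), hp.2 v hv]
  have r8 : s₂.reg 8 = 2 ^ n := by rw [hF₂.reg 8 (by decide), hp.1]
  have hF₃ := framed_den (set 4 (.get 0 (.reg 6)) ;; set 5 (2 * .get 0 (.reg 0 - .reg 7))) rfl
    (by decide) s₂
  have hden : setupCmd.den s =
    (set 4 (.get 0 (.reg 6)) ;; set 5 (2 * .get 0 (.reg 0 - .reg 7))).den s₂ := rfl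
  have q1 : 2 ^ (2 * (n / 3)) ≤ 2 ^ n := Nat.pow_le_pow_right (by norm_num) (by omega)
  have q2 : 2 ^ (n - n / 3) ≤ 2 ^ n := Nat.pow_le_pow_right (by norm_num) (by omega)
  rw [← hden] at hF₃
  refine ⟨h₂.framed hF₃ (by decide), by omega, ?_, ?_, ?_, ?_, ?_, ?_, ?_, fun v hv => ?_⟩
  · rw [hF₃.reg 3 (by decide), r3]
  · rw [hden]
    simp [r6, hp2 _ (by omega : 2 * (n / 3) ≤ n), h₂.reg_one]; omega
  · rw [hden]
    simp [r7, h₂.reg_zero, hp2 _ (by omega : n - n / 3 ≤ n), h₂.reg_one]; omega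
  · rw [hF₃.reg 6 (by decide), r6]
  · rw [hF₃.reg 7 (by decide), r7]
  · rw [hF₃.reg 8 (by decide), r8]
  · rw [hF₃.reg 9 (by decide), r9]
  · rw [hF₃.arr 0 (by norm_num) (by decide), hp2 v hv.le]

def initCmd : Cmd := set 2 (.reg 0 * .reg 0) ;; setupCmd

def solveCmd : Cmd := searchCmd ;; relabelCmd ;; tableCmd ;; outputCmd

/-! ### Correctness of the whole algorithm -/

/-- The set of the vertices before position `i`. -/
def initial (n : ℕ) (pos : ℕ → ℕ) (i : ℕ) : Finset ℕ := {v ∈ range n | pos v < i}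

theorem solveCmd_spec {s : State} (hs : Setup n h E M s) (h3 : ∀ i, s.arr 3 i = 0)
    {P : ℕ → Finset ℕ} (hP : ∀ i ≤ n, P i ⊆ range n) (hP0 : P 0 = ∅) (hPn : P n = range n)
    (hstep : ∀ i < n, ∃ v ∉ P i, P (i + 1) = insert v (P i))
    (hc : ∀ i ≤ n, #(boundary n E (P i)) ≤ c) (hcn : c ≤ n) :
    Suffix n (2 * c) E ∅ (solveCmd.den s).mem := by
  have hMn := hs.toCtx.le
  have hMsq := hs.sq_le
  have hle := hs.le
  obtain ⟨b1, b2⟩ := searchCmd_spec hs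
  have hF₁ := framed_den searchCmd rfl (by decide) s
  set s₁ := searchCmd.den s with hs₁
  have h₁ : Setup n h E M s₁ := hs.framed hF₁ (by decide) (by decide)
  -- The prefix that splits W evenly competes in the search, so the set found has boundary at most
  -- `c`.
  obtain ⟨i, hi, hi'⟩ := exists_card_inter_eq (h := h) (W := range (2 * h)) hP0 hstep (by
    rw [hPn, inter_eq_right.2 (range_mono hle), card_range]; omega)
  have h22 : s₁.reg 22 ≤ c := (b2 (P i) (hP i hi) hi').trans (hc i hi)
  obtain ⟨d1, d2, d3⟩ := b1 (h22.trans hcn)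
  set S := decode n (s₁.arr 0) (s₁.reg 23) with hS
  have hSn : S ⊆ range n := filter_subset _ _
  obtain ⟨r1, p, hp, hpS⟩ := relabelCmd_spec h₁
  rw [← hS] at r1 hpS
  have hF₂ := framed_den relabelCmd rfl (by decide) s₁
  set s₂ := relabelCmd.den s₁ with hs₂
  have h₂ : Setup n h E M s₂ := h₁.framed hF₂ (by decide) (by decide)
  have h3₂ : ∀ i, s₂.arr 3 i = 0 := fun i => by
    rw [hF₂.arr 3 (by norm_num) (by decide), hF₁.arr 3 (by norm_num) (by decide), h3]
  have ht := tableCmd_spec h₂ r1 d2 d3 (fun v hv => by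
    rw [hp.eq v hv]; exact Nat.one_le_two_pow) h3₂
  have hF₃ := framed_den tableCmd rfl (by decide) s₂
  set s₃ := tableCmd.den s₂ with hs₃
  have h₃ : Setup n h E M s₃ := h₂.framed hF₃ (by decide) (by decide)
  have ha1 : s₃.arr 1 = s₂.arr 1 := by funext i; exact hF₃.arr 1 (by norm_num) (by decide) i
  rw [← ha1] at ht hp
  -- One `c` accounts for the boundary of `S`, the other for that of the prefix.
  have htop := ht.top_le hp (c := 2 * c) hSn hpS le_rfl hP hP0 hPn hstep (fun i hi => by
    have := hc i hi
    omega)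
  exact outputCmd_spec h₃ hp ht htop.1 htop.2 (by nlinarith)

/-- The adjacency relation of a digraph on `{0, …, n - 1}` as a relation between numbers. -/
def adjacency {n : ℕ} (G : Digraph (Fin n)) (u v : ℕ) : Prop :=
  ∃ (hu : u < n) (hv : v < n), G.Adj ⟨u, hu⟩ ⟨v, hv⟩

theorem ncard_cut (G : Digraph (Fin n)) (π : Fin n ≃ Fin n) {pos : ℕ → ℕ}
    (hpos : ∀ v : Fin n, pos v = π v) (i : ℕ) :
    Set.ncard {v : Fin n | (π v : ℕ) < i ∧ ∃ u : Fin n, i ≤ (π u : ℕ) ∧ G.Adj u v} =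
      #(boundary n (adjacency G) (initial n pos i)) := by
  rw [← Set.ncard_image_of_injective _ Fin.val_injective, ← Set.ncard_coe_finset]
  congr 1
  ext v
  simp only [Set.mem_image, Set.mem_ofPred_eq, mem_coe, mem_boundary, initial, mem_filter,
    mem_range]
  constructor
  · rintro ⟨w, ⟨h1, u, hu, huw⟩, rfl⟩
    refine ⟨w.2, ⟨w.2, by rwa [hpos]⟩, u, u.2, ?_, u.2, w.2, huw⟩
    rw [hpos]
    omega
  · rintro ⟨hv, ⟨-, h1⟩, u, hu, h2, hu', hv', hadj⟩
    have e1 := hpos ⟨v, hv⟩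
    have e2 := hpos ⟨u, hu⟩
    simp only at e1 e2
    exact ⟨⟨v, hv⟩, ⟨by omega, ⟨u, hu⟩, by omega, hadj⟩, rfl⟩

theorem card_boundary_initial_le (G : Digraph (Fin n)) (π : Fin n ≃ Fin n) {pos : ℕ → ℕ}
    (hpos : ∀ v : Fin n, pos v = π v) {i : ℕ} (hi : i ≤ n) :
    #(boundary n (adjacency G) (initial n pos i)) ≤ orderingWidth G π := by
  -- The cuts at 0 and `n` do not enter the width, but their boundaries are empty.
  by_cases h0 : i = 0
  · simp [h0, initial, boundary_empty]
  by_cases hn : i = n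
  · have : initial n pos i = range n := by
      refine filter_true_of_mem fun v hv => ?_
      have hv := mem_range.1 hv
      have := hpos ⟨v, hv⟩
      simp only at this
      rw [this, hn]
      exact (π ⟨v, hv⟩).2
    simp [this, boundary_range]
  rw [← ncard_cut G π hpos]
  exact le_sup (f := fun i =>
    Set.ncard {v : Fin n | (π v : ℕ) < i ∧ ∃ u : Fin n, i ≤ (π u : ℕ) ∧ G.Adj u v})
    (mem_Icc.2 ⟨by omega, by omega⟩)

theorem exists_initial_succ (π : Fin n ≃ Fin n) {pos : ℕ → ℕ}
    (hpos : ∀ v : Fin n, pos v = π v) {i : ℕ} (hi : i < n) :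
    ∃ v ∉ initial n pos i, initial n pos (i + 1) = insert v (initial n pos i) := by
  have e := hpos (π.symm ⟨i, hi⟩)
  rw [Equiv.apply_symm_apply] at e
  refine ⟨π.symm ⟨i, hi⟩, by simp [initial, e], ?_⟩
  ext v
  simp only [initial, mem_filter, mem_range, mem_insert]
  constructor
  · rintro ⟨hv, hlt⟩
    rcases Nat.lt_succ_iff_lt_or_eq.1 hlt with h | h
    · exact .inr ⟨hv, h⟩
    · left
      have e' := hpos ⟨v, hv⟩
      have : π ⟨v, hv⟩ = ⟨i, hi⟩ := Fin.ext (by rw [← e']; exact h)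
      rw [← this, Equiv.symm_apply_apply]
  · rintro (rfl | ⟨hv, hlt⟩)
    · exact ⟨Fin.is_lt _, by rw [e]; simp⟩
    · exact ⟨hv, by omega⟩

theorem ctx_of_graphInput (G : Digraph (Fin n)) {s : State} (hm : s.mem = (graphInput G).mem)
    (h0 : s.reg 0 = n) (h1 : s.reg 1 = 256 * 4 ^ n) (h2 : s.reg 2 = n * n) :
    Ctx n (adjacency G) (256 * 4 ^ n) s where
  reg_zero := h0
  reg_one := h1
  reg_two := h2
  sq_le := by
    have h : n < 2 ^ n := Nat.lt_two_pow_self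
    have e : (4 : ℕ) ^ n = 2 ^ n * 2 ^ n := by rw [← mul_pow]; norm_num
    have : n + 4 ≤ 4 * 2 ^ n := by omega
    calc (n + 4) * (n + 4) ≤ (4 * 2 ^ n) * (4 * 2 ^ n) := Nat.mul_le_mul this this
      _ = 16 * 4 ^ n := by rw [e]; ring
      _ ≤ _ := by gcongr; norm_num
  pow_le := by
    have : 2 ^ n ≤ 4 ^ n := Nat.pow_le_pow_left (by norm_num) n
    omega
  le_one u hu v hv := by
    rw [hm]
    simp only [graphInput]
    split_ifs <;> omega
  adj u hu v hv := by
    rw [hm]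
    have key : ∀ u' v' : Fin n, u * n + v = (u' : ℕ) * n + v' → u = u' ∧ v = v' := by
      intro u' v' he
      have hn : 0 < n := by omega
      have h1 : (u * n + v) / n = u := by
        rw [mul_comm, Nat.mul_add_div hn, Nat.div_eq_of_lt hv, add_zero]
      have h2 : ((u' : ℕ) * n + v') / n = u' := by
        rw [mul_comm, Nat.mul_add_div hn, Nat.div_eq_of_lt v'.2, add_zero]
      have : u = u' := by rw [← h1, he, h2]
      subst this
      exact ⟨rfl, by omega⟩
    simp only [graphInput, adjacency]
    constructor
    · intro h
      split_ifs at h with hex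
      · obtain ⟨u', v', he, hadj⟩ := hex
        obtain ⟨rfl, rfl⟩ := key u' v' he
        exact ⟨u'.2, v'.2, hadj⟩
    · rintro ⟨hu', hv', hadj⟩
      rw [if_pos ⟨⟨u, hu⟩, ⟨v, hv⟩, rfl, hadj⟩]

theorem graphInput_mem_eq_zero (G : Digraph (Fin n)) {a : ℕ} (ha : n * n ≤ a) :
    (graphInput G).mem a = 0 := by
  simp only [graphInput]
  rw [if_neg]
  rintro ⟨u, v, rfl, -⟩
  have := mul_add_lt u.2 v.2
  omega

theorem graphInput_bdd (G : Digraph (Fin n)) : (graphInput G).Bdd (2 * n + 9) := by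
  refine ⟨fun r => ?_, fun a => ?_⟩ <;> simp only [graphInput] <;> split_ifs
  · rw [Nat.size_le]
    exact Nat.lt_two_pow_self.trans_le (Nat.pow_le_pow_right (by norm_num) (by omega))
  all_goals simp

theorem initCmd_spec (G : Digraph (Fin n)) {s : State} (hm : s.mem = (graphInput G).mem)
    (h0 : s.reg 0 = n) (h1 : s.reg 1 = 256 * 4 ^ n) :
    Setup n (n / 3) (adjacency G) (256 * 4 ^ n) (initCmd.den s) ∧
      ∀ i, (initCmd.den s).arr 3 i = 0 := by
  have hc : Ctx n (adjacency G) (256 * 4 ^ n) (s.setReg 2 (n * n)) :=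
    ctx_of_graphInput G (by simpa using hm) (by simpa using h0) (by simpa using h1) (by simp)
  have hMn := hc.sq_le
  have he : (set 2 (.reg 0 * .reg 0)).den s = s.setReg 2 (n * n) := by
    rw [den_set, Expr.eval_mul, Expr.eval_reg, h0, h1, min_eq_left]
    generalize 256 * 4 ^ n = M at hMn
    nlinarith
  rw [initCmd, den_seq, he]
  refine ⟨setupCmd_spec hc, fun i => ?_⟩
  have hF := framed_den setupCmd rfl (by decide) (s.setReg 2 (n * n))
  rw [hF.arr 3 (by norm_num) (by decide), State.arr, State.mem_setReg, hm]
  exact graphInput_mem_eq_zero G (by simp)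

theorem solveCmd_correct (G : Digraph (Fin n)) {h M : ℕ} {s : State}
    (hs : Setup n h (adjacency G) M s) (h3 : ∀ i, s.arr 3 i = 0) :
    ∃ π : Fin n ≃ Fin n, OutputsOrdering (solveCmd.den s) π ∧
      orderingWidth G π ≤ 2 * directedPathwidth G := by
  obtain ⟨σ, hσ⟩ : ∃ σ : Fin n ≃ Fin n, orderingWidth G σ = directedPathwidth G :=
    Nat.sInf_mem (Set.range_nonempty _)
  set q : ℕ → ℕ := fun v => if hv : v < n then σ ⟨v, hv⟩ else 0 with hq
  have hqσ : ∀ v : Fin n, q v = σ v := fun v => by simp [hq]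
  have hwn : directedPathwidth G ≤ n := by
    rw [← hσ]
    refine Finset.sup_le fun i _ => ?_
    rw [ncard_cut G σ hqσ]
    exact card_boundary_le _ _ _
  have hsuf := solveCmd_spec hs h3 (P := initial n q) (c := directedPathwidth G)
    (fun i _ => filter_subset _ _) (by simp [initial])
    (filter_true_of_mem fun v hv => by
      have hv := mem_range.1 hv
      rw [hqσ ⟨v, hv⟩]; exact Fin.is_lt _)
    (fun i hi => exists_initial_succ σ hqσ hi)
    (fun i hi => hσ ▸ card_boundary_initial_le G σ hqσ hi) hwn
  rw [show OutputsOrdering (solveCmd.den s) = fun π : Fin n ≃ Fin n =>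
    ∀ v : Fin n, (solveCmd.den s).mem v = (π v : ℕ) from rfl]
  generalize (solveCmd.den s).mem = m at hsuf
  have hlt : ∀ v : Fin n, m v < n := fun v => hsuf.pos_lt v v.2 (by simp)
  set f : Fin n → Fin n := fun v => ⟨m v, hlt v⟩ with hf
  have hinj : Function.Injective f := fun u v huv => Fin.ext <|
    hsuf.inj u u.2 v v.2 (by simp) (by simp) (Fin.ext_iff.1 huv)
  refine ⟨Equiv.ofBijective f (Finite.injective_iff_bijective.1 hinj), fun v => rfl, ?_⟩
  refine Finset.sup_le fun i hi => ?_
  have hi := mem_Icc.1 hi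
  rw [ncard_cut G _ (pos := m) fun v => rfl]
  simpa [initial] using hsuf.width i (by omega) (by simp)

/-! ### Running time -/

/-- Bounds for the registers that bound the loops. -/
def bound (n r : ℕ) : ℕ :=
  if r = 0 then n else if r = 3 then (n + 2) * (n + 2) else if r = 9 then n + 1
  else if r = 4 then 2 ^ (2 * (n / 3)) else if r = 5 then 2 * 2 ^ (n - n / 3) else 0

/-- The running time is within a polynomial factor of `2 ^ (n - n / 3)`. -/
def Feasible (p : Cmd) : Prop :=
  ∃ k d : ℕ, ∀ n, p.time (bound n) ≤ k * (n + 2) ^ d * 2 ^ (n - n / 3)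

theorem Feasible.seq {p q : Cmd} (hp : Feasible p) (hq : Feasible q) : Feasible (p ;; q) := by
  obtain ⟨k₁, d₁, h₁⟩ := hp
  obtain ⟨k₂, d₂, h₂⟩ := hq
  refine ⟨k₁ + k₂, d₁ + d₂, fun n => ?_⟩
  rw [time, add_mul, add_mul]
  refine add_le_add ((h₁ n).trans ?_) ((h₂ n).trans ?_) <;> gcongr <;> omega

theorem poly_time (p : Cmd) (hb : ∀ b ∈ p.bounds, b = 0 ∨ b = 3 ∨ b = 9) :
    ∃ k d : ℕ, ∀ n, p.time (bound n) ≤ k * (n + 2) ^ d := by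
  obtain ⟨k, d, h⟩ := p.time_le_pow
  refine ⟨k, 2 * d, fun n => ?_⟩
  rw [pow_mul]
  refine h _ _ (Nat.one_le_pow _ _ (by omega)) fun b hb' => ?_
  rcases hb b hb' with rfl | rfl | rfl <;> simp [bound] <;> nlinarith

theorem feasible_of_poly (p : Cmd) (hb : ∀ b ∈ p.bounds, b = 0 ∨ b = 3 ∨ b = 9) :
    Feasible p := by
  obtain ⟨k, d, h⟩ := poly_time p hb
  exact ⟨k, d, fun n => (h n).trans (Nat.le_mul_of_pos_right _ (by positivity))⟩

/-- The search has 2^(2h) ≤ 2^(n-h) rounds because 3h ≤ n; this balance dictates h = ⌊n/3⌋. The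
bodies are polynomial, and no two exponential loops are nested. -/
theorem feasible_forTo (i : ℕ) {b : ℕ} (p : Cmd) (hp : ∀ b ∈ p.bounds, b = 0 ∨ b = 3 ∨ b = 9)
    (hb : b = 4 ∨ b = 5) : Feasible (forTo i b p) := by
  obtain ⟨k, d, h⟩ := poly_time p hp
  set x := (Expr.reg b - Expr.reg i).weight with hx
  set y := (Expr.reg i + 1).weight with hy
  refine ⟨3 + x + 2 * (2 + x + y + k), d, fun n => ?_⟩
  set N := 2 ^ (n - n / 3) with hN
  have hN1 : 1 ≤ N := Nat.one_le_two_pow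
  have hd : 1 ≤ (n + 2) ^ d := Nat.one_le_pow _ _ (by omega)
  have hbN : bound n b ≤ 2 * N := by
    have : 2 ^ (2 * (n / 3)) ≤ N := Nat.pow_le_pow_right (by norm_num) (by omega)
    rcases hb with rfl | rfl <;> simp [bound]
    · omega
    · exact le_rfl
  change 3 + x + bound n b * (2 + x + y + p.time (bound n)) ≤ _
  calc
    3 + x + bound n b * (2 + x + y + p.time (bound n))
      ≤ (3 + x) * ((n + 2) ^ d * N) +
        2 * N * ((2 + x + y) * (n + 2) ^ d + k * (n + 2) ^ d) := by
        refine add_le_add (Nat.le_mul_of_pos_right _ (by positivity)) ?_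
        refine Nat.mul_le_mul hbN (add_le_add (Nat.le_mul_of_pos_right _ (by positivity)) (h n))
    _ = _ := by ring

theorem feasible_solve : Feasible solveCmd := by
  refine .seq (.seq (feasible_of_poly _ (by decide)) (feasible_forTo 10 _ (by decide) (.inl rfl)))
    (.seq (feasible_of_poly _ (by decide)) (.seq (.seq (feasible_of_poly _ (by decide))
      (.seq (feasible_of_poly _ (by decide)) (feasible_forTo 13 _ (by decide) (.inr rfl))))
      (feasible_of_poly _ (by decide))))

theorem two_pow_le (n : ℕ) : (2 : ℝ) ^ (n - n / 3) ≤ 4 * 1.6 ^ n := by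
  obtain ⟨m, i, hi, rfl⟩ : ∃ m i, i < 3 ∧ n = 3 * m + i :=
    ⟨n / 3, n % 3, Nat.mod_lt _ (by norm_num), (Nat.div_add_mod n 3).symm⟩
  have e : 3 * m + i - (3 * m + i) / 3 = 2 * m + i := by omega
  rw [e, pow_add, pow_mul, pow_add, pow_mul]
  -- The rate 1.6 works because 1.6³ = 4.096 exceeds 4.
  have h1 : ((2 : ℝ) ^ 2) ^ m ≤ (1.6 ^ 3) ^ m := by gcongr; norm_num
  have h2 : (2 : ℝ) ^ i ≤ 4 * 1.6 ^ i := by interval_cases i <;> norm_num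
  calc ((2 : ℝ) ^ 2) ^ m * 2 ^ i ≤ (1.6 ^ 3) ^ m * (4 * 1.6 ^ i) := by gcongr
    _ = _ := by ring

theorem exists_const (k d : ℕ) :
    ∃ C : ℝ, ∀ n : ℕ, ((k * (n + 2) ^ d * 2 ^ (n - n / 3) : ℕ) : ℝ) ≤ C * 1.66 ^ n := by
  have hr : (1 : ℝ) < 1.66 / 1.6 := by norm_num
  -- The gap between 1.6 and 1.66 absorbs the polynomial factor. The bound is used at n + 2, which
  -- costs the factor (1.66/1.6)² in the constant.
  obtain ⟨K, hK⟩ := (tendsto_pow_const_div_const_pow_of_one_lt d hr).bddAbove_range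
  refine ⟨k * K * (1.66 / 1.6) ^ 2 * 4, fun n => ?_⟩
  have h1 : ((n + 2 : ℕ) : ℝ) ^ d / (1.66 / 1.6) ^ (n + 2) ≤ K := hK ⟨n + 2, rfl⟩
  rw [div_le_iff₀ (by positivity)] at h1
  have h2 := two_pow_le n
  have e : (1.66 : ℝ) ^ n = (1.66 / 1.6) ^ n * 1.6 ^ n := by
    rw [← mul_pow]; norm_num
  push_cast at h1 ⊢
  calc (k : ℝ) * (n + 2) ^ d * 2 ^ (n - n / 3)
      ≤ k * (K * (1.66 / 1.6) ^ (n + 2)) * (4 * 1.6 ^ n) := by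
        gcongr
        exact mul_nonneg (Nat.cast_nonneg _) (le_trans (by positivity) h1)
    _ = k * K * (1.66 / 1.6) ^ 2 * 4 * ((1.66 / 1.6) ^ n * 1.6 ^ n) := by ring
    _ = _ := by rw [e]

end DirectedPathwidth

open DirectedPathwidth RAM RAM.Cmd in
theorem mainTheorem3 :
    ∃ (P : RAM.Prog) (C : ℝ), ∀ (n : ℕ) (G : Digraph (Fin n)), (∀ v : Fin n, ¬ G.Adj v v) →
      ∃ (t : ℕ) (s : RAM.State) (π : Fin n ≃ Fin n),
        RAM.Exec P (RAM.graphInput G) t s ∧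
        (t : ℝ) ≤ C * (1.66 : ℝ) ^ n ∧
        RAM.OutputsOrdering s π ∧
        orderingWidth G π ≤ 2 * directedPathwidth G := by
  obtain ⟨k, d, htime⟩ := (feasible_of_poly initCmd (by decide)).seq feasible_solve
  -- The 9 comes from B ≤ 9(n + 2), the 40 from the cost of computing the threshold, and `k` from
  -- the counting programs.
  obtain ⟨C, hC⟩ := exists_const (9 * (40 + k)) (d + 2)
  refine ⟨.seq growProg (.seq initCmd.compile solveCmd.compile), C, fun n G _ => ?_⟩
  set B := 2 * n + 9 with hB
  have hreg0 : (graphInput G).reg 0 = n := rfl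
  -- The threshold is 2^(2n+8), which has exactly 2n + 9 bits.
  have hsize : (256 * 4 ^ n).size ≤ B := by
    rw [Nat.size_le, hB, show 2 * n + 9 = 2 * n + 8 + 1 by rfl, pow_succ, pow_add, pow_mul]
    have : 0 < 4 ^ n := by positivity
    norm_num
    omega
  obtain ⟨t₀, s₀, e₀, ht₀, hb₀, hm₀, r1, hr₀⟩ := exec_growProg (graphInput G) (graphInput_bdd G)
    (by omega) (by rwa [hreg0])
  have r0 : s₀.reg 0 = n := by rw [hr₀ 0 (by norm_num) (by norm_num), hreg0]
  rw [hreg0] at r1 ht₀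
  obtain ⟨hsetup, h3⟩ := initCmd_spec G hm₀ r0 r1
  obtain ⟨π, hπ, hw⟩ := solveCmd_correct G hsetup h3
  rw [← hB] at ht₀
  obtain ⟨t₁, e₁, ht₁, hb₁⟩ := exec_den initCmd (by decide) (bound n) (B := B) (by omega)
    (by decide) hb₀ (fun b hb => by
      have : ∀ b ∈ initCmd.bounds, b = 0 := by decide
      rw [this b hb, r0]
      simp [bound])
  obtain ⟨t₂, e₂, ht₂, -⟩ := exec_den solveCmd (by decide) (bound n) (B := B) (by omega)
    (by decide) hb₁ (fun b hb => by
      have : ∀ b ∈ solveCmd.bounds, b = 0 ∨ b = 3 ∨ b = 4 ∨ b = 5 ∨ b = 9 := by decide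
      rcases this b hb with rfl | rfl | rfl | rfl | rfl
      · simp [bound, hsetup.reg_zero]
      · simp [bound, hsetup.reg_three]
      · simp [bound, hsetup.reg_four]
      · simp [bound, hsetup.reg_five]
      · simp [bound, hsetup.reg_nine])
  refine ⟨_, _, π, e₀.seq (e₁.seq e₂), le_trans (Nat.cast_le.2 ?_) (hC n), hπ, hw⟩
  have h1 := htime n
  rw [time] at h1
  set N := 2 ^ (n - n / 3) with hN
  have hN1 : 1 ≤ N := Nat.one_le_two_pow
  have hd1 : 1 ≤ (n + 2) ^ d := Nat.one_le_pow _ _ (by omega)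
  have hBn : B ≤ 9 * (n + 2) := by omega
  calc t₀ + (t₁ + t₂)
      ≤ (n + 2) * (40 * B) + (k * (n + 2) ^ d * N) * B := by
        have := Nat.mul_le_mul_right B h1
        rw [add_mul] at this
        omega
    _ ≤ (n + 2) * (40 * (9 * (n + 2))) * ((n + 2) ^ d * N) +
        (k * (n + 2) ^ d * N) * (9 * (n + 2)) * (n + 2) := by
        refine add_le_add ?_ ?_
        · calc (n + 2) * (40 * B) ≤ (n + 2) * (40 * (9 * (n + 2))) := by gcongr
            _ ≤ _ := Nat.le_mul_of_pos_right _ (by positivity)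
        · calc k * (n + 2) ^ d * N * B ≤ k * (n + 2) ^ d * N * (9 * (n + 2)) := by gcongr
            _ ≤ _ := Nat.le_mul_of_pos_right _ (by positivity)
    _ = _ := by ring
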